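/- **Setup.** For each sample size $n\ge 1$ let $(\Omega_n,P_n)$ be a probability space carrying the sample; all objects below are indexed by $n$ (index suppressed), and $o_p,O_p$ refer to $n\to\infty$. Let $d\ge 1$ be the parameter dimension, $d\to\infty$ as $n\to\infty$; $\Theta\subset\mathbb R^d$ a measurable parameter space, $\theta_0\in\mathbb R^d$, $s$ a random vector in $\mathbb R^d$, and $\Lambda=\sqrt n(\Theta-\theta_0)-s$ the local parameter space. Let $\ell$ be a (random) nonnegative integrable function on $\Lambda$, $f=\ell/\int_\Lambda\ell$, and let $\phi_J(\lambda)=(2\pi)^{-d/2}\det(J^{-1})^{-1/2}e^{-\lambda'J\lambda/2}$. Let $K=\{\lambda\in\mathbb R^d:\|\lambda\|\le R\}$, $R>0$, let $\|v\|_J=\sqrt{v'Jv}$, $\|K\|_J=\sup_{v\in K}\|v\|_J$, and let $\lambda_{\min}$ be the smallest eigenvalue of $J$. Let $q(x|u)$ be a jointly measurable proposal density (a probability density in $x$ for each $u\in K$; it may depend on the sample). The Metropolis walk on $K$ has the one-step distributions $$P_u(A)=\int_{K\cap A}\min\Big\{\tfrac{f(x)q(u|x)}{f(u)q(x|u)},1\Big\}q(x|u)\,dx+(1-p_u)1_u(A),\qquad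 p_u=\int_K\min\Big\{\tfrac{f(x)q(u|x)}{f(u)q(x|u)},1\Big\}q(x|u)\,dx .$$ Let $Q(A)=\int_{A\cap K}f/\int_Kf$, and let $Q_t$ be the law after $t$ steps from a starting distribution $Q_0$ on $K$. The conductance of the chain is $$\varphi=\inf_{A:\,0<Q(A)<1}\frac{\int_AP_u(K\setminus A)\,dQ(u)}{\min\{Q(A),Q(K\setminus A)\}},$$ the infimum over measurable $A\subset K$. The distribution $Q_0$ is $M$-warm if $\sup_{Q(A)>0}Q_0(A)/Q(A)=M<\infty$, and $\|\mu-\nu\|_{TV}=\sup_A|\mu(A)-\nu(A)|$. **Conditions.** * C.1: $s$ has mean zero and a covariance matrix whose eigenvalues are bounded above uniformly in $n$; $K\subset\Lambda$; $\int_Kf\ge 1-o_p(1)$ and $\int_K\phi_J\ge 1-o(1)$. * C.2: $\ell$ is lower semicontinuous; $J$ is a symmetric positive definite $d\times d$ matrix with eigenvalues bounded away from $0$ and from above uniformly in $n$; and there are (random) $\epsilon_1,\epsilon_2>0$ such that $\ell>0$ on $K$ and $\left|\ln\ell(\lambda)+\tfrac12\lambda'J\lambda\right|\le\epsilon_1+\epsilon_2\lambda'J\lambda/2$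 for all $\lambda\in K$. * C.3: $\epsilon_1=o_p(1)$ and $\epsilon_2\|K\|_J^2=o_p(1)$. * D.1: there are positive $h_n,c_n$ (possibly depending on the sample) such that for all $u,v\in K$, $\|u-v\|\le h_n$ implies $\|P_u-P_v\|_{TV}<1-c_n$. * D.2: $\dfrac1{c_n\min\{h_n\sqrt{\lambda_{\min}},1\}}=O_p(d)$. Conditions on realizations are understood almost surely for each $n$. **Theorem.** There is an absolute constant $C>0$ such that the following holds. Under C.1, C.2 and D.1, for every $n$, almost surely, $$\frac1\varphi\le C\,\frac{e^{2(\epsilon_1+\epsilon_2\|K\|_J^2/2)}}{c_n\min\{h_n\sqrt{\lambda_{\min}},1\}},$$ and for every $\varepsilon\in(0,1)$, every $M$ and every $M$-warm starting distribution $Q_0$ on $K$ there is an integer $$0\le N_\varepsilon\le C\,e^{4(\epsilon_1+\epsilon_2\|K\|_J^2/2)}\,\frac{\ln(M/\varepsilon)}{(c_n\min\{h_n\sqrt{\lambda_{\min}},1\})^2}$$ such that $\|Q_t-Q\|_{TV}\le\varepsilon$ for all $t\ge N_\varepsilon$. If moreover C.3 and D.2 hold, then $1/\varphi=O_p(d)$,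 and $N_\varepsilon=O_p(d^2\ln(M/\varepsilon))$: for every $\eta>0$ there is $B>0$ such that for all large $n$, outside an event of probability at most $\eta$, for every $\varepsilon\in(0,1)$, every $M$ and every $M$-warm $Q_0$ on $K$ there is an integer $0\le N_\varepsilon\le B\,d^2\ln(M/\varepsilon)$ with $\|Q_t-Q\|_{TV}\le\varepsilon$ for all $t\ge N_\varepsilon$. -/

import Mathlib

open MeasureTheory Filter Topology
open scoped ENNReal Matrix

universe u

noncomputable section

namespace QuasiBayes


/-! ### Euclidean space, the quadratic form of `J`, the normal density -/

/-- Euclidean space of dimension `d`. -/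
abbrev E (d : ℕ) : Type := EuclideanSpace ℝ (Fin d)

/-- The quadratic form `x' J x`. -/
def quadForm {d : ℕ} (J : Matrix (Fin d) (Fin d) ℝ) (x : E d) : ℝ :=
  x.ofLp ⬝ᵥ (J *ᵥ x.ofLp)

/-- The ellipsoidal norm `‖x‖_J = ‖J^{1/2} x‖ = √(x' J x)`. -/
def ellNorm {d : ℕ} (J : Matrix (Fin d) (Fin d) ℝ) (x : E d) : ℝ :=
  Real.sqrt (quadForm J x)

/-- `‖K‖_J = sup_{x ∈ K} ‖x‖_J`. -/
def setNormJ {d : ℕ} (J : Matrix (Fin d) (Fin d) ℝ) (K : Set (E d)) : ℝ :=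
  sSup (ellNorm J '' K)

/-- The smallest eigenvalue of `J`. -/
def lambdaMin {d : ℕ} (J : Matrix (Fin d) (Fin d) ℝ) : ℝ :=
  sInf (spectrum ℝ J)

/-- The density of the normal distribution `N(0, J⁻¹)`. -/
def normalDensity {d : ℕ} (J : Matrix (Fin d) (Fin d) ℝ) (x : E d) : ℝ :=
  1 / ((2 * Real.pi) ^ ((d : ℝ) / 2) * Real.sqrt (J⁻¹).det) *
    Real.exp (-(1 / 2) * quadForm J x)

/-! ### The Metropolis chain on a set `K` -/

section Chain

/-- The total variation distance `sup_A |μ(A) - ν(A)|`, over measurable `A`. -/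
def tvDist {X : Type*} [MeasurableSpace X] (μ ν : Measure X) : ℝ :=
  ⨆ A : {A : Set X // MeasurableSet A}, |μ.real A.1 - ν.real A.1|

/-- The distribution on `K` induced by `f`: `Q(A) = ∫_{A ∩ K} f / ∫_K f`. -/
def target {d : ℕ} (K : Set (E d)) (f : E d → ℝ) : Measure (E d) :=
  (∫⁻ x in K, ENNReal.ofReal (f x))⁻¹ •
    (volume.restrict K).withDensity (fun x => ENNReal.ofReal (f x))

/-- The density at `x` of an accepted move from `u`, where `q u x` is the density `q(x|u)`
at the candidate `x` of the proposal from `u`. Where `q(x|u) = 0` the value is `0`. -/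
def moveDensity {d : ℕ} (f : E d → ℝ) (q : E d → E d → ℝ) (u x : E d) : ℝ :=
  min (f x * q x u / (f u * q u x)) 1 * q u x

/-- The probability `p_u` of a proper move from `u`. -/
def moveProb {d : ℕ} (K : Set (E d)) (f : E d → ℝ) (q : E d → E d → ℝ) (u : E d) : ℝ≥0∞ :=
  ∫⁻ x in K, ENNReal.ofReal (moveDensity f q u x)

/-- The one-step distribution `P_u` of the Metropolis walk restricted to `K`. -/
def oneStep {d : ℕ} (K : Set (E d)) (f : E d → ℝ) (q : E d → E d → ℝ) (u : E d) :
    Measure (E d) :=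
  (volume.restrict K).withDensity (fun x => ENNReal.ofReal (moveDensity f q u x)) +
    (1 - moveProb K f q u) • Measure.dirac u

/-- The distribution `Q_t` after `t` steps with one-step distributions `P`, started from `Q₀`:
`Q_{t+1}(A) = ∫ P_u(A) dQ_t(u)`. -/
def chainLaw {X : Type*} [MeasurableSpace X] (P : X → Measure X) (Q₀ : Measure X) :
    ℕ → Measure X
  | 0 => Q₀
  | t + 1 => (chainLaw P Q₀ t).bind P

/-- The ergodic flow `Φ(A) = ∫_A P_u(K \ A) dQ(u)`. -/
def ergodicFlow {X : Type*} [MeasurableSpace X] (K : Set X) (P : X → Measure X)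
    (Q : Measure X) (A : Set X) : ℝ≥0∞ :=
  ∫⁻ u in A, P u (K \ A) ∂Q

/-- The global conductance: the infimum of `Φ(A) / min {Q(A), Q(K \ A)}` over measurable
`A ⊆ K` with `0 < Q(A) < 1`. -/
def conductance {X : Type*} [MeasurableSpace X] (K : Set X) (P : X → Measure X)
    (Q : Measure X) : ℝ≥0∞ :=
  ⨅ (A : Set X) (_ : MeasurableSet A) (_ : A ⊆ K) (_ : 0 < Q A) (_ : Q A < 1),
    ergodicFlow K P Q A / min (Q A) (Q (K \ A))

/-- `Q₀` is `M`-warm with respect to `Q`: `sup_{A : Q(A) > 0} Q₀(A) / Q(A) = M`. -/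
def IsWarm {X : Type*} [MeasurableSpace X] (Q₀ Q : Measure X) (M : ℝ) : Prop :=
  ⨆ (A : Set X) (_ : MeasurableSet A) (_ : 0 < Q A), Q₀ A / Q A = ENNReal.ofReal M

/-- For every accuracy `ε ∈ (0,1)`, every `M` and every `M`-warm starting distribution on `K`,
at most `b * ln (M / ε)` steps of the chain bring its distribution (for good) within total
variation distance `ε` of `Q`. -/
def SamplesWithin {X : Type*} [MeasurableSpace X] (K : Set X) (P : X → Measure X)
    (Q : Measure X) (b : ℝ) : Prop :=
  ∀ (ε M : ℝ) (Q₀ : Measure X), 0 < ε → ε < 1 → IsProbabilityMeasure Q₀ → Q₀ Kᶜ = 0 →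
    IsWarm Q₀ Q M →
      ∃ N : ℕ, (N : ℝ) ≤ b * Real.log (M / ε) ∧
        ∀ t : ℕ, N ≤ t → tvDist (chainLaw P Q₀ t) Q ≤ ε

end Chain

/-! ### Stochastic order symbols

The sample of size `n` lives on its own probability space `(Ω n, P n)`. -/

/-- `X_n = o_p(1)`. -/
def IsLittleOp {Ω : ℕ+ → Type u} [∀ n, MeasurableSpace (Ω n)] (P : ∀ n, Measure (Ω n))
    (X : ∀ n, Ω n → ℝ) : Prop :=
  ∀ δ : ℝ, 0 < δ → Tendsto (fun n => P n {ω | δ < |X n ω|}) atTop (𝓝 0)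

/-- `X_n = O_p(a_n)`, for nonnegative, possibly infinite `X_n`. -/
def IsBigOp {Ω : ℕ+ → Type u} [∀ n, MeasurableSpace (Ω n)] (P : ∀ n, Measure (Ω n))
    (X : ∀ n, Ω n → ℝ≥0∞) (a : ℕ+ → ℝ) : Prop :=
  ∀ η : ℝ, 0 < η → ∃ B : ℝ, 0 < B ∧
    ∀ᶠ n in atTop, P n {ω | ENNReal.ofReal (B * a n) < X n ω} ≤ ENNReal.ofReal η

/-! ### The statistical model and its Metropolis walk -/

/-- The data of the problem, indexed by the sample size `n`; what depends on the sample is a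
function of `ω : Ω n`. -/
structure Setup (Ω : ℕ+ → Type u) where
  /-- parameter dimension -/
  d : ℕ+ → ℕ
  /-- parameter space -/
  Θ : ∀ n, Set (E (d n))
  /-- true parameter value -/
  θ₀ : ∀ n, E (d n)
  /-- normalized first order approximation of the extremum estimator -/
  s : ∀ n, Ω n → E (d n)
  /-- localized likelihood or criterion function -/
  ℓ : ∀ n, Ω n → E (d n) → ℝ
  /-- radius of the approximate support set -/
  R : ℕ+ → ℝ
  /-- matrix of the limiting quadratic form -/
  J : ∀ n, Matrix (Fin (d n)) (Fin (d n)) ℝ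
  /-- approximation error (local discontinuities) -/
  ε₁ : ∀ n, Ω n → ℝ
  /-- approximation error (tilting away from the quadratic form) -/
  ε₂ : ∀ n, Ω n → ℝ
  /-- proposal densities: `q n ω u x` is `q(x|u)` -/
  q : ∀ n, Ω n → E (d n) → E (d n) → ℝ
  /-- the distance `h_n` -/
  h : ∀ n, Ω n → ℝ
  /-- the overlap `c_n` -/
  c : ∀ n, Ω n → ℝ

namespace Setup

variable {Ω : ℕ+ → Type u}

/-- The local parameter space `Λ = √n (Θ - θ₀) - s`. -/
def Lam (S : Setup Ω) (n : ℕ+) (ω : Ω n) : Set (E (S.d n)) :=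
  (fun θ => Real.sqrt (n : ℕ) • (θ - S.θ₀ n) - S.s n ω) '' S.Θ n

/-- The approximate support set, the closed ball `K = B(0, ‖K‖)`. -/
def K (S : Setup Ω) (n : ℕ+) : Set (E (S.d n)) :=
  Metric.closedBall 0 (S.R n)

/-- The quasi-posterior density `f = ℓ / ∫_Λ ℓ` on `Λ`, extended by `0`. -/
def f (S : Setup Ω) (n : ℕ+) (ω : Ω n) : E (S.d n) → ℝ :=
  (S.Lam n ω).indicator fun x => S.ℓ n ω x / ∫ y in S.Lam n ω, S.ℓ n ω y

/-- The target distribution `Q` on `K`. -/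
def Q (S : Setup Ω) (n : ℕ+) (ω : Ω n) : Measure (E (S.d n)) :=
  target (S.K n) (S.f n ω)

/-- The one-step distributions `P_u`. -/
def step (S : Setup Ω) (n : ℕ+) (ω : Ω n) : E (S.d n) → Measure (E (S.d n)) :=
  oneStep (S.K n) (S.f n ω) (S.q n ω)

/-- The global conductance of the chain. -/
def cond (S : Setup Ω) (n : ℕ+) (ω : Ω n) : ℝ≥0∞ :=
  conductance (S.K n) (S.step n ω) (S.Q n ω)

/-- The deviation `ε₁ + ε₂ ‖K‖_J² / 2`. -/
def dev (S : Setup Ω) (n : ℕ+) (ω : Ω n) : ℝ :=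
  S.ε₁ n ω + S.ε₂ n ω * setNormJ (S.J n) (S.K n) ^ 2 / 2

/-- The quantity `c_n min {h_n √λ_min, 1}`. -/
def geo (S : Setup Ω) (n : ℕ+) (ω : Ω n) : ℝ :=
  S.c n ω * min (S.h n ω * Real.sqrt (lambdaMin (S.J n))) 1

variable [∀ n, MeasurableSpace (Ω n)]

/-- What is understood throughout: the dimension is positive and grows to infinity, `ℓ` is
nonnegative and integrable over the measurable set `Λ` (so that the quasi-posterior is defined),
and for each `u ∈ K` the proposal `q(·|u)` is a probability density, jointly measurable. -/
structure Standing (S : Setup Ω) (P : ∀ n, Measure (Ω n)) : Prop where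
  d_pos : ∀ n, 1 ≤ S.d n
  d_tendsto : Tendsto S.d atTop atTop
  measurable_Θ : ∀ n, MeasurableSet (S.Θ n)
  ℓ_nonneg : ∀ n, ∀ᵐ ω ∂P n, ∀ x ∈ S.Lam n ω, 0 ≤ S.ℓ n ω x
  ℓ_integrable : ∀ n, ∀ᵐ ω ∂P n, IntegrableOn (S.ℓ n ω) (S.Lam n ω)
  q_measurable : ∀ n, ∀ᵐ ω ∂P n, Measurable fun p : E (S.d n) × E (S.d n) => S.q n ω p.1 p.2
  q_nonneg : ∀ n, ∀ᵐ ω ∂P n, ∀ u ∈ S.K n, ∀ x, 0 ≤ S.q n ω u x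
  q_density : ∀ n, ∀ᵐ ω ∂P n, ∀ u ∈ S.K n, ∫⁻ x, ENNReal.ofReal (S.q n ω u x) = 1

/-- Condition on `s`, on the local parameter space and on the approximate support set. -/
structure C1 (S : Setup Ω) (P : ∀ n, Measure (Ω n)) : Prop where
  s_memLp : ∀ n, MemLp (S.s n) 2 (P n)
  s_mean : ∀ n, ∫ ω, S.s n ω ∂P n = 0
  s_cov : ∃ B : ℝ, ∀ n,
    spectrum ℝ (Matrix.of fun i j : Fin (S.d n) =>
      ProbabilityTheory.covariance (fun ω => S.s n ω i) (fun ω => S.s n ω j) (P n)) ⊆ Set.Iic B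
  R_pos : ∀ n, 0 < S.R n
  K_subset : ∀ n, ∀ᵐ ω ∂P n, S.K n ⊆ S.Lam n ω
  f_mass : IsLittleOp P fun n ω => 1 - ∫ x in S.K n, S.f n ω x
  normal_mass : Tendsto (fun n => 1 - ∫ x in S.K n, normalDensity (S.J n) x) atTop (𝓝 0)

/-- `ln ℓ` is close to `-x' J x / 2` uniformly on `K`. -/
structure C2 (S : Setup Ω) (P : ∀ n, Measure (Ω n)) : Prop where
  J_posDef : ∀ n, (S.J n).PosDef
  J_eigenvalues : ∃ a b : ℝ, 0 < a ∧ ∀ n, spectrum ℝ (S.J n) ⊆ Set.Icc a b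
  ε₁_pos : ∀ n, ∀ᵐ ω ∂P n, 0 < S.ε₁ n ω
  ε₂_pos : ∀ n, ∀ᵐ ω ∂P n, 0 < S.ε₂ n ω
  ℓ_lsc : ∀ n, ∀ᵐ ω ∂P n, LowerSemicontinuousOn (S.ℓ n ω) (S.Lam n ω)
  ℓ_approx : ∀ n, ∀ᵐ ω ∂P n, ∀ x ∈ S.K n, 0 < S.ℓ n ω x ∧
    |Real.log (S.ℓ n ω x) - (-(1 / 2) * quadForm (S.J n) x)| ≤
      S.ε₁ n ω + S.ε₂ n ω * quadForm (S.J n) x / 2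

/-- The approximation errors vanish: `ε₁ = o_p(1)` and `ε₂ ‖K‖_J² = o_p(1)`. -/
structure C3 (S : Setup Ω) (P : ∀ n, Measure (Ω n)) : Prop where
  ε₁_small : IsLittleOp P S.ε₁
  ε₂_small : IsLittleOp P fun n ω => S.ε₂ n ω * setNormJ (S.J n) (S.K n) ^ 2

/-- The geometric condition: points of `K` within distance `h_n` have one-step distributions
within total variation distance less than `1 - c_n`. -/
structure D1 (S : Setup Ω) (P : ∀ n, Measure (Ω n)) : Prop where
  h_pos : ∀ n, ∀ᵐ ω ∂P n, 0 < S.h n ω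
  c_pos : ∀ n, ∀ᵐ ω ∂P n, 0 < S.c n ω
  overlap : ∀ n, ∀ᵐ ω ∂P n, ∀ u ∈ S.K n, ∀ v ∈ S.K n, ‖u - v‖ ≤ S.h n ω →
    tvDist (S.step n ω u) (S.step n ω v) < 1 - S.c n ω

/-- The rate `1 / (c_n min {h_n √λ_min, 1}) = O_p(d)`. -/
def D2 (S : Setup Ω) (P : ∀ n, Measure (Ω n)) : Prop :=
  IsBigOp P (fun n ω => ENNReal.ofReal (1 / S.geo n ω)) fun n => (S.d n : ℝ)

end Setup

end QuasiBayes

end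

/-!
On the ball `K` the quasi-posterior density is, up to a constant, within the factor
`exp (2 * dev)` of the Gaussian `exp (-x'Jx/2)`, so the bounds reduce to a geometric fact about
Gaussian measures restricted to balls, and to a spectral argument for reversible chains.

*Isoperimetry.* Let `γ` be the restricted Gaussian and `s ^ 2` a positive lower bound for the
eigenvalues of `J`. If two sets are at distance `h`, the rest of the ball has measure at least
`min (s h) 1 / 48` times the smaller of their measures (`gaussBall_isoperimetry`), whatever the
dimension. The Prékopa–Leindler inequality (`prekopaLeindler_euclidean`), combined with the
parallelogram identity for `x'Jx`, shows that `γ` has a strengthened form of log-concavity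
(`StronglyLogConcave`), which passes to restrictions to convex sets and to images under linear
contractions. In dimension one it gives the isoperimetric inequality directly
(`StronglyLogConcave.isoperimetry_real`). The dimension is lowered by localization
(`isoperimetryInDim`): the ball is cut by hyperplanes into finitely many convex pieces, each
containing the same proportion of the first set, until the shadow of each piece on a fixed plane
avoids a fine net. A planar convex set that contains no small disc lies in a thin strip
(`exists_strip_of_forall_ball_not_subset`), so each piece lies in a thin slab, and projecting it
along the thin direction gives the inequality on the piece; the inequalities add up because the
pieces are balanced. The factor `exp (2 * dev)` is lost in passing from `γ` to the target `Q`
(`MetropolisData.target_isoperimetry`).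

*Conductance.* Take `A` measurable. Points of `A` that leave it with small probability and points of
`Aᶜ` that enter `A` with small probability have one-step distributions far apart in total variation,
so by the overlap condition they are at distance more than `h`. By isoperimetry the remaining points
have mass comparable with `min (Q A) (Q Aᶜ)`, and each contributes to the flow (`flow_ge`).

*Mixing.* The walk need not be lazy, so the spectrum of its kernel `κ` near `-1` has to be
controlled as well. The contraction of `κ` in `L²(Q)` is governed by `κ²`, and the two-step flow
`∫ κ(x, A) κ(x, Aᶜ) dQ` from `A` to `Aᶜ` has a lower bound of the same kind (`two_step_flow_ge`): the
points with `κ(x, A)` near `1` and those with `κ(x, A)` near `0` are again far apart, and all others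
contribute. Cheeger's inequality (`cheeger`) for `κ²` then yields a contraction of the variance of
densities by `1 - φ² / 2` per step (`tvDist_chainLaw_le`). A warm start has a bounded density
(`IsWarm.exists_density`), whence the logarithmic number of steps.
-/

noncomputable section

namespace QuasiBayes

/-! ### The Prékopa–Leindler inequality for midpoints -/

/-- The Brunn–Minkowski inequality on the line for nonempty compact sets. -/
lemma volume_add_le_of_isCompact {A B Z : Set ℝ} (hA : IsCompact A) (hB : IsCompact B)
    (hA0 : A.Nonempty) (hB0 : B.Nonempty) (h : ∀ x ∈ A, ∀ y ∈ B, (2⁻¹ : ℝ) * (x + y) ∈ Z) :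
    volume A + volume B ≤ 2 * volume Z := by
  obtain ⟨a, haA, ha⟩ := hA.exists_isGreatest hA0
  obtain ⟨b, hbB, hb⟩ := hB.exists_isLeast hB0
  have vol : ∀ (S : Set ℝ) (c : ℝ), 2 * volume ((fun z : ℝ => 2 * z - c) ⁻¹' S) = volume S := by
    intro S c
    have : (fun z : ℝ => 2 * z - c) ⁻¹' S = (fun z : ℝ => 2 * z) ⁻¹' ((fun z => z + -c) ⁻¹' S) := by
      ext z; simp [sub_eq_add_neg]
    rw [this, Real.volume_preimage_mul_left two_ne_zero, measure_preimage_add_right, ← mul_assoc]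
    rw [show |(2 : ℝ)⁻¹| = 2⁻¹ by norm_num, ENNReal.ofReal_inv_of_pos two_pos]
    simp [ENNReal.mul_inv_cancel]
  set A' := (fun z : ℝ => 2 * z - b) ⁻¹' A
  set B' := (fun z : ℝ => 2 * z - a) ⁻¹' B
  have hB'm : MeasurableSet B' := (by fun_prop : Measurable fun z : ℝ => 2 * z - a) hB.measurableSet
  have hsub : A' ∪ B' ⊆ Z := by
    rintro z (hz | hz)
    · have := h _ hz b hbB
      ring_nf at this; simpa using this
    · have := h a haA _ hz
      ring_nf at this; simpa using this
  have hint : volume (A' ∩ B') = 0 := by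
    refine measure_mono_null (t := {2⁻¹ * (a + b)}) ?_ (by simp)
    rintro z ⟨h1, h2⟩
    have h3 := ha h1
    have h4 := hb h2
    simp only at h3 h4
    rw [Set.mem_singleton_iff]; linarith
  calc volume A + volume B = 2 * (volume A' + volume B') := by rw [mul_add, vol, vol]
    _ = 2 * volume (A' ∪ B') := by rw [← measure_union_add_inter A' hB'm, hint, add_zero]
    _ ≤ _ := by gcongr

/-- The Brunn–Minkowski inequality on the line. -/
lemma volume_add_le_two_mul {A B Z : Set ℝ} (hA : MeasurableSet A) (hB : MeasurableSet B)
    (hA0 : A.Nonempty) (hB0 : B.Nonempty) (h : ∀ x ∈ A, ∀ y ∈ B, (2⁻¹ : ℝ) * (x + y) ∈ Z) :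
    volume A + volume B ≤ 2 * volume Z := by
  obtain ⟨a, ha⟩ := hA0
  obtain ⟨b, hb⟩ := hB0
  have key : ∀ K ⊆ A, IsCompact K → ∀ L ⊆ B, IsCompact L →
      volume K + volume L ≤ 2 * volume Z := by
    intro K hK hKc L hL hLc
    calc volume K + volume L ≤ volume (insert a K) + volume (insert b L) := by
          gcongr <;> exact Set.subset_insert _ _
      _ ≤ _ := by
          refine volume_add_le_of_isCompact (hKc.insert a) (hLc.insert b) (by simp) (by simp) ?_
          intro x hx y hy
          exact h x (Set.insert_subset ha hK hx) y (Set.insert_subset hb hL hy)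
  rw [hA.measure_eq_iSup_isCompact, hB.measure_eq_iSup_isCompact]
  simp_rw [iSup_and']
  refine ENNReal.biSup_add_biSup_le' ⟨∅, by simp⟩ ⟨∅, by simp⟩ ?_
  rintro K ⟨hK, hKc⟩ L ⟨hL, hLc⟩
  exact key K hK hKc L hL hLc

/-- Functions on the line whose supremum is `1`: Brunn–Minkowski for the superlevel sets,
integrated over the levels. -/
lemma lintegral_add_le_of_sup_eq_one {F G H : ℝ → ℝ} (hF : Measurable F) (hG : Measurable G)
    (hH : Measurable H) (hF0 : ∀ x, 0 ≤ F x) (hG0 : ∀ x, 0 ≤ G x) (hH0 : ∀ x, 0 ≤ H x)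
    (hF1 : ∀ x, F x ≤ 1) (hG1 : ∀ x, G x ≤ 1)
    (hFs : ∀ t < 1, ∃ x, t < F x) (hGs : ∀ t < 1, ∃ x, t < G x)
    (h : ∀ x y, F x * G y ≤ H (2⁻¹ * (x + y)) ^ 2) :
    (∫⁻ x, ENNReal.ofReal (F x)) + ∫⁻ x, ENNReal.ofReal (G x) ≤
      2 * ∫⁻ x, ENNReal.ofReal (H x) := by
  rw [lintegral_eq_lintegral_meas_lt _ (ae_of_all _ hF0) hF.aemeasurable,
    lintegral_eq_lintegral_meas_lt _ (ae_of_all _ hG0) hG.aemeasurable,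
    lintegral_eq_lintegral_meas_lt _ (ae_of_all _ hH0) hH.aemeasurable]
  have anti : ∀ F : ℝ → ℝ, Measurable fun t => volume {x | t < F x} := fun F =>
    Antitone.measurable fun s t hst => measure_mono fun x hx => lt_of_le_of_lt hst hx
  rw [← lintegral_add_left (anti F), ← lintegral_const_mul _ (anti H)]
  refine setLIntegral_mono ((anti H).const_mul 2) ?_
  intro t ht
  rcases lt_or_ge t 1 with h1 | h1
  · refine volume_add_le_two_mul (measurableSet_lt measurable_const hF)
      (measurableSet_lt measurable_const hG) (hFs t h1) (hGs t h1) ?_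
    intro x hx y hy
    have hx' : t < F x := hx
    have hy' : t < G y := hy
    have ht' : 0 < t := ht
    refine lt_of_pow_lt_pow_left₀ 2 (hH0 _) (lt_of_lt_of_le ?_ (h x y))
    nlinarith
  · have e1 : {x | t < F x} = ∅ := by
      ext x; simpa using (hF1 x).trans h1
    have e2 : {x | t < G x} = ∅ := by
      ext x; simpa using (hG1 x).trans h1
    simp [e1, e2]

/-- The Prékopa–Leindler inequality with equal weights, as a property of a measure. -/
def PrekopaLeindler {V : Type*} [AddCommGroup V] [Module ℝ V] [MeasurableSpace V]
    (μ : Measure V) : Prop :=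
  ∀ f g h : V → ℝ≥0∞, Measurable f → Measurable g → Measurable h →
    (∀ x y, f x * g y ≤ h ((2⁻¹ : ℝ) • (x + y)) ^ 2) →
      (∫⁻ x, f x ∂μ) * (∫⁻ x, g x ∂μ) ≤ (∫⁻ x, h x ∂μ) ^ 2

lemma ENNReal.mul_le_sq_of_add_le {u v w : ℝ≥0∞} (h : u + v ≤ 2 * w) : u * v ≤ w ^ 2 := by
  rcases eq_or_ne w ∞ with rfl | hw
  · simp
  have h2 : u + v ≠ ∞ := ne_top_of_le_ne_top (ENNReal.mul_ne_top (by simp) hw) h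
  lift w to NNReal using hw
  lift u to NNReal using (ENNReal.add_ne_top.1 h2).1
  lift v to NNReal using (ENNReal.add_ne_top.1 h2).2
  norm_cast at h ⊢
  have h' : (u : ℝ) + v ≤ 2 * w := by exact_mod_cast h
  have : (u : ℝ) * v ≤ w ^ 2 := by nlinarith [sq_nonneg ((u : ℝ) - v), u.2, v.2, w.2]
  exact_mod_cast this

/-- The functions are divided by their suprema `α` and `β`, and `h` by `√(α β)`. The arithmetic
mean bound for the normalized functions is stronger than the geometric mean one. -/
lemma prekopaLeindler_real_of_bounded {f g h : ℝ → ℝ≥0∞} (hf : Measurable f) (hg : Measurable g)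
    (hh : Measurable h) {n : ℝ≥0∞} (hn : n ≠ ∞) (hfn : ∀ x, f x ≤ n) (hgn : ∀ x, g x ≤ n)
    (H : ∀ x y, f x * g y ≤ h (2⁻¹ * (x + y)) ^ 2) :
    (∫⁻ x, f x) * (∫⁻ x, g x) ≤ (∫⁻ x, h x) ^ 2 := by
  set a := ⨆ x, f x with ha
  set b := ⨆ x, g x with hb
  have ha' : a ≠ ∞ := ne_top_of_le_ne_top hn (iSup_le hfn)
  have hb' : b ≠ ∞ := ne_top_of_le_ne_top hn (iSup_le hgn)
  have hfa : ∀ x, f x ≤ a := fun x => le_iSup f x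
  have hgb : ∀ x, g x ≤ b := fun x => le_iSup g x
  rcases eq_or_ne a 0 with ha0 | ha0
  · have : ∀ x, f x = 0 := fun x => le_antisymm (ha0 ▸ hfa x) bot_le
    simp [this]
  rcases eq_or_ne b 0 with hb0 | hb0
  · have : ∀ x, g x = 0 := fun x => le_antisymm (hb0 ▸ hgb x) bot_le
    simp [this]
  set α := a.toReal with hα
  set β := b.toReal with hβ
  have hα0 : 0 < α := ENNReal.toReal_pos ha0 ha'
  have hβ0 : 0 < β := ENNReal.toReal_pos hb0 hb'
  set c := Real.sqrt (α * β) with hc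
  have hc0 : 0 < c := Real.sqrt_pos.2 (mul_pos hα0 hβ0)
  have hc2 : c ^ 2 = α * β := Real.sq_sqrt (mul_pos hα0 hβ0).le
  set F : ℝ → ℝ := fun x => (f x).toReal / α with hF
  set G : ℝ → ℝ := fun x => (g x).toReal / β with hG
  -- the cut-off at `c` keeps `K` real valued where `h` is infinite
  set K : ℝ → ℝ := fun x => (min (h x) (ENNReal.ofReal c)).toReal / c with hK
  have fin_f : ∀ x, f x ≠ ∞ := fun x => ne_top_of_le_ne_top ha' (hfa x)
  have fin_g : ∀ x, g x ≠ ∞ := fun x => ne_top_of_le_ne_top hb' (hgb x)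
  have fin_h : ∀ x, min (h x) (ENNReal.ofReal c) ≠ ∞ := fun x =>
    ne_top_of_le_ne_top ENNReal.ofReal_ne_top (min_le_right _ _)
  have key := lintegral_add_le_of_sup_eq_one (F := F) (G := G) (H := K)
    (hf.ennreal_toReal.div_const _) (hg.ennreal_toReal.div_const _)
    ((hh.min measurable_const).ennreal_toReal.div_const _)
    (fun x => by positivity) (fun x => by positivity) (fun x => by positivity)
    (fun x => (div_le_one hα0).2 (ENNReal.toReal_mono ha' (hfa x)))
    (fun x => (div_le_one hβ0).2 (ENNReal.toReal_mono hb' (hgb x)))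
    (fun t ht => by
      rcases lt_or_ge t 0 with h0 | h0
      · exact ⟨0, h0.trans_le (by positivity)⟩
      have : ENNReal.ofReal (t * α) < a := by
        rw [ENNReal.ofReal_lt_iff_lt_toReal (by positivity) ha']
        nlinarith
      obtain ⟨x, hx⟩ := lt_iSup_iff.1 this
      refine ⟨x, (lt_div_iff₀ hα0).2 ?_⟩
      rwa [ENNReal.ofReal_lt_iff_lt_toReal (by positivity) (fin_f x)] at hx)
    (fun t ht => by
      rcases lt_or_ge t 0 with h0 | h0
      · exact ⟨0, h0.trans_le (by positivity)⟩
      have : ENNReal.ofReal (t * β) < b := by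
        rw [ENNReal.ofReal_lt_iff_lt_toReal (by positivity) hb']
        nlinarith
      obtain ⟨x, hx⟩ := lt_iSup_iff.1 this
      refine ⟨x, (lt_div_iff₀ hβ0).2 ?_⟩
      rwa [ENNReal.ofReal_lt_iff_lt_toReal (by positivity) (fin_g x)] at hx)
    (fun x y => by
      have h1 : (f x).toReal * (g y).toReal ≤
          (min (h (2⁻¹ * (x + y))) (ENNReal.ofReal c)).toReal ^ 2 := by
        rw [← ENNReal.toReal_mul, ← ENNReal.toReal_pow]
        refine ENNReal.toReal_mono (ENNReal.pow_ne_top (fin_h _)) ?_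
        rcases min_choice (h (2⁻¹ * (x + y))) (ENNReal.ofReal c) with e | e
        · rw [e]; exact H x y
        · rw [e, ← ENNReal.ofReal_pow hc0.le, hc2, ENNReal.ofReal_mul hα0.le,
            ENNReal.ofReal_toReal ha', ENNReal.ofReal_toReal hb']
          exact mul_le_mul' (hfa x) (hgb y)
      simp only [hF, hG, hK]
      rw [div_mul_div_comm, div_pow, hc2]
      gcongr)
  have ef : ∫⁻ x, f x = ENNReal.ofReal α * ∫⁻ x, ENNReal.ofReal (F x) := by
    rw [← lintegral_const_mul' _ _ ENNReal.ofReal_ne_top]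
    refine lintegral_congr fun x => ?_
    rw [← ENNReal.ofReal_mul hα0.le, mul_div_cancel₀ _ hα0.ne', ENNReal.ofReal_toReal (fin_f x)]
  have eg : ∫⁻ x, g x = ENNReal.ofReal β * ∫⁻ x, ENNReal.ofReal (G x) := by
    rw [← lintegral_const_mul' _ _ ENNReal.ofReal_ne_top]
    refine lintegral_congr fun x => ?_
    rw [← ENNReal.ofReal_mul hβ0.le, mul_div_cancel₀ _ hβ0.ne', ENNReal.ofReal_toReal (fin_g x)]
  have eh : ENNReal.ofReal c * ∫⁻ x, ENNReal.ofReal (K x) ≤ ∫⁻ x, h x := by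
    rw [← lintegral_const_mul' _ _ ENNReal.ofReal_ne_top]
    refine lintegral_mono fun x => ?_
    rw [← ENNReal.ofReal_mul hc0.le, mul_div_cancel₀ _ hc0.ne', ENNReal.ofReal_toReal (fin_h x)]
    exact min_le_left _ _
  calc (∫⁻ x, f x) * (∫⁻ x, g x)
      = ENNReal.ofReal c ^ 2 *
          ((∫⁻ x, ENNReal.ofReal (F x)) * ∫⁻ x, ENNReal.ofReal (G x)) := by
        rw [ef, eg, ← ENNReal.ofReal_pow hc0.le, hc2, ENNReal.ofReal_mul hα0.le]; ring
    _ ≤ ENNReal.ofReal c ^ 2 * (∫⁻ x, ENNReal.ofReal (K x)) ^ 2 := by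
        gcongr; exact ENNReal.mul_le_sq_of_add_le key
    _ = (ENNReal.ofReal c * ∫⁻ x, ENNReal.ofReal (K x)) ^ 2 := by rw [mul_pow]
    _ ≤ _ := by gcongr

lemma prekopaLeindler_real : PrekopaLeindler (volume : Measure ℝ) := by
  intro f g h hf hg hh H
  simp only [smul_eq_mul] at H
  have lim : ∀ f : ℝ → ℝ≥0∞, Measurable f →
      Tendsto (fun n : ℕ => ∫⁻ x, min (f x) n) atTop (𝓝 (∫⁻ x, f x)) := by
    intro f hf
    refine lintegral_tendsto_of_tendsto_of_monotone
      (fun n => (hf.min measurable_const).aemeasurable) ?_ ?_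
    · exact ae_of_all _ fun x m n hmn => min_le_min le_rfl (by exact_mod_cast hmn)
    · refine ae_of_all _ fun x => ?_
      have : Tendsto (fun n : ℕ => min (f x) (n : ℝ≥0∞)) atTop (𝓝 (min (f x) ∞)) :=
        tendsto_const_nhds.min ENNReal.tendsto_nat_nhds_top
      simpa using this
  have bound : ∀ m n : ℕ, (∫⁻ x, min (f x) m) * (∫⁻ x, min (g x) n) ≤ (∫⁻ x, h x) ^ 2 := by
    intro m n
    refine prekopaLeindler_real_of_bounded (n := (max m n : ℕ)) (hf.min measurable_const)
      (hg.min measurable_const) hh (ENNReal.natCast_ne_top _) ?_ ?_ ?_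
    · exact fun x => (min_le_right _ _).trans (by exact_mod_cast le_max_left m n)
    · exact fun x => (min_le_right _ _).trans (by exact_mod_cast le_max_right m n)
    · exact fun x y => (mul_le_mul' (min_le_left _ _) (min_le_left _ _)).trans (H x y)
  have sup : ∀ f : ℝ → ℝ≥0∞, Measurable f → ∫⁻ x, f x = ⨆ n : ℕ, ∫⁻ x, min (f x) n := by
    intro f hf
    refine tendsto_nhds_unique (lim f hf) (tendsto_atTop_iSup fun m n hmn => ?_)
    exact lintegral_mono fun x => min_le_min le_rfl (by exact_mod_cast hmn)
  rw [sup f hf, sup g hg, ENNReal.iSup_mul]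
  refine iSup_le fun m => ?_
  rw [ENNReal.mul_iSup]
  exact iSup_le fun n => bound m n

section Tensor

variable {V W : Type*} [AddCommGroup V] [Module ℝ V] [MeasurableSpace V]
  [AddCommGroup W] [Module ℝ W] [MeasurableSpace W]

lemma PrekopaLeindler.prod {μ : Measure V} {ν : Measure W} [SFinite μ] [SFinite ν]
    (hμ : PrekopaLeindler μ) (hν : PrekopaLeindler ν) : PrekopaLeindler (μ.prod ν) := by
  intro f g h hf hg hh H
  rw [lintegral_prod _ hf.aemeasurable, lintegral_prod _ hg.aemeasurable,
    lintegral_prod _ hh.aemeasurable]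
  refine hμ _ _ _ hf.lintegral_prod_right' hg.lintegral_prod_right' hh.lintegral_prod_right' ?_
  intro x x'
  refine hν _ _ _ (hf.comp measurable_prodMk_left) (hg.comp measurable_prodMk_left)
    (hh.comp measurable_prodMk_left) fun y y' => ?_
  exact H (x, y) (x', y')

lemma PrekopaLeindler.of_measurePreserving {μ : Measure V} {ν : Measure W} (e : V →ₗ[ℝ] W)
    (he : MeasurePreserving e μ ν) (hμ : PrekopaLeindler μ) : PrekopaLeindler ν := by
  intro f g h hf hg hh H
  rw [← he.lintegral_comp hf, ← he.lintegral_comp hg, ← he.lintegral_comp hh]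
  refine hμ _ _ _ (hf.comp he.measurable) (hg.comp he.measurable) (hh.comp he.measurable) ?_
  intro x y
  simpa using H (e x) (e y)

end Tensor

lemma prekopaLeindler_pi : ∀ d : ℕ, PrekopaLeindler (volume : Measure (Fin d → ℝ)) := by
  intro d
  induction d with
  | zero =>
    intro f g h hf hg hh H
    rw [Measure.volume_pi_eq_dirac 0, lintegral_dirac' _ hf, lintegral_dirac' _ hg,
      lintegral_dirac' _ hh]
    simpa using H 0 0
  | succ d ih =>
    have h1 := prekopaLeindler_real.prod ih
    have h2 := (volume_preserving_piFinSuccAbove (fun _ : Fin (d + 1) => ℝ) 0).symm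
    refine h1.of_measurePreserving
      ((Fin.consLinearEquiv ℝ (fun _ : Fin (d + 1) => ℝ)) : (ℝ × (Fin d → ℝ)) →ₗ[ℝ] _) ?_
    have e : ⇑((Fin.consLinearEquiv ℝ (fun _ : Fin (d + 1) => ℝ)) : (ℝ × (Fin d → ℝ)) →ₗ[ℝ] _) =
        ⇑(MeasurableEquiv.piFinSuccAbove (fun _ : Fin (d + 1) => ℝ) 0).symm := by
      funext p
      exact (Fin.insertNth_zero' p.1 p.2).symm
    rw [e]
    exact h2

lemma prekopaLeindler_euclidean (d : ℕ) : PrekopaLeindler (volume : Measure (E d)) :=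
  (prekopaLeindler_pi d).of_measurePreserving
    ((WithLp.linearEquiv 2 ℝ (Fin d → ℝ)).symm : (Fin d → ℝ) →ₗ[ℝ] E d)
    (PiLp.volume_preserving_toLp (Fin d))

/-! ### Strongly log-concave measures -/

/-- Strong log-concavity of a measure with modulus `s ^ 2`, in a form that refers to sets only:
if `Z` contains all midpoints between `X` and `Y`, and `X` and `Y` are at distance at least `r`,
then `μ(Z)² ≥ exp((s r)² / 4) μ(X) μ(Y)`. Unlike a condition on a density, it is inherited at once
by restrictions to convex sets and by images under linear contractions. -/
def StronglyLogConcave {V : Type*} [NormedAddCommGroup V] [NormedSpace ℝ V] [MeasurableSpace V]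
    (s : ℝ) (μ : Measure V) : Prop :=
  ∀ X Y Z : Set V, MeasurableSet X → MeasurableSet Y → MeasurableSet Z → ∀ r : ℝ, 0 ≤ r →
    (∀ x ∈ X, ∀ y ∈ Y, r ≤ ‖x - y‖ ∧ (2⁻¹ : ℝ) • (x + y) ∈ Z) →
      ENNReal.ofReal (Real.exp ((s * r) ^ 2 / 4)) * (μ X * μ Y) ≤ μ Z ^ 2

section Stability

variable {V W : Type*} [NormedAddCommGroup V] [NormedSpace ℝ V] [MeasurableSpace V]
  [NormedAddCommGroup W] [NormedSpace ℝ W] [MeasurableSpace W]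

lemma StronglyLogConcave.restrict {s : ℝ} {μ : Measure V} (hμ : StronglyLogConcave s μ)
    {C : Set V} (hC : Convex ℝ C) (hCm : MeasurableSet C) :
    StronglyLogConcave s (μ.restrict C) := by
  intro X Y Z hX hY hZ r hr h
  rw [Measure.restrict_apply hX, Measure.restrict_apply hY, Measure.restrict_apply hZ]
  refine hμ _ _ _ (hX.inter hCm) (hY.inter hCm) (hZ.inter hCm) r hr ?_
  rintro x ⟨hx, hxC⟩ y ⟨hy, hyC⟩
  refine ⟨(h x hx y hy).1, (h x hx y hy).2, ?_⟩
  rw [smul_add]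
  exact hC hxC hyC (by norm_num) (by norm_num) (by norm_num)

lemma StronglyLogConcave.map {s : ℝ} {μ : Measure V} (hμ : StronglyLogConcave s μ)
    (p : V →ₗ[ℝ] W) (hp : Measurable p) (hp1 : ∀ x, ‖p x‖ ≤ ‖x‖) :
    StronglyLogConcave s (μ.map p) := by
  intro X Y Z hX hY hZ r hr h
  rw [Measure.map_apply hp hX, Measure.map_apply hp hY, Measure.map_apply hp hZ]
  refine hμ _ _ _ (hp hX) (hp hY) (hp hZ) r hr ?_
  intro x hx y hy
  obtain ⟨h1, h2⟩ := h _ hx _ hy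
  refine ⟨h1.trans ?_, ?_⟩
  · rw [← map_sub]; exact hp1 _
  · simpa using h2

end Stability

/-! ### Isoperimetry on the line -/

/-- The support of a log-concave measure on the line has no gaps. -/
lemma StronglyLogConcave.measure_Iio_eq_zero_or {s : ℝ} {μ : Measure ℝ}
    (hμ : StronglyLogConcave s μ) {a b : ℝ} (hab : a < b) (h0 : μ (Set.Ico a b) = 0) :
    μ (Set.Iio a) = 0 ∨ μ (Set.Ici b) = 0 := by
  by_contra! hcon
  obtain ⟨hL, hR⟩ := hcon
  -- `α` and `β` are the last point of the support before the gap and the first one after it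
  set T : Set ℝ := {y | μ (Set.Ico y a) = 0} with hT
  set U : Set ℝ := {y | μ (Set.Ico b y) = 0} with hU
  have haT : a ∈ T := by simp [hT]
  have hbU : b ∈ U := by simp [hU]
  have hTb : BddBelow T := by
    by_contra hnb
    apply hL
    rw [not_bddBelow_iff] at hnb
    have : Set.Iio a ⊆ ⋃ n : ℕ, Set.Ico (-(n : ℝ)) a := by
      intro x hx
      obtain ⟨n, hn⟩ := exists_nat_ge (-x)
      exact Set.mem_iUnion.2 ⟨n, by linarith, hx⟩
    refine measure_mono_null this (measure_iUnion_null fun n => ?_)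
    obtain ⟨y, hy, hyn⟩ := hnb (-(n : ℝ))
    exact measure_mono_null (Set.Ico_subset_Ico_left hyn.le) hy
  have hUb : BddAbove U := by
    by_contra hnb
    apply hR
    rw [not_bddAbove_iff] at hnb
    have : Set.Ici b ⊆ ⋃ n : ℕ, Set.Ico b (n : ℝ) := by
      intro x hx
      obtain ⟨n, hn⟩ := exists_nat_gt x
      exact Set.mem_iUnion.2 ⟨n, hx, hn⟩
    refine measure_mono_null this (measure_iUnion_null fun n => ?_)
    obtain ⟨y, hy, hyn⟩ := hnb (n : ℝ)
    exact measure_mono_null (Set.Ico_subset_Ico_right hyn.le) hy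
  set α := sInf T
  set β := sSup U
  have hαa : α ≤ a := csInf_le hTb haT
  have hbβ : b ≤ β := le_csSup hUb hbU
  have hα : μ (Set.Ioo α a) = 0 := by
    have : Set.Ioo α a ⊆ ⋃ n : ℕ, Set.Ico (α + 1 / ((n : ℝ) + 1)) a := by
      intro x hx
      obtain ⟨n, hn⟩ := exists_nat_one_div_lt (sub_pos.2 hx.1)
      exact Set.mem_iUnion.2 ⟨n, by linarith, hx.2⟩
    refine measure_mono_null this (measure_iUnion_null fun n => ?_)
    have hn : (0 : ℝ) < 1 / ((n : ℝ) + 1) := by positivity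
    obtain ⟨y, hy, hyn⟩ := exists_lt_of_csInf_lt ⟨a, haT⟩ (lt_add_of_pos_right α hn)
    exact measure_mono_null (Set.Ico_subset_Ico_left hyn.le) hy
  have hβ : μ (Set.Ico b β) = 0 := by
    have : Set.Ico b β ⊆ ⋃ n : ℕ, Set.Ico b (β - 1 / ((n : ℝ) + 1)) := by
      intro x hx
      obtain ⟨n, hn⟩ := exists_nat_one_div_lt (sub_pos.2 hx.2)
      exact Set.mem_iUnion.2 ⟨n, hx.1, by linarith⟩
    refine measure_mono_null this (measure_iUnion_null fun n => ?_)
    have hn : (0 : ℝ) < 1 / ((n : ℝ) + 1) := by positivity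
    obtain ⟨y, hy, hyn⟩ := exists_lt_of_lt_csSup ⟨b, hbU⟩ (sub_lt_self β hn)
    exact measure_mono_null (Set.Ico_subset_Ico_right hyn.le) hy
  have hZ : μ (Set.Ioo α β) = 0 := by
    have : Set.Ioo α β ⊆ Set.Ioo α a ∪ (Set.Ico a b ∪ Set.Ico b β) := by
      intro x hx
      rcases lt_or_ge x a with h | h
      · exact Or.inl ⟨hx.1, h⟩
      rcases lt_or_ge x b with h' | h'
      · exact Or.inr (Or.inl ⟨h, h'⟩)
      · exact Or.inr (Or.inr ⟨h', hx.2⟩)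
    exact measure_mono_null this (measure_union_null hα (measure_union_null h0 hβ))
  set e := (β - α) / 4 with he
  have he0 : 0 < e := by rw [he]; linarith
  have hX : μ (Set.Icc (α - e) α) ≠ 0 := by
    intro h
    have h1 : μ (Set.Ico (α - e) a) = 0 := by
      refine measure_mono_null (t := Set.Icc (α - e) α ∪ Set.Ioo α a) ?_
        (measure_union_null h hα)
      intro x hx
      rcases le_or_gt x α with h | h
      · exact Or.inl ⟨hx.1, h⟩
      · exact Or.inr ⟨h, hx.2⟩
    have := csInf_le hTb (show α - e ∈ T from h1)
    linarith
  have hY : μ (Set.Ico β (β + e)) ≠ 0 := by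
    intro h
    have h1 : μ (Set.Ico b (β + e)) = 0 := by
      refine measure_mono_null (t := Set.Ico b β ∪ Set.Ico β (β + e)) ?_
        (measure_union_null hβ h)
      intro x hx
      rcases lt_or_ge x β with h | h
      · exact Or.inl ⟨hx.1, h⟩
      · exact Or.inr ⟨h, hx.2⟩
    have := le_csSup hUb (show β + e ∈ U from h1)
    linarith
  have key := hμ (Set.Icc (α - e) α) (Set.Ico β (β + e)) (Set.Ioo α β) measurableSet_Icc
    measurableSet_Ico measurableSet_Ioo 0 le_rfl (fun x hx y hy => ⟨norm_nonneg _, by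
      obtain ⟨h1, h2⟩ := hx
      obtain ⟨h3, h4⟩ := hy
      simp only [smul_eq_mul, Set.mem_Ioo]
      constructor <;> linarith⟩)
  rw [hZ] at key
  simp [hX, hY] at key

/-- A log-concave sequence with the stated modulus which does not increase at its first step
decays fast enough for its sum to be controlled by its first term. -/
lemma sum_le_of_logConcave {m : ℕ → ℝ} {a : ℝ} (ha : 0 < a) (ha1 : a ≤ 1) (hm : ∀ k, 0 ≤ m k)
    (hlc : ∀ k, m k * m (k + 2) ≤ Real.exp (-a ^ 2) * m (k + 1) ^ 2) (h10 : m 1 ≤ m 0)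
    (hgap : ∀ k, m k = 0 → m (k + 1) = 0) (n : ℕ) :
    a * ∑ k ∈ Finset.range n, m (k + 1) ≤ 4 * m 0 := by
  -- each ratio of consecutive terms is at most `exp (-a ^ 2)` times the one before
  have step : ∀ k, m (k + 1) ≤ Real.exp (-a ^ 2 * k) * m k := by
    intro k
    induction k with
    | zero => simpa using h10
    | succ k ih =>
      rcases (hm k).eq_or_lt with h | h
      · have h1 := hgap k h.symm
        rw [h1, hgap _ h1]; simp
      refine le_of_mul_le_mul_left ?_ h
      calc m k * m (k + 1 + 1) ≤ Real.exp (-a ^ 2) * m (k + 1) ^ 2 := hlc k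
        _ = Real.exp (-a ^ 2) * m (k + 1) * m (k + 1) := by ring
        _ ≤ Real.exp (-a ^ 2) * m (k + 1) * (Real.exp (-a ^ 2 * k) * m k) := by
            gcongr
            exact mul_nonneg (Real.exp_pos _).le (hm _)
        _ = m k * (Real.exp (-a ^ 2 * ↑(k + 1)) * m (k + 1)) := by
            rw [show -a ^ 2 * ((k + 1 : ℕ) : ℝ) = -a ^ 2 + -a ^ 2 * k by push_cast; ring,
              Real.exp_add]
            ring
  have quad : ∀ k : ℕ, m (k + 1) ≤ Real.exp (-a ^ 2 * (k * (k + 1) / 2)) * m 0 := by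
    intro k
    induction k with
    | zero => simpa using h10
    | succ k ih =>
      refine (step (k + 1)).trans ?_
      calc Real.exp (-a ^ 2 * ↑(k + 1)) * m (k + 1)
          ≤ Real.exp (-a ^ 2 * ↑(k + 1)) * (Real.exp (-a ^ 2 * (k * (k + 1) / 2)) * m 0) := by
            gcongr
        _ = _ := by
            rw [← mul_assoc, ← Real.exp_add]
            congr 2
            push_cast; ring
  -- `(a k - 1) ^ 2 ≥ 0` bounds the Gaussian decay by a geometric one of rate `exp (-a)`
  have geo : ∀ k : ℕ, m (k + 1) ≤ 2 * m 0 * Real.exp (-a) ^ k := by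
    intro k
    refine (quad k).trans ?_
    have h1 : Real.exp (-a ^ 2 * (k * (k + 1) / 2)) ≤ Real.exp (1 / 2) * Real.exp (-a) ^ k := by
      rw [← Real.exp_nat_mul, ← Real.exp_add]
      apply Real.exp_le_exp.2
      have hk : (0 : ℝ) ≤ k := Nat.cast_nonneg k
      nlinarith [sq_nonneg (a * k - 1), mul_nonneg (sq_nonneg a) hk]
    have h2 : Real.exp (1 / 2) ≤ 2 := by
      have h3 : Real.exp (1 / 2) ^ 2 = Real.exp 1 := by rw [← Real.exp_nat_mul]; norm_num
      nlinarith [Real.exp_one_lt_d9, Real.exp_pos (1 / 2)]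
    calc _ ≤ (Real.exp (1 / 2) * Real.exp (-a) ^ k) * m 0 := by gcongr; exact hm 0
      _ ≤ (2 * Real.exp (-a) ^ k) * m 0 := by gcongr; exact hm 0
      _ = _ := by ring
  have hq : a / 2 ≤ 1 - Real.exp (-a) := by
    have h1 : Real.exp (-a) ≤ 1 / (1 + a) := by
      rw [Real.exp_neg, ← one_div]
      exact one_div_le_one_div_of_le (by linarith) (by linarith [Real.add_one_le_exp a])
    have h2 : 1 / (1 + a) ≤ 1 - a / 2 := by
      rw [div_le_iff₀ (by linarith)]; nlinarith
    linarith
  have hsum : ∑ k ∈ Finset.range n, m (k + 1) ≤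
      2 * m 0 * ∑ k ∈ Finset.range n, Real.exp (-a) ^ k := by
    rw [Finset.mul_sum]
    exact Finset.sum_le_sum fun k _ => geo k
  have hgs : (1 - Real.exp (-a)) * ∑ k ∈ Finset.range n, Real.exp (-a) ^ k ≤ 1 := by
    rw [mul_neg_geom_sum]
    linarith [pow_pos (Real.exp_pos (-a)) n]
  have hs0 : 0 ≤ ∑ k ∈ Finset.range n, Real.exp (-a) ^ k :=
    Finset.sum_nonneg fun k _ => by positivity
  calc a * ∑ k ∈ Finset.range n, m (k + 1)
      ≤ a * (2 * m 0 * ∑ k ∈ Finset.range n, Real.exp (-a) ^ k) := by gcongr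
    _ = 4 * m 0 * (a / 2 * ∑ k ∈ Finset.range n, Real.exp (-a) ^ k) := by ring
    _ ≤ 4 * m 0 * ((1 - Real.exp (-a)) * ∑ k ∈ Finset.range n, Real.exp (-a) ^ k) := by
        gcongr
        linarith [hm 0]
    _ ≤ 4 * m 0 * 1 := by
        gcongr
        linarith [hm 0]
    _ = 4 * m 0 := by ring

/-- Consecutive intervals of length `h`, to the right (`σ = 1`) or to the left (`σ = -1`) of
a base interval that outweighs its neighbour on that side. -/
lemma StronglyLogConcave.sum_Ico_le {s h x σ : ℝ} {μ : Measure ℝ} [IsFiniteMeasure μ]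
    (hμ : StronglyLogConcave s μ) (hs : 0 < s) (hh : 0 < h) (hsh : s * h ≤ 1)
    (hσ : σ = 1 ∨ σ = -1)
    (h10 : μ (Set.Ico (x + σ * h) (x + σ * h + h)) ≤ μ (Set.Ico x (x + h)))
    (hgap : ∀ k : ℕ, μ (Set.Ico (x + σ * k * h) (x + σ * k * h + h)) = 0 →
      μ (Set.Ico (x + σ * (k + 1 : ℕ) * h) (x + σ * (k + 1 : ℕ) * h + h)) = 0) :
    ENNReal.ofReal (s * h) *
        μ (⋃ k : ℕ, Set.Ico (x + σ * (k + 1 : ℕ) * h) (x + σ * (k + 1 : ℕ) * h + h)) ≤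
      8 * μ (Set.Ico x (x + h)) := by
  set J : ℕ → Set ℝ := fun k => Set.Ico (x + σ * k * h) (x + σ * k * h + h) with hJ
  have hJ0 : J 0 = Set.Ico x (x + h) := by simp [hJ]
  have hJ1 : J 1 = Set.Ico (x + σ * h) (x + σ * h + h) := by simp [hJ]
  have hlc : ∀ k, μ.real (J k) * μ.real (J (k + 2)) ≤
      Real.exp (-(s * h / 2) ^ 2) * μ.real (J (k + 1)) ^ 2 := by
    intro k
    have key := hμ (J k) (J (k + 2)) (J (k + 1)) measurableSet_Ico measurableSet_Ico
      measurableSet_Ico h hh.le (fun u hu v hv => by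
        obtain ⟨h1, h2⟩ := hu
        obtain ⟨h3, h4⟩ := hv
        rw [Real.norm_eq_abs, le_abs, smul_eq_mul]
        simp only [hJ, Set.mem_Ico]
        push_cast at *
        rcases hσ with rfl | rfl
        · refine ⟨Or.inr ?_, ?_, ?_⟩ <;> linarith
        · refine ⟨Or.inl ?_, ?_, ?_⟩ <;> linarith)
    have key' := ENNReal.toReal_mono (ENNReal.pow_ne_top (measure_ne_top _ _)) key
    rw [ENNReal.toReal_mul, ENNReal.toReal_mul, ENNReal.toReal_pow,
      ENNReal.toReal_ofReal (Real.exp_pos _).le] at key'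
    change Real.exp ((s * h) ^ 2 / 4) * (μ.real (J k) * μ.real (J (k + 2))) ≤
      μ.real (J (k + 1)) ^ 2 at key'
    calc μ.real (J k) * μ.real (J (k + 2))
        = Real.exp (-(s * h / 2) ^ 2) * (Real.exp ((s * h) ^ 2 / 4) *
            (μ.real (J k) * μ.real (J (k + 2)))) := by
          rw [← mul_assoc, ← Real.exp_add]
          ring_nf
          simp
      _ ≤ _ := by gcongr
  have main : ∀ n, (s * h / 2) * ∑ k ∈ Finset.range n, μ.real (J (k + 1)) ≤ 4 * μ.real (J 0) := by
    refine sum_le_of_logConcave (by positivity) (by linarith) (fun k => measureReal_nonneg) hlc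
      ?_ ?_
    · rw [hJ0, hJ1]
      exact ENNReal.toReal_mono (measure_ne_top _ _) h10
    · intro k hk
      rw [measureReal_eq_zero_iff] at hk ⊢
      exact hgap k hk
  rw [← hJ0]
  calc ENNReal.ofReal (s * h) * μ (⋃ k : ℕ, J (k + 1))
      ≤ ENNReal.ofReal (s * h) * ∑' k : ℕ, μ (J (k + 1)) := by
        gcongr; exact measure_iUnion_le _
    _ = ∑' k : ℕ, ENNReal.ofReal (s * h) * μ (J (k + 1)) := ENNReal.tsum_mul_left.symm
    _ ≤ 8 * μ (J 0) := by
        refine ENNReal.tsum_le_of_sum_range_le fun n => ?_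
        rw [← Finset.mul_sum]
        have e : ∑ k ∈ Finset.range n, μ (J (k + 1)) =
            ENNReal.ofReal (∑ k ∈ Finset.range n, μ.real (J (k + 1))) := by
          rw [ENNReal.ofReal_sum_of_nonneg fun _ _ => measureReal_nonneg]
          simp
        rw [e, ← ENNReal.ofReal_mul (by positivity), ← ofReal_measureReal (s := J 0),
          show (8 : ℝ≥0∞) = ENNReal.ofReal 8 by simp, ← ENNReal.ofReal_mul (by norm_num)]
        exact ENNReal.ofReal_le_ofReal (by linarith [main n])

/-- On the line, an interval of length `h` has at least a fraction of order `s h` of the mass on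
one of its two sides. -/
lemma StronglyLogConcave.measure_side_le {s h : ℝ} {μ : Measure ℝ} [IsFiniteMeasure μ]
    (hμ : StronglyLogConcave s μ) (hs : 0 < s) (hh : 0 < h) (hsh : s * h ≤ 1) (x : ℝ) :
    ENNReal.ofReal (s * h) * μ (Set.Iio x) ≤ 8 * μ (Set.Ico x (x + h)) ∨
      ENNReal.ofReal (s * h) * μ (Set.Ici (x + h)) ≤ 8 * μ (Set.Ico x (x + h)) := by
  by_cases hL : μ (Set.Iio x) = 0
  · left; simp [hL]
  by_cases hR : μ (Set.Ici (x + h)) = 0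
  · right; simp [hR]
  have h0 : μ (Set.Ico x (x + h)) ≠ 0 := fun h0 => by
    rcases hμ.measure_Iio_eq_zero_or (by linarith) h0 with h | h
    · exact hL h
    · exact hR h
  -- by log-concavity the interval outweighs one of its two neighbours
  rcases le_or_gt (μ (Set.Ico (x + 1 * h) (x + 1 * h + h))) (μ (Set.Ico x (x + h))) with h1 | h1
  · right
    refine le_trans ?_ (hμ.sum_Ico_le hs hh hsh (Or.inl rfl) h1 ?_)
    · gcongr
      intro y hy
      have hy' : x + h ≤ y := hy
      obtain ⟨hf1, hf2⟩ : (⌊(y - x - h) / h⌋₊ : ℝ) ≤ (y - x - h) / h ∧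
          (y - x - h) / h < ⌊(y - x - h) / h⌋₊ + 1 :=
        ⟨Nat.floor_le (div_nonneg (by linarith) hh.le), Nat.lt_floor_add_one _⟩
      rw [le_div_iff₀ hh] at hf1
      rw [div_lt_iff₀ hh] at hf2
      refine Set.mem_iUnion.2 ⟨⌊(y - x - h) / h⌋₊, ?_, ?_⟩ <;> push_cast <;> nlinarith
    · intro k hk
      rcases hμ.measure_Iio_eq_zero_or (by linarith) hk with h | h
      · rcases Nat.eq_zero_or_pos k with rfl | hk0
        · simp at hk; exact absurd hk h0
        · refine absurd (measure_mono_null ?_ h) h0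
          have : (1 : ℝ) ≤ k := by exact_mod_cast hk0
          intro y hy
          have := hy.2
          simp only [Set.mem_Iio]
          nlinarith
      · refine measure_mono_null ?_ h
        intro y hy
        have := hy.1
        simp only [Set.mem_Ici]
        push_cast at this
        linarith
  · left
    have h2 : μ (Set.Ico (x + (-1) * h) (x + (-1) * h + h)) ≤ μ (Set.Ico x (x + h)) := by
      have key := hμ (Set.Ico (x + (-1) * h) (x + (-1) * h + h))
        (Set.Ico (x + 1 * h) (x + 1 * h + h)) (Set.Ico x (x + h)) measurableSet_Ico
        measurableSet_Ico measurableSet_Ico 0 le_rfl (fun u hu v hv => by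
          obtain ⟨h1, h2⟩ := hu
          obtain ⟨h3, h4⟩ := hv
          refine ⟨norm_nonneg _, ?_⟩
          rw [smul_eq_mul, Set.mem_Ico]
          constructor <;> linarith)
      simp only [mul_zero, ne_eq, OfNat.ofNat_ne_zero, not_false_eq_true, zero_pow, zero_div,
        Real.exp_zero, ENNReal.ofReal_one, one_mul] at key
      by_contra! hlt
      refine absurd (key.trans_lt ?_) (lt_irrefl _)
      rw [sq]
      simp only [one_mul] at h1
      exact ENNReal.mul_lt_mul hlt h1
    refine le_trans ?_ (hμ.sum_Ico_le hs hh hsh (Or.inr rfl) h2 ?_)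
    · gcongr
      intro y hy
      have hy' : y < x := hy
      obtain ⟨hf1, hf2⟩ : (x - y) / h ≤ ⌈(x - y) / h⌉₊ ∧ (⌈(x - y) / h⌉₊ : ℝ) < (x - y) / h + 1 :=
        ⟨Nat.le_ceil _, Nat.ceil_lt_add_one (div_nonneg (by linarith) hh.le)⟩
      have hpos : 0 < ⌈(x - y) / h⌉₊ := Nat.ceil_pos.2 (div_pos (by linarith) hh)
      obtain ⟨j, hj⟩ := Nat.exists_eq_succ_of_ne_zero hpos.ne'
      rw [div_le_iff₀ hh] at hf1
      rw [← sub_lt_iff_lt_add, lt_div_iff₀ hh] at hf2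
      rw [hj] at hf1 hf2
      refine Set.mem_iUnion.2 ⟨j, ?_, ?_⟩ <;> push_cast at * <;> nlinarith
    · intro k hk
      rcases hμ.measure_Iio_eq_zero_or (by linarith) hk with h | h
      · refine measure_mono_null ?_ h
        intro y hy
        have := hy.2
        simp only [Set.mem_Iio]
        push_cast at this
        linarith
      · rcases Nat.eq_zero_or_pos k with rfl | hk0
        · simp at hk; exact absurd hk h0
        · refine absurd (measure_mono_null ?_ h) h0
          have : (1 : ℝ) ≤ k := by exact_mod_cast hk0
          intro y hy
          have := hy.1
          simp only [Set.mem_Ici]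
          nlinarith

/-- Between a point of `A` and a point of `B` there is an interval of length `h` that avoids both
sets, if their distance is at least `h`. -/
lemma exists_Ioo_disjoint {A B : Set ℝ} {h p q : ℝ} (hAB : ∀ a ∈ A, ∀ b ∈ B, h ≤ |a - b|)
    (hp : p ∈ A) (hq : q ∈ B) (hpq : p < q) :
    ∃ x, p ≤ x ∧ x + h ≤ q ∧ Set.Ioo x (x + h) ⊆ (A ∪ B)ᶜ := by
  set T := A ∩ Set.Iic q
  have hpT : p ∈ T := ⟨hp, hpq.le⟩
  have hTb : BddAbove T := ⟨q, fun y hy => hy.2⟩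
  have hsq : sSup T + h ≤ q := by
    rw [← le_sub_iff_add_le]
    refine csSup_le ⟨p, hpT⟩ fun y hy => ?_
    have h1 := hAB y hy.1 q hq
    rw [abs_sub_comm, abs_of_nonneg (sub_nonneg.2 hy.2)] at h1
    linarith
  refine ⟨sSup T, le_csSup hTb hpT, hsq, ?_⟩
  rintro y ⟨hy1, hy2⟩ (hyA | hyB)
  · exact absurd (le_csSup hTb (show y ∈ T from ⟨hyA, by simp only [Set.mem_Iic]; linarith⟩))
      (not_le.2 hy1)
  · obtain ⟨a, haT, ha⟩ := exists_lt_of_lt_csSup ⟨p, hpT⟩ (show y - h < sSup T by linarith)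
    have h1 := hAB a haT.1 y hyB
    have h2 := le_csSup hTb haT
    rw [abs_sub_comm, abs_of_nonneg (by linarith)] at h1
    linarith

lemma measure_biUnion_Iic_le {μ : Measure ℝ} [IsFiniteMeasure μ] {T : Set ℝ} {c : ℝ≥0∞}
    (hT : ∀ x ∈ T, μ (Set.Iic x) ≤ c) : μ (⋃ x ∈ T, Set.Iic x) ≤ c := by
  have hlow : IsLowerSet (⋃ x ∈ T, Set.Iic x) := isLowerSet_iUnion₂ fun x _ => isLowerSet_Iic x
  rw [hlow.ordConnected.measurableSet.measure_eq_iSup_isCompact]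
  refine iSup₂_le fun K hK => iSup_le fun hKc => ?_
  rcases K.eq_empty_or_nonempty with rfl | hne
  · simp
  obtain ⟨k, hk, hkK⟩ := hKc.exists_isGreatest hne
  obtain ⟨x, hx, hkx⟩ := Set.mem_iUnion₂.1 (hK hk)
  exact (measure_mono fun y hy => (hkK hy).trans hkx).trans (hT x hx)

lemma measure_biUnion_Ici_le {μ : Measure ℝ} [IsFiniteMeasure μ] {T : Set ℝ} {c : ℝ≥0∞}
    (hT : ∀ x ∈ T, μ (Set.Ici x) ≤ c) : μ (⋃ x ∈ T, Set.Ici x) ≤ c := by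
  have hup : IsUpperSet (⋃ x ∈ T, Set.Ici x) := isUpperSet_iUnion₂ fun x _ => isUpperSet_Ici x
  rw [hup.ordConnected.measurableSet.measure_eq_iSup_isCompact]
  refine iSup₂_le fun K hK => iSup_le fun hKc => ?_
  rcases K.eq_empty_or_nonempty with rfl | hne
  · simp
  obtain ⟨k, hk, hkK⟩ := hKc.exists_isLeast hne
  obtain ⟨x, hx, hkx⟩ := Set.mem_iUnion₂.1 (hK hk)
  exact (measure_mono fun y hy => hkx.trans (hkK hy)).trans (hT x hx)

/-- The three-set isoperimetric inequality on the line. -/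
lemma StronglyLogConcave.isoperimetry_real {s h : ℝ} {μ : Measure ℝ} [IsFiniteMeasure μ]
    [NullSingletonClass μ]
    (hμ : StronglyLogConcave s μ) (hs : 0 < s) (hh : 0 < h) (hsh : s * h ≤ 1) {A B : Set ℝ}
    (hAB : ∀ a ∈ A, ∀ b ∈ B, h ≤ |a - b|) :
    ENNReal.ofReal (s * h) * (μ A * μ B) ≤ 16 * (μ (A ∪ B)ᶜ * μ Set.univ) := by
  set k := ENNReal.ofReal (s * h) with hk
  have hk0 : k ≠ 0 := by
    rw [hk]; simpa using mul_pos hs hh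
  have hkt : k ≠ ∞ := ENNReal.ofReal_ne_top
  set c := 8 * μ (A ∪ B)ᶜ / k with hc
  -- the left ends of the gaps with little mass on the left, the right ends of the others
  set G := {x : ℝ | Set.Ioo x (x + h) ⊆ (A ∪ B)ᶜ} with hG
  set gapL := {x : ℝ | x ∈ G ∧ μ (Set.Iic x) ≤ c} with hgapL
  set gapR := {y : ℝ | y - h ∈ G ∧ μ (Set.Ici y) ≤ c} with hgapR
  have hside : ∀ x ∈ G, x ∈ gapL ∨ x + h ∈ gapR := by
    intro x hx
    have hIco : μ (Set.Ico x (x + h)) ≤ μ (A ∪ B)ᶜ := by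
      rw [measure_congr (Ioo_ae_eq_Ico (μ := μ) (a := x) (b := x + h)).symm]
      exact measure_mono hx
    rcases hμ.measure_side_le hs hh hsh x with h1 | h1
    · refine Or.inl ⟨hx, ?_⟩
      rw [measure_congr (Iio_ae_eq_Iic (μ := μ) (a := x)).symm, hc,
        ENNReal.le_div_iff_mul_le (Or.inl hk0) (Or.inl hkt), mul_comm]
      exact h1.trans (by gcongr)
    · refine Or.inr ⟨by simpa using hx, ?_⟩
      rw [hc, ENNReal.le_div_iff_mul_le (Or.inl hk0) (Or.inl hkt), mul_comm]
      exact h1.trans (by gcongr)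
  set U := ⋃ x ∈ gapL, Set.Iic x
  set V := ⋃ x ∈ gapR, Set.Ici x
  have hUc : μ U ≤ c := measure_biUnion_Iic_le fun x hx => hx.2
  have hVc : μ V ≤ c := measure_biUnion_Ici_le fun x hx => hx.2
  have hUV : μ (U ∪ V) ≤ 2 * c := (measure_union_le _ _).trans (by rw [two_mul]; gcongr)
  -- outside the small set `U ∪ V` no two points are separated by a gap, so `A` and `B` cannot both
  -- have points there
  have nogap : ∀ p q, p ∉ U ∪ V → q ∉ U ∪ V → ∀ x, p ≤ x → x + h ≤ q → x ∈ G → False := by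
    intro p q hp hq x hpx hxq hx
    rcases hside x hx with h1 | h1
    · exact hp (Or.inl (Set.mem_iUnion₂.2 ⟨x, h1, hpx⟩))
    · exact hq (Or.inr (Set.mem_iUnion₂.2 ⟨x + h, h1, hxq⟩))
  have hsmall : A ⊆ U ∪ V ∨ B ⊆ U ∪ V := by
    by_contra! hcon
    obtain ⟨hA, hB⟩ := hcon
    obtain ⟨p, hpA, hp⟩ := Set.not_subset.1 hA
    obtain ⟨q, hqB, hq⟩ := Set.not_subset.1 hB
    rcases lt_trichotomy p q with hlt | rfl | hlt
    · obtain ⟨x, h1, h2, h3⟩ := exists_Ioo_disjoint hAB hpA hqB hlt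
      exact nogap p q hp hq x h1 h2 h3
    · have := hAB p hpA p hqB
      simp at this; linarith
    · obtain ⟨x, h1, h2, h3⟩ := exists_Ioo_disjoint
        (fun b hb a ha => by rw [abs_sub_comm]; exact hAB a ha b hb) hqB hpA hlt
      exact nogap q p hq hp x h1 h2 (by rw [Set.union_comm] at h3; exact h3)
  have hkc : k * (2 * c) = 16 * μ (A ∪ B)ᶜ := by
    rw [hc, mul_left_comm, ENNReal.mul_div_cancel hk0 hkt, ← mul_assoc]
    norm_num
  rcases hsmall with h1 | h1
  · calc k * (μ A * μ B) ≤ k * (2 * c * μ Set.univ) := by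
          gcongr
          · exact (measure_mono h1).trans hUV
          · exact Set.subset_univ _
      _ = 16 * (μ (A ∪ B)ᶜ * μ Set.univ) := by rw [← mul_assoc, hkc, mul_assoc]
  · calc k * (μ A * μ B) ≤ k * (μ Set.univ * (2 * c)) := by
          gcongr
          · exact Set.subset_univ _
          · exact (measure_mono h1).trans hUV
      _ = 16 * (μ (A ∪ B)ᶜ * μ Set.univ) := by
          rw [mul_comm (μ Set.univ), ← mul_assoc, hkc, mul_assoc]

/-! ### Planar convex sets -/

/-- The determinant of two vectors of the plane. -/
def planeDet (a b : ℂ) : ℝ := a.re * b.im - a.im * b.re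

lemma abs_planeDet_le (a b : ℂ) : |planeDet a b| ≤ ‖a‖ * ‖b‖ := by
  have h : planeDet a b = ((starRingEnd ℂ) a * b).im := by simp [planeDet]; ring
  rw [h]
  refine (Complex.abs_im_le_norm _).trans ?_
  simp

/-- A bounded planar convex set which contains no disc of radius `w / 6` lies in a strip of width
`2 * w`: otherwise it contains a triangle, over an almost longest chord, whose heights are all at
least of order `w`. -/
lemma exists_strip_of_forall_ball_not_subset {C : Set ℂ} (hC : Convex ℝ C)
    (hb : Bornology.IsBounded C) {w : ℝ} (hw : 0 < w)
    (hball : ∀ g, ¬ Metric.ball g (w / 6) ⊆ C) :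
    ∃ u : ℂ, ‖u‖ = 1 ∧ ∃ c : ℝ, ∀ x ∈ C,
      c ≤ u.re * x.re + u.im * x.im ∧ u.re * x.re + u.im * x.im ≤ c + 2 * w := by
  rcases C.eq_empty_or_nonempty with rfl | ⟨p₀, hp₀⟩
  · exact ⟨1, by simp, 0, by simp⟩
  rcases le_or_gt (Metric.diam C) w with hD | hD
  · refine ⟨1, by simp, p₀.re - w, fun x hx => ?_⟩
    have h1 := (Complex.abs_re_le_norm (x - p₀)).trans
      ((dist_eq_norm x p₀ ▸ Metric.dist_le_diam_of_mem hb hx hp₀).trans hD)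
    rw [abs_le, Complex.sub_re] at h1
    simp only [Complex.one_re, Complex.one_im, one_mul, zero_mul, add_zero]
    constructor <;> linarith
  set D := Metric.diam C with hDdef
  have hD0 : 0 < D := hw.trans hD
  obtain ⟨p, hp, q, hq, hpq⟩ : ∃ p ∈ C, ∃ q ∈ C, D / 2 < dist p q := by
    by_contra! hcon
    have := Metric.diam_le_of_forall_dist_le (by positivity) hcon
    linarith
  set v := q - p with hv
  have hvn : D / 2 < ‖v‖ := by rwa [hv, ← dist_eq_norm, dist_comm]
  have hv0 : 0 < ‖v‖ := by linarith
  -- `planeDet v (r - p) / ‖v‖` is the signed distance of `r` from the line through `p` and `q`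
  by_cases hr : ∀ r ∈ C, |planeDet v (r - p)| ≤ w * ‖v‖
  · refine ⟨Complex.I * v / ‖v‖, by simp [hv0.ne'], planeDet v p / ‖v‖ - w, fun x hx => ?_⟩
    have h1 := hr x hx
    have h2 : (Complex.I * v / ‖v‖).re * x.re + (Complex.I * v / ‖v‖).im * x.im =
        planeDet v p / ‖v‖ + planeDet v (x - p) / ‖v‖ := by
      simp only [Complex.div_ofReal_re, Complex.div_ofReal_im, planeDet]
      simp
      field_simp
      ring
    have h3 : |planeDet v (x - p) / ‖v‖| ≤ w := by
      rw [abs_div, abs_of_pos hv0, div_le_iff₀ hv0]; exact h1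
    rw [abs_le] at h3
    rw [h2]
    constructor <;> linarith
  · exfalso
    push Not at hr
    obtain ⟨r, hr, hN⟩ := hr
    set t := r - p with ht
    have htn : ‖t‖ ≤ D := by
      rw [ht, ← dist_eq_norm]; exact Metric.dist_le_diam_of_mem hb hr hp
    have htvn : ‖t - v‖ ≤ D := by
      rw [ht, hv, show r - p - (q - p) = r - q by ring, ← dist_eq_norm]
      exact Metric.dist_le_diam_of_mem hb hr hq
    set N := planeDet v t with hNdef
    have hN0 : 0 < |N| := by nlinarith
    have hNne : N ≠ 0 := abs_pos.1 hN0
    -- the disc about the centroid of the triangle `p q r` lies in the triangle: the barycentric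
    -- coordinates of its points differ from `1 / 3` by less than `1 / 3`
    have small : ∀ a e : ℂ, ‖a‖ ≤ D → ‖e‖ < w / 6 → |planeDet e a / N| < 1 / 3 := by
      intro a e ha he
      rw [abs_div, div_lt_iff₀ hN0]
      have h1 := abs_planeDet_le e a
      have h2 : ‖e‖ * ‖a‖ ≤ w / 6 * D := by gcongr
      nlinarith
    refine hball ((p + q + r) / 3) fun x hx => ?_
    set e := x - (p + q + r) / 3 with he
    have hen : ‖e‖ < w / 6 := by rwa [Metric.mem_ball, dist_eq_norm] at hx
    have hβ := (abs_lt.1 (small t e htn hen))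
    have hγ := (abs_lt.1 (small v e (by
      rw [hv, ← dist_eq_norm]; exact Metric.dist_le_diam_of_mem hb hq hp) hen))
    have hα := (abs_lt.1 (small (t - v) e htvn hen))
    set β := 1 / 3 + planeDet e t / N with hβd
    set γ := 1 / 3 - planeDet e v / N with hγd
    have hα' : 0 ≤ 1 - β - γ := by
      have : planeDet e (t - v) / N = planeDet e t / N - planeDet e v / N := by
        rw [← sub_div]; congr 1; simp [planeDet]; ring
      rw [this] at hα
      rw [hβd, hγd]; linarith
    have hx' : x = (1 - β - γ) • p + β • q + γ • r := by
      have h1 : e = (planeDet e t / N) • v - (planeDet e v / N) • t := by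
        apply Complex.ext
        · simp only [Complex.sub_re, Complex.real_smul, Complex.mul_re, Complex.ofReal_re,
            Complex.ofReal_im, zero_mul, sub_zero]
          field_simp
          simp only [hNdef, planeDet]
          ring
        · simp only [Complex.sub_im, Complex.real_smul, Complex.mul_im, Complex.ofReal_re,
            Complex.ofReal_im, zero_mul, add_zero]
          field_simp
          simp only [hNdef, planeDet]
          ring
      have h2 : x = e + (p + q + r) / 3 := by rw [he]; ring
      rw [h2]
      nth_rewrite 1 [h1]
      rw [hβd, hγd, hv, ht]
      simp only [Complex.real_smul]
      push_cast
      ring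
    rw [hx']
    have := hC.sum_mem (t := Finset.univ) (w := ![1 - β - γ, β, γ]) (z := ![p, q, r])
      (by
        intro i _
        fin_cases i
        · exact hα'
        · simp; linarith
        · simp; linarith)
      (by simp only [Fin.sum_univ_three, Matrix.cons_val]; ring)
      (by
        intro i _
        fin_cases i
        · exact hp
        · exact hq
        · exact hr)
    simpa [Fin.sum_univ_three] using this

/-! ### Splitting by half-spaces -/

section Split

open InnerProductSpace

variable {E : Type*} [NormedAddCommGroup E] [InnerProductSpace ℝ E] [MeasurableSpace E]
  [BorelSpace E]

local notation "⟪" x ", " y "⟫" => inner ℝ x y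

/-- The mass cut off by a half-space depends continuously on the half-space, if hyperplanes are
null sets. -/
lemma continuous_measureReal_halfSpace {μ : Measure E} [IsFiniteMeasure μ]
    (hnull : ∀ u : E, u ≠ 0 → ∀ c : ℝ, μ {x | ⟪u, x⟫ = c} = 0) (X : Set E)
    {v : ℝ → E} {t : ℝ → ℝ} (hv : Continuous v) (ht : Continuous t) (hv0 : ∀ θ, v θ ≠ 0) :
    Continuous fun θ => μ.real (X ∩ {x | t θ ≤ ⟪v θ, x⟫}) := by
  have hm : ∀ θ, MeasurableSet {x : E | t θ ≤ ⟪v θ, x⟫} := fun θ =>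
    (isClosed_le continuous_const (by fun_prop)).measurableSet
  have e : (fun θ => μ.real (X ∩ {x | t θ ≤ ⟪v θ, x⟫})) = fun θ =>
      ∫ x in X, ({x | t θ ≤ ⟪v θ, x⟫} : Set E).indicator (fun _ => (1 : ℝ)) x ∂μ := by
    funext θ
    rw [integral_indicator (hm θ), setIntegral_const, smul_eq_mul, mul_one,
      measureReal_restrict_apply (hm θ), Set.inter_comm]
  rw [e, continuous_iff_continuousAt]
  intro θ₀
  refine continuousAt_of_dominated (bound := fun _ => 1) ?_ ?_ (integrable_const _) ?_
  · exact Eventually.of_forall fun θ =>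
      ((measurable_const.indicator (hm θ)).aestronglyMeasurable)
  · refine Eventually.of_forall fun θ => ae_of_all _ fun x => ?_
    by_cases h : x ∈ {x | t θ ≤ ⟪v θ, x⟫}
    · simp [Set.indicator_of_mem h]
    · simp [Set.indicator_of_notMem h]
  · have h0 : ∀ᵐ x ∂(μ.restrict X), ⟪v θ₀, x⟫ ≠ t θ₀ :=
      ae_restrict_of_ae (by simpa [ae_iff] using hnull (v θ₀) (hv0 θ₀) (t θ₀))
    filter_upwards [h0] with x hx
    have hc1 : ContinuousAt (fun θ => ⟪v θ, x⟫) θ₀ := by fun_prop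
    have hc2 : ContinuousAt t θ₀ := ht.continuousAt
    rcases lt_or_gt_of_ne hx with h | h
    · refine ContinuousAt.congr (f := fun _ => (0 : ℝ)) continuousAt_const ?_
      filter_upwards [hc1.eventually_lt hc2 h] with θ hθ
      rw [Set.indicator_of_notMem]
      simpa using hθ
    · refine ContinuousAt.congr (f := fun _ => (1 : ℝ)) continuousAt_const ?_
      filter_upwards [hc2.eventually_lt hc1 h] with θ hθ
      rw [Set.indicator_of_mem]
      exact hθ.le

lemma measureReal_split {μ : Measure E} [IsFiniteMeasure μ]
    (hnull : ∀ u : E, u ≠ 0 → ∀ c : ℝ, μ {x | ⟪u, x⟫ = c} = 0) (X : Set E)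
    {v : E} (hv : v ≠ 0) (t : ℝ) :
    μ.real (X ∩ {x | t ≤ ⟪v, x⟫}) + μ.real (X ∩ {x | ⟪v, x⟫ ≤ t}) = μ.real X := by
  have hm : MeasurableSet {x : E | t ≤ ⟪v, x⟫} :=
    (isClosed_le continuous_const (by fun_prop)).measurableSet
  have h1 := measureReal_inter_add_sdiff (μ := μ) (s := X) hm
  rw [← h1]
  congr 1
  refine measureReal_congr ?_
  have h0 : ∀ᵐ x ∂μ, ⟪v, x⟫ ≠ t := by simpa [ae_iff] using hnull v hv t
  filter_upwards [h0] with x hx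
  have : (⟪v, x⟫ ≤ t) = ¬ (t ≤ ⟪v, x⟫) := by
    rw [not_le]
    exact propext ⟨fun h => lt_of_le_of_ne h hx, le_of_lt⟩
  change (x ∈ X ∧ ⟪v, x⟫ ≤ t) = (x ∈ X ∧ ¬ (t ≤ ⟪v, x⟫))
  rw [this]

/-- Through every point of the plane spanned by two orthonormal vectors there is a hyperplane,
with normal vector in that plane, that preserves a given balance of masses. -/
lemma exists_balanced_halfSpace {μ : Measure E} [IsFiniteMeasure μ]
    (hnull : ∀ u : E, u ≠ 0 → ∀ c : ℝ, μ {x | ⟪u, x⟫ = c} = 0) {e₁ e₂ : E}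
    (h₁ : ‖e₁‖ = 1) (h₂ : ‖e₂‖ = 1) (h₁₂ : ⟪e₁, e₂⟫ = 0) {X Y : Set E}
    {a m : ℝ} (hbal : m * μ.real X = a * μ.real Y) (p : ℂ) :
    ∃ u : ℂ, ‖u‖ = 1 ∧ u.re • e₁ + u.im • e₂ ≠ 0 ∧
      m * μ.real (X ∩ {x | u.re * p.re + u.im * p.im ≤ ⟪u.re • e₁ + u.im • e₂, x⟫}) =
        a * μ.real (Y ∩ {x | u.re * p.re + u.im * p.im ≤ ⟪u.re • e₁ + u.im • e₂, x⟫}) := by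
  set v : ℝ → E := fun θ => Real.cos θ • e₁ + Real.sin θ • e₂ with hv
  set t : ℝ → ℝ := fun θ => Real.cos θ * p.re + Real.sin θ * p.im with ht
  have hvc : Continuous v := by fun_prop
  have htc : Continuous t := by fun_prop
  have hvn : ∀ θ, ‖v θ‖ = 1 := by
    intro θ
    have : ‖v θ‖ * ‖v θ‖ = 1 := by
      rw [hv, norm_add_sq_eq_norm_sq_add_norm_sq_real
        (by simp [inner_smul_left, inner_smul_right, h₁₂])]
      simp only [norm_smul, h₁, h₂, mul_one, Real.norm_eq_abs, abs_mul_abs_self]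
      nlinarith [Real.sin_sq_add_cos_sq θ]
    nlinarith [norm_nonneg (v θ)]
  have hv0 : ∀ θ, v θ ≠ 0 := fun θ h => by
    have := hvn θ
    rw [h] at this; simp at this
  set g : ℝ → ℝ := fun θ => m * μ.real (X ∩ {x | t θ ≤ ⟪v θ, x⟫}) -
    a * μ.real (Y ∩ {x | t θ ≤ ⟪v θ, x⟫}) with hg
  have hgc : Continuous g :=
    ((continuous_measureReal_halfSpace hnull X hvc htc hv0).const_mul m |>.sub
      ((continuous_measureReal_halfSpace hnull Y hvc htc hv0).const_mul a))
  -- half a turn exchanges the two sides of the hyperplane, so the imbalance changes sign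
  have hgπ : g Real.pi = - g 0 := by
    have e : {x : E | t Real.pi ≤ ⟪v Real.pi, x⟫} = {x | ⟪v 0, x⟫ ≤ t 0} := by
      ext x
      simp [hv, ht, inner_neg_left]
    have hX' := measureReal_split hnull X (hv0 0) (t 0)
    have hY' := measureReal_split hnull Y (hv0 0) (t 0)
    simp only [hg, e]
    rw [← hX', ← hY'] at hbal
    linarith
  have h0 : (0 : ℝ) ∈ Set.uIcc (g 0) (g Real.pi) := by
    rw [hgπ, Set.mem_uIcc]
    rcases le_total (g 0) 0 with h | h
    · left; constructor <;> linarith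
    · right; constructor <;> linarith
  obtain ⟨θ, -, hθ⟩ := intermediate_value_uIcc hgc.continuousOn h0
  refine ⟨⟨Real.cos θ, Real.sin θ⟩, ?_, hv0 θ, sub_eq_zero.1 hθ⟩
  rw [← sq_eq_sq₀ (norm_nonneg _) zero_le_one, ← Complex.normSq_eq_norm_sq, Complex.normSq_mk]
  nlinarith [Real.sin_sq_add_cos_sq θ]

/-- The part of the inductive step that cuts along hyperplanes: given finitely many points of the
plane spanned by `e₁` and `e₂`, a convex body is cut into balanced pieces none of which has one of
these points in the interior of its planar shadow. An inequality that holds on such pieces is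
summed over the pieces. -/
lemma le_of_forall_balanced_piece {μ : Measure E} [IsFiniteMeasure μ]
    (hnull : ∀ u : E, u ≠ 0 → ∀ c : ℝ, μ {x | ⟪u, x⟫ = c} = 0) {e₁ e₂ : E}
    (h₁ : ‖e₁‖ = 1) (h₂ : ‖e₂‖ = 1) (h₁₂ : ⟪e₁, e₂⟫ = 0) {A X Y : Set E} {a m k l : ℝ}
    {π : E → ℂ} (hπ : ∀ x, π x = ⟨⟪e₁, x⟫, ⟪e₂, x⟫⟩) {N : Finset ℂ} {D : Set E}
    (hpiece : ∀ C ⊆ D, IsClosed C → Convex ℝ C → m * μ.real (A ∩ C) = a * μ.real C →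
      (∀ p ∈ N, p ∉ interior (π '' C)) → k * μ.real (X ∩ C) ≤ l * μ.real (Y ∩ C))
    (F : Finset ℂ) : ∀ C ⊆ D, IsClosed C → Convex ℝ C → m * μ.real (A ∩ C) = a * μ.real C →
      (∀ p ∈ N, p ∉ F → p ∉ interior (π '' C)) → k * μ.real (X ∩ C) ≤ l * μ.real (Y ∩ C) := by
  classical
  induction F using Finset.induction with
  | empty =>
    intro C hCD hC hCc hbal hN
    exact hpiece C hCD hC hCc hbal fun p hp => hN p hp (by simp)
  | insert p F hpF ih =>
    intro C hCD hC hCc hbal hN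
    obtain ⟨u, hu, hv0, hsplit⟩ :=
      exists_balanced_halfSpace hnull h₁ h₂ h₁₂ (X := A ∩ C) (Y := C) hbal p
    set v := u.re • e₁ + u.im • e₂ with hv
    set t := u.re * p.re + u.im * p.im with ht
    have hvx : ∀ x, ⟪v, x⟫ = u.re * (π x).re + u.im * (π x).im := fun x => by
      rw [hπ, hv, inner_add_left, inner_smul_left, inner_smul_left]; rfl
    have hvc : Continuous fun x : E => ⟪v, x⟫ := by fun_prop
    have hlin : IsLinearMap ℝ fun x : E => ⟪v, x⟫ := (innerSL ℝ v).toLinearMap.isLinear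
    have hu2 : u.re * u.re + u.im * u.im = 1 := by
      have := Complex.sq_norm u
      rw [hu, Complex.normSq_apply] at this
      linarith
    have split := fun Z => measureReal_split hnull (μ := μ) Z hv0 t
    -- the shadows of both halves have `p` on their boundary
    have hbd : ∀ (σ : ℝ) (C' : Set E), σ ≠ 0 → (∀ x ∈ C', 0 ≤ σ * (⟪v, x⟫ - t)) →
        p ∉ interior (π '' C') := by
      intro σ C' hσ hC' hp
      rw [mem_interior_iff_mem_nhds] at hp
      have hlim : Tendsto (fun τ : ℝ => p - (τ * σ : ℝ) • u) (𝓝[>] 0) (𝓝 p) := by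
        have : Continuous fun τ : ℝ => p - (τ * σ : ℝ) • u := by fun_prop
        simpa using (this.tendsto 0).mono_left nhdsWithin_le_nhds
      obtain ⟨τ, ⟨x, hx, hxe⟩, hτ⟩ := ((hlim.eventually hp).and self_mem_nhdsWithin).exists
      have hτ' : 0 < τ := hτ
      have h1 := hC' x hx
      rw [hvx, hxe] at h1
      simp only [Complex.sub_re, Complex.sub_im, Complex.real_smul, Complex.mul_re,
        Complex.mul_im, Complex.ofReal_re, Complex.ofReal_im, zero_mul, sub_zero, add_zero] at h1
      have h2 : σ * (u.re * (p.re - τ * σ * u.re) + u.im * (p.im - τ * σ * u.im) - t) =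
          - (τ * σ ^ 2) := by
        rw [ht]; linear_combination (- (τ * σ ^ 2)) * hu2
      rw [h2] at h1
      have : 0 < τ * σ ^ 2 := by positivity
      linarith
    have hold : ∀ C' ⊆ C, ∀ q ∈ N, q ∉ F → q ≠ p → q ∉ interior (π '' C') := by
      intro C' hC' q hq hqF hqp hqi
      refine hN q hq (by simp [hqF, hqp]) (interior_mono (Set.image_mono hC') hqi)
    have hC1 := ih (C ∩ {x | t ≤ ⟪v, x⟫}) (Set.inter_subset_left.trans hCD)
      (hC.inter (isClosed_le continuous_const hvc)) (hCc.inter (convex_halfSpace_ge hlin t))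
      (by rw [← Set.inter_assoc]; exact hsplit)
      (fun q hq hqF => by
        by_cases hqp : q = p
        · rw [hqp]
          exact hbd 1 _ one_ne_zero fun x hx => by
            have : t ≤ ⟪v, x⟫ := hx.2
            linarith
        · exact hold _ Set.inter_subset_left q hq hqF hqp)
    have hC2 := ih (C ∩ {x | ⟪v, x⟫ ≤ t}) (Set.inter_subset_left.trans hCD)
      (hC.inter (isClosed_le hvc continuous_const)) (hCc.inter (convex_halfSpace_le hlin t))
      (by
        rw [← Set.inter_assoc]
        have h1 := split (A ∩ C)
        have h2 := split C
        rw [← h1, ← h2] at hbal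
        linarith)
      (fun q hq hqF => by
        by_cases hqp : q = p
        · rw [hqp]
          exact hbd (-1) _ (by norm_num) fun x hx => by
            have : ⟪v, x⟫ ≤ t := hx.2
            linarith
        · exact hold _ Set.inter_subset_left q hq hqF hqp)
    rw [← Set.inter_assoc, ← Set.inter_assoc] at hC1 hC2
    rw [← split (X ∩ C), ← split (Y ∩ C)]
    linarith

end Split

/-! ### Isoperimetry for strongly log-concave measures -/

section Isoperimetry

local notation "⟪" x ", " y "⟫" => inner ℝ x y

/-- The three-set isoperimetric inequality, for open sets at distance at least `h`, in all
Euclidean spaces of dimension `d`. Hyperplanes are required to be null sets. -/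
def IsoperimetryInDim (d : ℕ) : Prop :=
  ∀ (E : Type) [NormedAddCommGroup E] [InnerProductSpace ℝ E] [FiniteDimensional ℝ E]
    [MeasurableSpace E] [BorelSpace E], Module.finrank ℝ E = d →
    ∀ (s h R : ℝ) (μ : Measure E) [IsFiniteMeasure μ], StronglyLogConcave s μ → 0 < s → 0 < h →
      s * h ≤ 1 → (∀ u : E, u ≠ 0 → ∀ c : ℝ, μ {x | ⟪u, x⟫ = c} = 0) →
      μ (Metric.closedBall 0 R)ᶜ = 0 → ∀ A B : Set E, IsOpen A → IsOpen B →
      (∀ a ∈ A, ∀ b ∈ B, h ≤ ‖a - b‖) →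
        s * h * (μ.real A * μ.real B) ≤ 16 * (μ.real (A ∪ B)ᶜ * μ.real Set.univ)

lemma isoperimetryInDim_one : IsoperimetryInDim 1 := by
  intro E _ _ _ _ _ hE s h R μ _ hμ hs hh hsh hnull _ A B hA hB hAB
  obtain ⟨e, he⟩ : ∃ e : E, ‖e‖ = 1 := by
    have : Nontrivial E := Module.nontrivial_of_finrank_pos (R := ℝ) (by omega)
    exact exists_norm_eq E zero_le_one
  have he0 : e ≠ 0 := fun h => by simp [h] at he
  have hex : ∀ x : E, ⟪e, x⟫ • e = x := by
    intro x
    obtain ⟨c, rfl⟩ := (finrank_eq_one_iff_of_nonzero' e he0).1 hE x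
    rw [inner_smul_right, real_inner_self_eq_norm_sq, he]; simp
  set p : E →ₗ[ℝ] ℝ := (innerSL ℝ e).toLinearMap with hp
  have hpx : ∀ x, p x = ⟪e, x⟫ := fun x => rfl
  have hpm : Measurable p := (innerSL ℝ e).continuous.measurable
  have hpn : ∀ x, ‖p x‖ ≤ ‖x‖ := fun x => by
    rw [hpx]; simpa [he] using norm_inner_le_norm (𝕜 := ℝ) e x
  have hec : Measurable fun t : ℝ => t • e := by fun_prop
  have hpre : ∀ X : Set E, MeasurableSet X → μ.map p ((fun t : ℝ => t • e) ⁻¹' X) = μ X := by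
    intro X hX
    rw [Measure.map_apply hpm (hec hX)]
    congr 1
    ext x
    simp [hpx, hex]
  have : NullSingletonClass (μ.map p) := ⟨fun c => by
    rw [Measure.map_apply hpm (measurableSet_singleton c)]
    exact hnull e he0 c⟩
  have key := (hμ.map p hpm hpn).isoperimetry_real hs hh hsh
    (A := (fun t : ℝ => t • e) ⁻¹' A) (B := (fun t : ℝ => t • e) ⁻¹' B) (by
      intro a ha b hb
      have := hAB _ ha _ hb
      rwa [← sub_smul, norm_smul, he, mul_one] at this)
  rw [← Set.preimage_union, ← Set.preimage_compl, hpre A hA.measurableSet,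
    hpre B hB.measurableSet, hpre _ (hA.union hB).measurableSet.compl,
    Measure.map_apply hpm MeasurableSet.univ, Set.preimage_univ] at key
  have key' := ENNReal.toReal_mono (by finiteness) key
  rw [ENNReal.toReal_mul, ENNReal.toReal_mul, ENNReal.toReal_mul, ENNReal.toReal_mul,
    ENNReal.toReal_ofReal (by positivity)] at key'
  exact key'

variable {E : Type} [NormedAddCommGroup E] [InnerProductSpace ℝ E] [FiniteDimensional ℝ E]
    [MeasurableSpace E] [BorelSpace E]

/-- A measure carried by a slab of thickness `δ` is projected along the thin direction, at the
cost of a reduction of distances by `3 * δ`. -/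
lemma isoperimetry_of_slab {d : ℕ} (ih : IsoperimetryInDim d) (hE : Module.finrank ℝ E = d + 1)
    {s h δ R c : ℝ} {μ : Measure E} [IsFiniteMeasure μ] (hμ : StronglyLogConcave s μ) (hs : 0 < s)
    (hδ : 0 < δ) (hδh : 3 * δ < h) (hsh : s * h ≤ 1)
    (hnull : ∀ u : E, u ≠ 0 → ∀ c : ℝ, μ {x | ⟪u, x⟫ = c} = 0)
    (hR : μ (Metric.closedBall 0 R)ᶜ = 0) {v : E} (hv : ‖v‖ = 1)
    (hslab : μ {x | c ≤ ⟪v, x⟫ ∧ ⟪v, x⟫ ≤ c + δ}ᶜ = 0)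
    {A B : Set E} (hA : IsOpen A) (hB : IsOpen B) (hAB : ∀ a ∈ A, ∀ b ∈ B, h ≤ ‖a - b‖) :
    s * (h - 3 * δ) * (μ.real A * μ.real B) ≤
      16 * (μ.real (A ∪ B)ᶜ * μ.real Set.univ) := by
  set W : Submodule ℝ E := (ℝ ∙ v)ᗮ with hW
  have hv0 : v ≠ 0 := fun h => by simp [h] at hv
  have : Fact (Module.finrank ℝ E = d + 1) := ⟨hE⟩
  have hWd : Module.finrank ℝ W = d := Submodule.finrank_orthogonal_span_singleton hv0
  set P : E →L[ℝ] W := W.orthogonalProjectionOnto with hP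
  have hPn : ∀ x, ‖P x‖ ≤ ‖x‖ := fun x => W.norm_orthogonalProjectionOnto_apply_le x
  have hPm : Measurable P := P.continuous.measurable
  have hPs : Function.Surjective P := fun w => ⟨w, by simp [hP]⟩
  have hPo : IsOpenMap P := P.isOpenMap hPs
  have hPv : ∀ x, ‖x‖ ≤ |⟪v, x⟫| + ‖P x‖ := by
    intro x
    have h1 : x = ⟪v, x⟫ • v + (P x : E) := by
      have := (ℝ ∙ v).starProjection_add_starProjection_orthogonal x
      rw [Submodule.starProjection_unit_singleton ℝ hv, Submodule.starProjection_apply] at this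
      exact this.symm
    calc ‖x‖ = ‖⟪v, x⟫ • v + (P x : E)‖ := by rw [← h1]
      _ ≤ ‖⟪v, x⟫ • v‖ + ‖(P x : E)‖ := norm_add_le _ _
      _ = _ := by rw [norm_smul, hv, mul_one, Real.norm_eq_abs]; rfl
  -- an open slab, so that the projections of `A ∩ T` and `B ∩ T` are open; `⟪v, x⟫` varies by at
  -- most `3 * δ` on it
  set T : Set E := {x | c - δ < ⟪v, x⟫ ∧ ⟪v, x⟫ < c + 2 * δ} with hT
  have hvc : Continuous fun x : E => ⟪v, x⟫ := by fun_prop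
  have hTo : IsOpen T := (isOpen_lt continuous_const hvc).inter (isOpen_lt hvc continuous_const)
  have hTn : ∀ᵐ x ∂μ, x ∈ T := by
    rw [ae_iff]
    refine measure_mono_null (fun x hx => ?_) hslab
    simp only [Set.mem_compl_iff, Set.mem_ofPred_eq] at hx ⊢
    exact fun h => hx ⟨by linarith [h.1], by linarith [h.2]⟩
  set A' : Set W := P '' (A ∩ T)
  set B' : Set W := P '' (B ∩ T)
  have hA' : IsOpen A' := hPo _ (hA.inter hTo)
  have hB' : IsOpen B' := hPo _ (hB.inter hTo)
  have key := ih W hWd s (h - 3 * δ) R (μ.map P) (hμ.map P.toLinearMap hPm hPn) hs (by linarith)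
    (by nlinarith) (by
      intro u hu t
      have hm : MeasurableSet {y : W | ⟪u, y⟫ = t} :=
        (isClosed_eq (by fun_prop) continuous_const).measurableSet
      rw [Measure.map_apply hPm hm]
      have : P ⁻¹' {y : W | ⟪u, y⟫ = t} = {x : E | ⟪(u : E), x⟫ = t} := by
        ext x
        change ⟪u, P x⟫ = t ↔ ⟪(u : E), x⟫ = t
        rw [hP, Submodule.inner_orthogonalProjectionOnto_eq_of_mem_left]
      rw [this]
      exact hnull u (by simpa using hu) t)
    (by
      rw [Measure.map_apply hPm Metric.isClosed_closedBall.measurableSet.compl]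
      refine measure_mono_null (fun x hx => ?_) hR
      simp only [Set.preimage_compl, Set.mem_compl_iff, Set.mem_preimage,
        mem_closedBall_zero_iff, not_le] at hx ⊢
      exact hx.trans_le (hPn x))
    A' B' hA' hB' (by
      rintro _ ⟨a, ⟨haA, haT⟩, rfl⟩ _ ⟨b, ⟨hbB, hbT⟩, rfl⟩
      have h1 := hAB a haA b hbB
      have h2 := hPv (a - b)
      have h3 : |⟪v, a - b⟫| ≤ 3 * δ := by
        rw [inner_sub_right, abs_le]
        constructor <;> linarith [haT.1, haT.2, hbT.1, hbT.2]
      rw [← map_sub]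
      linarith)
  have hlow : ∀ X : Set E, IsOpen X → μ.real X ≤ (μ.map P).real (P '' (X ∩ T)) := by
    intro X hX
    rw [map_measureReal_apply hPm (hPo _ (hX.inter hTo)).measurableSet]
    refine ENNReal.toReal_mono (measure_ne_top _ _) (measure_mono_ae ?_)
    filter_upwards [hTn] with x hx hxX
    exact ⟨x, ⟨hxX, hx⟩, rfl⟩
  have hup : (μ.map P).real (A' ∪ B')ᶜ ≤ μ.real (A ∪ B)ᶜ := by
    rw [map_measureReal_apply hPm (hA'.union hB').measurableSet.compl]
    refine ENNReal.toReal_mono (measure_ne_top _ _) (measure_mono_ae ?_)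
    filter_upwards [hTn] with x hx hxS
    rintro (h | h)
    · exact hxS (Or.inl ⟨x, ⟨h, hx⟩, rfl⟩)
    · exact hxS (Or.inr ⟨x, ⟨h, hx⟩, rfl⟩)
  have huniv : (μ.map P).real Set.univ = μ.real Set.univ := by
    rw [map_measureReal_apply hPm MeasurableSet.univ, Set.preimage_univ]
  rw [huniv] at key
  have hk : 0 ≤ s * (h - 3 * δ) := mul_nonneg hs.le (by linarith)
  calc s * (h - 3 * δ) * (μ.real A * μ.real B)
      ≤ s * (h - 3 * δ) * ((μ.map P).real A' * (μ.map P).real B') := by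
        gcongr
        · exact hlow A hA
        · exact hlow B hB
    _ ≤ 16 * ((μ.map P).real (A' ∪ B')ᶜ * μ.real Set.univ) := key
    _ ≤ _ := by gcongr

lemma isoperimetry_sub_of_dim {d : ℕ} (ih : IsoperimetryInDim (d + 1))
    (hE : Module.finrank ℝ E = d + 2)
    {s h w R : ℝ} {μ : Measure E} [IsFiniteMeasure μ] (hμ : StronglyLogConcave s μ) (hs : 0 < s)
    (hw : 0 < w) (hwh : 3 * (2 * w) < h) (hsh : s * h ≤ 1)
    (hnull : ∀ u : E, u ≠ 0 → ∀ c : ℝ, μ {x | ⟪u, x⟫ = c} = 0)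
    (hR : μ (Metric.closedBall 0 R)ᶜ = 0)
    {A B : Set E} (hA : IsOpen A) (hB : IsOpen B) (hAB : ∀ a ∈ A, ∀ b ∈ B, h ≤ ‖a - b‖) :
    s * (h - 3 * (2 * w)) * (μ.real A * μ.real B) ≤
      16 * (μ.real (A ∪ B)ᶜ * μ.real Set.univ) := by
  obtain ⟨e₁, e₂, h₁, h₂, h₁₂⟩ : ∃ e₁ e₂ : E, ‖e₁‖ = 1 ∧ ‖e₂‖ = 1 ∧ ⟪e₁, e₂⟫ = 0 := by
    have b := stdOrthonormalBasis ℝ E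
    rw [hE] at b
    exact ⟨b 0, b 1, b.orthonormal.1 0, b.orthonormal.1 1, b.orthonormal.2 (by simp)⟩
  set π : E → ℂ := fun x => ⟨⟪e₁, x⟫, ⟪e₂, x⟫⟩ with hπ
  have hlin : IsLinearMap ℝ π :=
    ⟨fun x y => by apply Complex.ext <;> simp [hπ, inner_add_right],
      fun r x => by apply Complex.ext <;> simp [hπ, inner_smul_right]⟩
  have hbound : ∀ x ∈ Metric.closedBall (0 : E) R, π x ∈ Metric.closedBall (0 : ℂ) (2 * R) := by
    intro x hx
    rw [mem_closedBall_zero_iff] at hx ⊢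
    have i1 := abs_real_inner_le_norm e₁ x
    have i2 := abs_real_inner_le_norm e₂ x
    rw [h₁, one_mul] at i1
    rw [h₂, one_mul] at i2
    have := Complex.norm_le_abs_re_add_abs_im (π x)
    simp only [hπ] at this ⊢
    linarith
  obtain ⟨N, hN⟩ : ∃ N : Finset ℂ, ∀ z ∈ Metric.closedBall (0 : ℂ) (2 * R), ∃ p ∈ N,
      dist z p < w / 6 := by
    obtain ⟨T, hT, hT'⟩ := Metric.totallyBounded_iff.1
      (isCompact_closedBall (0 : ℂ) (2 * R)).totallyBounded (w / 6) (by positivity)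
    refine ⟨hT.toFinset, fun z hz => ?_⟩
    obtain ⟨p, hp, hzp⟩ := Set.mem_iUnion₂.1 (hT' hz)
    exact ⟨p, by simpa using hp, hzp⟩
  set a := μ.real A with ha
  set m := μ.real Set.univ with hm
  have hk : 0 ≤ s * (h - 3 * (2 * w)) := mul_nonneg hs.le (by linarith)
  have hball : ∀ Z : Set E, μ.real (Z ∩ Metric.closedBall 0 R) = μ.real Z := by
    intro Z
    refine measureReal_congr ?_
    have h0 : ∀ᵐ x ∂μ, x ∈ Metric.closedBall (0 : E) R := by rw [ae_iff]; exact hR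
    filter_upwards [h0] with x hx
    exact propext ⟨fun h => h.1, fun h => ⟨h, hx⟩⟩
  have main := le_of_forall_balanced_piece hnull h₁ h₂ h₁₂ (A := A) (X := B) (Y := (A ∪ B)ᶜ)
    (a := a) (m := m) (k := s * (h - 3 * (2 * w)) * a) (l := 16 * m) (π := π) (fun x => rfl)
    (N := N) (D := Metric.closedBall 0 R) (by
      intro C hCD hC hCc hbal hint
      obtain ⟨u, hu, c, hc⟩ := exists_strip_of_forall_ball_not_subset (C := π '' C)
        (hCc.is_linear_image hlin) ((Metric.isBounded_closedBall (x := (0 : ℂ)) (r := 2 * R)).subset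
          (by rintro _ ⟨x, hx, rfl⟩; exact hbound x (hCD hx))) hw (by
          intro g hg
          obtain ⟨x, hx, hxg⟩ := hg (Metric.mem_ball_self (by positivity))
          obtain ⟨p, hp, hpd⟩ := hN (π x) (hbound x (hCD hx))
          refine hint p hp (interior_maximal hg Metric.isOpen_ball ?_)
          rw [Metric.mem_ball, dist_comm, ← hxg]
          exact hpd)
      set v := u.re • e₁ + u.im • e₂ with hv
      have hvx : ∀ x, ⟪v, x⟫ = u.re * (π x).re + u.im * (π x).im := fun x => by
        rw [hπ, hv, inner_add_left, inner_smul_left, inner_smul_left]; rfl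
      have hvn : ‖v‖ = 1 := by
        have h3 : ‖v‖ * ‖v‖ = 1 := by
          rw [hv, norm_add_sq_eq_norm_sq_add_norm_sq_real
            (by simp [inner_smul_left, inner_smul_right, h₁₂])]
          have := Complex.sq_norm u
          rw [hu, Complex.normSq_apply] at this
          simp only [norm_smul, h₁, h₂, mul_one, Real.norm_eq_abs, abs_mul_abs_self]
          linarith
        nlinarith [norm_nonneg v]
      have hCm := hC.measurableSet
      have hslab := isoperimetry_of_slab ih hE (hμ.restrict hCc hCm) hs (δ := 2 * w) (by linarith)
        hwh hsh (fun u' hu' c' => by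
          exact Measure.absolutelyContinuous_of_le Measure.restrict_le_self (hnull u' hu' c'))
        (R := R) (Measure.absolutelyContinuous_of_le Measure.restrict_le_self hR) hvn (c := c) (by
          have h0 : ∀ᵐ x ∂(μ.restrict C), c ≤ ⟪v, x⟫ ∧ ⟪v, x⟫ ≤ c + 2 * w := by
            filter_upwards [ae_restrict_mem hCm] with x hx
            rw [hvx]
            exact hc _ ⟨x, hx, rfl⟩
          rw [ae_iff] at h0
          exact h0) hA hB hAB
      rw [measureReal_restrict_apply hA.measurableSet, measureReal_restrict_apply hB.measurableSet,
        measureReal_restrict_apply (hA.union hB).measurableSet.compl,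
        measureReal_restrict_apply MeasurableSet.univ, Set.univ_inter] at hslab
      rcases (measureReal_nonneg (μ := μ) (s := C)).eq_or_lt with h0 | h0
      · have hX : ∀ Z : Set E, μ.real (Z ∩ C) = 0 := fun Z =>
          le_antisymm (h0 ▸ measureReal_mono Set.inter_subset_right) measureReal_nonneg
        simp [hX]
      · refine le_of_mul_le_mul_right ?_ h0
        have hm0 : 0 ≤ m := measureReal_nonneg
        calc s * (h - 3 * (2 * w)) * a * μ.real (B ∩ C) * μ.real C
            = s * (h - 3 * (2 * w)) * (a * μ.real C) * μ.real (B ∩ C) := by ring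
          _ = m * (s * (h - 3 * (2 * w)) * (μ.real (A ∩ C) * μ.real (B ∩ C))) := by
              rw [← hbal]; ring
          _ ≤ m * (16 * (μ.real ((A ∪ B)ᶜ ∩ C) * μ.real C)) := by gcongr
          _ = _ := by ring)
    N (Metric.closedBall 0 R) subset_rfl Metric.isClosed_closedBall (convex_closedBall 0 R)
    (by rw [hball, ← Set.univ_inter (Metric.closedBall 0 R), hball]; ring)
    (fun p hp hp' => absurd hp hp')
  rw [hball, hball] at main
  linarith

/-- The three-set isoperimetric inequality for strongly log-concave measures, with a constant
independent of the dimension. -/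
theorem isoperimetryInDim (d : ℕ) : IsoperimetryInDim (d + 1) := by
  induction d with
  | zero => exact isoperimetryInDim_one
  | succ d ih =>
    intro E _ _ _ _ _ hE s h R μ _ hμ hs hh hsh hnull hR A B hA hB hAB
    have hlim : Tendsto (fun w : ℝ => s * (h - 3 * (2 * w)) * (μ.real A * μ.real B)) (𝓝[>] 0)
        (𝓝 (s * h * (μ.real A * μ.real B))) := by
      have : Continuous fun w : ℝ => s * (h - 3 * (2 * w)) * (μ.real A * μ.real B) := by fun_prop
      simpa using (this.tendsto 0).mono_left nhdsWithin_le_nhds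
    refine le_of_tendsto hlim ?_
    have hev : ∀ᶠ w : ℝ in 𝓝[>] 0, w < h / 6 :=
      nhdsWithin_le_nhds (Iio_mem_nhds (by positivity))
    filter_upwards [hev, self_mem_nhdsWithin] with w hw hw0
    exact isoperimetry_sub_of_dim ih hE hμ hs hw0 (by linarith) hsh hnull hR hA hB hAB

end Isoperimetry

/-! ### The normal density on a ball -/

lemma quadForm_smul {d : ℕ} (J : Matrix (Fin d) (Fin d) ℝ) (c : ℝ) (x : E d) :
    quadForm J (c • x) = c ^ 2 * quadForm J x := by
  simp only [quadForm, WithLp.ofLp_smul, Matrix.mulVec_smul, dotProduct_smul, smul_dotProduct,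
    smul_eq_mul]
  ring

lemma quadForm_parallelogram {d : ℕ} (J : Matrix (Fin d) (Fin d) ℝ) (x y : E d) :
    quadForm J (x + y) + quadForm J (x - y) = 2 * (quadForm J x + quadForm J y) := by
  simp only [quadForm, WithLp.ofLp_add, WithLp.ofLp_sub, Matrix.mulVec_add, Matrix.mulVec_sub,
    dotProduct_add, add_dotProduct, dotProduct_sub, sub_dotProduct]
  ring

@[fun_prop]
lemma continuous_quadForm {d : ℕ} (J : Matrix (Fin d) (Fin d) ℝ) :
    Continuous (quadForm J : E d → ℝ) := by
  unfold quadForm dotProduct Matrix.mulVec dotProduct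
  fun_prop

/-- The measure on the closed ball of radius `R` with density `exp (- x' J x / 2)`. -/
def gaussBall {d : ℕ} (J : Matrix (Fin d) (Fin d) ℝ) (R : ℝ) : Measure (E d) :=
  (volume.restrict (Metric.closedBall 0 R)).withDensity
    fun x => ENNReal.ofReal (Real.exp (-(1 / 2) * quadForm J x))

section Gauss

variable {d : ℕ} {J : Matrix (Fin d) (Fin d) ℝ} {s : ℝ}

lemma gaussBall_apply (R : ℝ) {X : Set (E d)} (hX : MeasurableSet X) :
    gaussBall J R X = ∫⁻ x, (X ∩ Metric.closedBall 0 R).indicator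
      (fun x => ENNReal.ofReal (Real.exp (-(1 / 2) * quadForm J x))) x := by
  rw [gaussBall, withDensity_apply _ hX, Measure.restrict_restrict hX,
    lintegral_indicator (hX.inter Metric.isClosed_closedBall.measurableSet)]

lemma isFiniteMeasure_gaussBall (hJ : ∀ x : E d, s ^ 2 * ‖x‖ ^ 2 ≤ quadForm J x) (R : ℝ) :
    IsFiniteMeasure (gaussBall J R) := by
  refine isFiniteMeasure_withDensity (ne_top_of_le_ne_top
    (b := ∫⁻ _ in Metric.closedBall (0 : E d) R, 1)
    ?_ ?_)
  · simpa using (isCompact_closedBall (0 : E d) R).measure_lt_top.ne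
  · refine lintegral_mono fun x => ?_
    rw [← ENNReal.ofReal_one]
    refine ENNReal.ofReal_le_ofReal (Real.exp_le_one_iff.2 ?_)
    have := hJ x
    have h2 : 0 ≤ s ^ 2 * ‖x‖ ^ 2 := by positivity
    linarith

/-- By the parallelogram identity, `quadForm J` at the midpoint of `x` and `y` falls short of its mean
by `quadForm J (x - y) / 4`, which accounts for the factor `exp ((s * r) ^ 2 / 4)`. -/
lemma stronglyLogConcave_gaussBall (hJ : ∀ x : E d, s ^ 2 * ‖x‖ ^ 2 ≤ quadForm J x) (R : ℝ) :
    StronglyLogConcave s (gaussBall J R) := by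
  intro X Y Z hX hY hZ r hr h
  set K : Set (E d) := Metric.closedBall 0 R
  have hK : MeasurableSet K := Metric.isClosed_closedBall.measurableSet
  set ρ : E d → ℝ≥0∞ := fun x => ENNReal.ofReal (Real.exp (-(1 / 2) * quadForm J x)) with hρ
  have hρm : Measurable ρ := by
    have : Continuous fun x : E d => Real.exp (-(1 / 2) * quadForm J x) := by fun_prop
    exact this.measurable.ennreal_ofReal
  set c := ENNReal.ofReal (Real.exp ((s * r) ^ 2 / 4)) with hc
  rw [gaussBall_apply R hX, gaussBall_apply R hY, gaussBall_apply R hZ, mul_left_comm,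
    ← lintegral_const_mul c (hρm.indicator (hY.inter hK))]
  refine prekopaLeindler_euclidean d _ _ _ (hρm.indicator (hX.inter hK))
    ((hρm.indicator (hY.inter hK)).const_mul c) (hρm.indicator (hZ.inter hK)) ?_
  intro x y
  by_cases hx : x ∈ X ∩ K
  · by_cases hy : y ∈ Y ∩ K
    · obtain ⟨h1, h2⟩ := h x hx.1 y hy.1
      have hz : (2⁻¹ : ℝ) • (x + y) ∈ Z ∩ K := by
        refine ⟨h2, ?_⟩
        rw [smul_add]
        exact convex_closedBall 0 R hx.2 hy.2 (by norm_num) (by norm_num) (by norm_num)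
      rw [Set.indicator_of_mem hx, Set.indicator_of_mem hy, Set.indicator_of_mem hz]
      simp only [hρ, hc]
      rw [← ENNReal.ofReal_mul (Real.exp_pos _).le, ← ENNReal.ofReal_mul (Real.exp_pos _).le,
        ← ENNReal.ofReal_pow (Real.exp_pos _).le, ← Real.exp_add, ← Real.exp_add,
        ← Real.exp_nat_mul]
      refine ENNReal.ofReal_le_ofReal (Real.exp_le_exp.2 ?_)
      have h3 := quadForm_parallelogram J x y
      have h4 := hJ (x - y)
      have h5 : s ^ 2 * r ^ 2 ≤ s ^ 2 * ‖x - y‖ ^ 2 := by gcongr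
      rw [quadForm_smul]
      push_cast
      nlinarith
    · rw [Set.indicator_of_notMem hy, mul_zero, mul_zero]; exact zero_le
  · rw [Set.indicator_of_notMem hx, zero_mul]; exact zero_le

lemma volume_hyperplane {u : E d} (hu : u ≠ 0) (c : ℝ) :
    volume {x : E d | inner ℝ u x = c} = 0 := by
  rcases Set.eq_empty_or_nonempty {x : E d | inner ℝ u x = c} with h | ⟨x₀, hx₀⟩
  · rw [h, measure_empty]
  have e : {x : E d | inner ℝ u x = c} =
      (fun x => x + -x₀) ⁻¹' ((LinearMap.ker (innerSL ℝ u).toLinearMap : Submodule ℝ (E d)) :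
        Set (E d)) := by
    ext x
    have h0 : inner ℝ u x₀ = c := hx₀
    simp [h0, inner_add_right, add_neg_eq_zero]
  rw [e, measure_preimage_add_right]
  refine Measure.addHaar_submodule _ _ fun htop => hu ?_
  have : u ∈ LinearMap.ker (innerSL ℝ u).toLinearMap := by rw [htop]; trivial
  simpa using this

/-- The three-set isoperimetric inequality for the normal density restricted to a ball. -/
lemma gaussBall_isoperimetry (hd : 1 ≤ d) (hs : 0 < s)
    (hJ : ∀ x : E d, s ^ 2 * ‖x‖ ^ 2 ≤ quadForm J x) (R : ℝ) {h : ℝ} (hh : 0 < h)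
    {A B : Set (E d)} (hAB : ∀ a ∈ A, ∀ b ∈ B, h ≤ ‖a - b‖) :
    min (s * h) 1 * min ((gaussBall J R).real A) ((gaussBall J R).real B) ≤
      48 * (gaussBall J R).real (A ∪ B)ᶜ := by
  set γ := gaussBall J R
  have hfin : IsFiniteMeasure γ := isFiniteMeasure_gaussBall hJ R
  set t := min (s * h) 1 with ht
  have ht0 : 0 < t := lt_min (by positivity) one_pos
  have ht1 : t ≤ 1 := min_le_right _ _
  have hts : t / s ≤ h := by rw [div_le_iff₀ hs]; linarith [min_le_left (s * h) 1]
  have hac : γ ≪ volume := (withDensity_absolutelyContinuous _ _).trans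
    (Measure.absolutelyContinuous_of_le Measure.restrict_le_self)
  -- `A` and `B` are replaced by their open thickenings, at distance `t / s - 2 * δ` at least
  have prod : t * (γ.real A * γ.real B) ≤ 16 * (γ.real (A ∪ B)ᶜ * γ.real Set.univ) := by
    have hlim : Tendsto (fun δ : ℝ => s * (t / s - 2 * δ) * (γ.real A * γ.real B)) (𝓝[>] 0)
        (𝓝 (t * (γ.real A * γ.real B))) := by
      have : Continuous fun δ : ℝ => s * (t / s - 2 * δ) * (γ.real A * γ.real B) := by fun_prop
      have h2 := (this.tendsto 0).mono_left (nhdsWithin_le_nhds (s := Set.Ioi 0))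
      rwa [mul_zero, sub_zero, mul_div_cancel₀ t hs.ne'] at h2
    refine le_of_tendsto hlim ?_
    have hev : ∀ᶠ δ : ℝ in 𝓝[>] 0, δ < t / s / 2 :=
      nhdsWithin_le_nhds (Iio_mem_nhds (by positivity))
    filter_upwards [hev, self_mem_nhdsWithin] with δ hδ hδ0
    have hδ' : 0 < δ := hδ0
    have hpos : 0 < t / s - 2 * δ := by linarith
    obtain ⟨k, rfl⟩ : ∃ k, d = k + 1 := ⟨d - 1, by omega⟩
    have key := isoperimetryInDim k (E (k + 1)) (by simp) s (t / s - 2 * δ) R γ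
      (stronglyLogConcave_gaussBall hJ R) hs hpos
      (by
        rw [mul_sub, mul_div_cancel₀ t hs.ne']
        have : 0 < s * (2 * δ) := by positivity
        linarith)
      (fun u hu c => hac (volume_hyperplane hu c))
      (by
        change gaussBall J R _ = 0
        rw [gaussBall_apply R Metric.isClosed_closedBall.measurableSet.compl, Set.compl_inter_self]
        simp)
      (Metric.thickening δ A) (Metric.thickening δ B) Metric.isOpen_thickening
      Metric.isOpen_thickening (by
        intro x hx y hy
        obtain ⟨a, ha, hxa⟩ := Metric.mem_thickening_iff.1 hx
        obtain ⟨b, hb, hyb⟩ := Metric.mem_thickening_iff.1 hy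
        have h1 := hAB a ha b hb
        rw [← dist_eq_norm] at h1 ⊢
        have h2 := dist_triangle4 a x y b
        rw [dist_comm a x] at h2
        linarith)
    have hA := Metric.self_subset_thickening hδ' A
    have hB := Metric.self_subset_thickening hδ' B
    calc s * (t / s - 2 * δ) * (γ.real A * γ.real B)
        ≤ s * (t / s - 2 * δ) *
            (γ.real (Metric.thickening δ A) * γ.real (Metric.thickening δ B)) := by
          have : 0 ≤ s * (t / s - 2 * δ) := by positivity
          gcongr <;> simp
      _ ≤ _ := key
      _ ≤ _ := by gcongr; simp
  set a := γ.real A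
  set b := γ.real B
  set S := γ.real (A ∪ B)ᶜ
  set T := γ.real Set.univ
  have hT : T ≤ a + b + S := by
    have h1 : Set.univ = (A ∪ B) ∪ (A ∪ B)ᶜ := (Set.union_compl_self _).symm
    calc T ≤ γ.real (A ∪ B) + S := by
          change γ.real Set.univ ≤ _
          rw [h1]; exact measureReal_union_le _ _
      _ ≤ _ := by gcongr; exact measureReal_union_le _ _
  have ha0 : 0 ≤ a := measureReal_nonneg
  have hb0 : 0 ≤ b := measureReal_nonneg
  have hS0 : 0 ≤ S := measureReal_nonneg
  have haT : a ≤ T := measureReal_mono (Set.subset_univ _)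
  have hbT : b ≤ T := measureReal_mono (Set.subset_univ _)
  -- if the separating set has less than a third of the mass, the larger of the two sets has at
  -- least a third
  rcases le_or_gt T (3 * S) with h3 | h3
  · have hmin : min a b ≤ T := (min_le_left _ _).trans haT
    have : t * min a b ≤ 1 * min a b := by gcongr
    linarith
  · have hT0 : 0 < T := by linarith
    refine le_of_mul_le_mul_right ?_ hT0
    have hmax : T ≤ 3 * max a b := by
      rcases le_total a b with h | h
      · rw [max_eq_right h]; linarith
      · rw [max_eq_left h]; linarith
    calc t * min a b * T ≤ t * min a b * (3 * max a b) := by gcongr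
      _ = 3 * (t * (a * b)) := by rw [← min_mul_max a b]; ring
      _ ≤ 3 * (16 * (S * T)) := by gcongr
      _ = _ := by ring

end Gauss

lemma lambdaMin_pos {d : ℕ} (hd : 1 ≤ d) {J : Matrix (Fin d) (Fin d) ℝ} (hJ : J.PosDef) :
    0 < lambdaMin J := by
  have hne : Nonempty (Fin d) := ⟨⟨0, hd⟩⟩
  have hspec : spectrum ℝ J = Set.range hJ.1.eigenvalues := hJ.1.spectrum_real_eq_range_eigenvalues
  have hmem : sInf (Set.range hJ.1.eigenvalues) ∈ Set.range hJ.1.eigenvalues :=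
    (Set.range_nonempty _).csInf_mem (Set.finite_range _)
  rw [lambdaMin, hspec]
  obtain ⟨i, hi⟩ := hmem
  rw [← hi]
  exact hJ.eigenvalues_pos i

lemma lambdaMin_mul_le_quadForm {d : ℕ} {J : Matrix (Fin d) (Fin d) ℝ}
    (hJ : J.PosDef) (x : E d) : lambdaMin J * ‖x‖ ^ 2 ≤ quadForm J x := by
  have hspec : spectrum ℝ J = Set.range hJ.1.eigenvalues := hJ.1.spectrum_real_eq_range_eigenvalues
  have hherm : (J - algebraMap ℝ _ (lambdaMin J)).IsHermitian := by
    refine hJ.1.sub ?_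
    rw [Algebra.algebraMap_eq_smul_one]
    simp [Matrix.IsHermitian]
  have hpsd : (J - algebraMap ℝ _ (lambdaMin J)).PosSemidef := by
    rw [hherm.posSemidef_iff_eigenvalues_nonneg]
    intro i
    have h1 := hherm.eigenvalues_mem_spectrum_real i
    rw [← spectrum.sub_singleton_eq] at h1
    obtain ⟨y, hy, z, hz, hyz⟩ := h1
    have h2 : lambdaMin J ≤ y := csInf_le (by rw [hspec]; exact (Set.finite_range _).bddBelow) hy
    rw [Set.mem_singleton_iff] at hz
    simp only [Pi.zero_apply]
    have h3 : y - z = hherm.eigenvalues i := hyz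
    linarith
  have h1 := hpsd.dotProduct_mulVec_nonneg x.ofLp
  have h2 : ‖x‖ ^ 2 = x.ofLp ⬝ᵥ x.ofLp := by
    rw [EuclideanSpace.real_norm_sq_eq]
    simp [dotProduct, sq]
  rw [h2]
  simp only [star_trivial, Matrix.sub_mulVec, dotProduct_sub, Algebra.algebraMap_eq_smul_one,
    Matrix.smul_mulVec, Matrix.one_mulVec, dotProduct_smul, smul_eq_mul] at h1
  rw [quadForm]
  linarith

/-! ### Cheeger's inequality -/

section Cheeger

variable {X : Type*} [MeasurableSpace X]

lemma integrable_of_abs_le {μ : Measure X} [IsFiniteMeasure μ] {f : X → ℝ} (hf : Measurable f)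
    {B : ℝ} (hB : ∀ x, |f x| ≤ B) : Integrable f μ :=
  Integrable.of_bound hf.aestronglyMeasurable B (ae_of_all _ hB)

lemma exists_median {Q : Measure X} [IsProbabilityMeasure Q] {f : X → ℝ} (hf : Measurable f)
    {B : ℝ} (hB : ∀ x, |f x| ≤ B) :
    ∃ m : ℝ, |m| ≤ B ∧ Q.real {x | m < f x} ≤ 1 / 2 ∧ Q.real {x | f x < m} ≤ 1 / 2 := by
  set T := {t : ℝ | Q.real {x | t < f x} ≤ 1 / 2} with hT
  have hBT : B ∈ T := by
    have : {x | B < f x} = ∅ := by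
      ext x; simpa using (abs_le.1 (hB x)).2
    simp [hT, this]
  have hlow : ∀ t ∈ T, -B ≤ t := by
    intro t ht
    by_contra! h
    have h1 : {x | t < f x} = Set.univ := by
      ext x; simpa using h.trans_le (abs_le.1 (hB x)).1
    have h2 : Q.real {x | t < f x} ≤ 1 / 2 := ht
    rw [h1, probReal_univ] at h2
    norm_num at h2
  have hTb : BddBelow T := ⟨-B, hlow⟩
  set m := sInf T with hm
  refine ⟨m, abs_le.2 ⟨le_csInf ⟨B, hBT⟩ hlow, csInf_le hTb hBT⟩, ?_, ?_⟩
  · have hlim : Tendsto (fun n : ℕ => Q.real {x | m + 1 / ((n : ℝ) + 1) < f x}) atTop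
        (𝓝 (Q.real {x | m < f x})) := by
      have e : {x | m < f x} = ⋃ n : ℕ, {x | m + 1 / ((n : ℝ) + 1) < f x} := by
        ext x
        simp only [Set.mem_ofPred_eq, Set.mem_iUnion]
        constructor
        · intro h
          obtain ⟨n, hn⟩ := exists_nat_one_div_lt (sub_pos.2 h)
          exact ⟨n, by linarith⟩
        · rintro ⟨n, hn⟩
          have : (0 : ℝ) < 1 / ((n : ℝ) + 1) := by positivity
          linarith
      rw [e]
      refine (ENNReal.tendsto_toReal (measure_ne_top _ _)).comp
        (tendsto_measure_iUnion_atTop fun i j hij x hx => ?_)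
      have h1 : 1 / ((j : ℝ) + 1) ≤ 1 / ((i : ℝ) + 1) :=
        one_div_le_one_div_of_le (by positivity) (by
          have : (i : ℝ) ≤ j := by exact_mod_cast hij
          linarith)
      have h2 : m + 1 / ((i : ℝ) + 1) < f x := hx
      change m + 1 / ((j : ℝ) + 1) < f x
      linarith
    refine le_of_tendsto hlim (Eventually.of_forall fun n => ?_)
    have hn : (0 : ℝ) < 1 / ((n : ℝ) + 1) := by positivity
    obtain ⟨t, ht, htn⟩ := exists_lt_of_csInf_lt ⟨B, hBT⟩ (lt_add_of_pos_right m hn)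
    have ht' : Q.real {x | t < f x} ≤ 1 / 2 := ht
    exact (measureReal_mono fun x hx => htn.trans hx).trans ht'
  · have hlim : Tendsto (fun n : ℕ => Q.real {x | f x ≤ m - 1 / ((n : ℝ) + 1)}) atTop
        (𝓝 (Q.real {x | f x < m})) := by
      have e : {x | f x < m} = ⋃ n : ℕ, {x | f x ≤ m - 1 / ((n : ℝ) + 1)} := by
        ext x
        simp only [Set.mem_ofPred_eq, Set.mem_iUnion]
        constructor
        · intro h
          obtain ⟨n, hn⟩ := exists_nat_one_div_lt (sub_pos.2 h)
          exact ⟨n, by linarith⟩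
        · rintro ⟨n, hn⟩
          have : (0 : ℝ) < 1 / ((n : ℝ) + 1) := by positivity
          linarith
      rw [e]
      refine (ENNReal.tendsto_toReal (measure_ne_top _ _)).comp
        (tendsto_measure_iUnion_atTop fun i j hij x hx => ?_)
      have h1 : 1 / ((j : ℝ) + 1) ≤ 1 / ((i : ℝ) + 1) :=
        one_div_le_one_div_of_le (by positivity) (by
          have : (i : ℝ) ≤ j := by exact_mod_cast hij
          linarith)
      have h2 : f x ≤ m - 1 / ((i : ℝ) + 1) := hx
      change f x ≤ m - 1 / ((j : ℝ) + 1)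
      linarith
    refine le_of_tendsto hlim (Eventually.of_forall fun n => ?_)
    have hn : (0 : ℝ) < 1 / ((n : ℝ) + 1) := by positivity
    have hnT : m - 1 / ((n : ℝ) + 1) ∉ T := fun h => by
      have := csInf_le hTb h
      linarith
    have h1 : 1 / 2 < Q.real {x | m - 1 / ((n : ℝ) + 1) < f x} := not_le.1 hnT
    have h2 : {x | f x ≤ m - 1 / ((n : ℝ) + 1)} = {x | m - 1 / ((n : ℝ) + 1) < f x}ᶜ := by
      ext x; simp
    rw [h2, probReal_compl_eq_one_sub (measurableSet_lt measurable_const hf)]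
    linarith

/-- The co-area step of Cheeger's inequality: the flow out of the superlevel sets of `G`,
integrated over the levels. -/
lemma mul_integral_le_of_flow {Q : Measure X} [IsProbabilityMeasure Q] {Γ : Measure (X × X)}
    [IsProbabilityMeasure Γ] {φ : ℝ} (hφ : 0 ≤ φ) {G : X → ℝ}
    (hG : Measurable G) (hG0 : ∀ x, 0 ≤ G x) {B : ℝ} (hB : ∀ x, |G x| ≤ B)
    (hflow : ∀ t, 0 < t → φ * Q.real {x | t < G x} ≤
      Γ.real ({x | t < G x} ×ˢ {x | t < G x}ᶜ)) :
    φ * ∫ x, G x ∂Q ≤ ∫ p, (G p.1 - min (G p.1) (G p.2)) ∂Γ := by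
  have hG1 : Measurable fun p : X × X => G p.1 := hG.comp measurable_fst
  have hG2 : Measurable fun p : X × X => G p.2 := hG.comp measurable_snd
  have hmin : Measurable fun p : X × X => min (G p.1) (G p.2) := hG1.min hG2
  have hmb : ∀ p : X × X, |min (G p.1) (G p.2)| ≤ B := fun p => by
    rcases min_choice (G p.1) (G p.2) with h | h <;> rw [h] <;> exact hB _
  have hi1 : Integrable (fun p : X × X => G p.1) Γ := integrable_of_abs_le hG1 fun p => hB p.1
  have him : Integrable (fun p : X × X => min (G p.1) (G p.2)) Γ := integrable_of_abs_le hmin hmb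
  have hmin0 : ∀ p : X × X, 0 ≤ min (G p.1) (G p.2) := fun p => le_min (hG0 _) (hG0 _)
  have hG10 : ∀ p : X × X, 0 ≤ G p.1 := fun p => hG0 p.1
  rw [integral_sub hi1 him]
  have anti : ∀ (Y : Type _) [MeasurableSpace Y] (ν : Measure Y) (F : Y → ℝ),
      Measurable fun t => ν {x | t < F x} := fun Y _ ν F =>
    Antitone.measurable fun s t hst => measure_mono fun x hx => lt_of_le_of_lt hst hx
  have main : (∫⁻ p, ENNReal.ofReal (min (G p.1) (G p.2)) ∂Γ) +
      ENNReal.ofReal φ * (∫⁻ x, ENNReal.ofReal (G x) ∂Q) ≤ ∫⁻ p, ENNReal.ofReal (G p.1) ∂Γ := by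
    rw [lintegral_eq_lintegral_meas_lt _ (ae_of_all _ hmin0) hmin.aemeasurable,
      lintegral_eq_lintegral_meas_lt _ (ae_of_all _ hG0) hG.aemeasurable,
      lintegral_eq_lintegral_meas_lt _ (ae_of_all _ hG10) hG1.aemeasurable,
      ← lintegral_const_mul _ (anti X Q G), ← lintegral_add_left (anti _ Γ _)]
    refine setLIntegral_mono (anti _ Γ _) fun t ht => ?_
    set A := {x | t < G x} with hA
    have hAm : MeasurableSet A := measurableSet_lt measurable_const hG
    have e1 : {p : X × X | t < min (G p.1) (G p.2)} = A ×ˢ A := by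
      ext p; simp [hA]
    have e2 : {p : X × X | t < G p.1} = A ×ˢ A ∪ A ×ˢ Aᶜ := by
      rw [← Set.prod_union, Set.union_compl_self]
      ext p; simp [hA]
    rw [e1, e2, measure_union (by
      rw [Set.disjoint_left]
      rintro p ⟨-, h1⟩ ⟨-, h2⟩
      exact h2 h1) (hAm.prod hAm.compl)]
    gcongr
    have := ENNReal.ofReal_le_ofReal (hflow t ht)
    rwa [ENNReal.ofReal_mul hφ, ofReal_measureReal, ofReal_measureReal] at this
  rw [← ofReal_integral_eq_lintegral_ofReal him (ae_of_all _ hmin0),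
    ← ofReal_integral_eq_lintegral_ofReal hi1 (ae_of_all _ hG10),
    ← ofReal_integral_eq_lintegral_ofReal (integrable_of_abs_le hG hB) (ae_of_all _ hG0),
    ← ENNReal.ofReal_mul hφ,
    ← ENNReal.ofReal_add (integral_nonneg hmin0) (mul_nonneg hφ (integral_nonneg hG0)),
    ENNReal.ofReal_le_ofReal_iff (integral_nonneg hG10)] at main
  linarith

/-- Cheeger's inequality for functions whose support has probability at most one half. -/
lemma cheeger_of_nonneg {Q : Measure X} [IsProbabilityMeasure Q] {Γ : Measure (X × X)}
    [IsProbabilityMeasure Γ] (hfst : Γ.map Prod.fst = Q) (hswap : Γ.map Prod.swap = Γ)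
    {φ : ℝ} (hφ : 0 < φ)
    (hflow : ∀ A, MeasurableSet A → φ * min (Q.real A) (Q.real Aᶜ) ≤ Γ.real (A ×ˢ Aᶜ))
    {g : X → ℝ} (hg : Measurable g) (hg0 : ∀ x, 0 ≤ g x) {B : ℝ} (hB : ∀ x, |g x| ≤ B)
    (hhalf : Q.real {x | 0 < g x} ≤ 1 / 2) :
    φ ^ 2 * ∫ x, g x ^ 2 ∂Q ≤ ∫ p, (g p.1 - g p.2) ^ 2 ∂Γ := by
  set G : X → ℝ := fun x => g x ^ 2 with hGdef
  have hG : Measurable G := hg.pow_const 2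
  have hGB : ∀ x, |G x| ≤ B ^ 2 := fun x => by
    rw [hGdef, abs_pow]
    exact pow_le_pow_left₀ (abs_nonneg _) (hB x) 2
  have hg1 : Measurable fun p : X × X => g p.1 := hg.comp measurable_fst
  have hg2 : Measurable fun p : X × X => g p.2 := hg.comp measurable_snd
  have hG1 : Measurable fun p : X × X => G p.1 := hG.comp measurable_fst
  have hG2 : Measurable fun p : X × X => G p.2 := hG.comp measurable_snd
  have flow := mul_integral_le_of_flow hφ.le hG (fun x => sq_nonneg _) hGB (fun t ht => by
    have hAm : MeasurableSet {x | t < G x} := measurableSet_lt measurable_const hG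
    have h1 := hflow _ hAm
    have h2 : Q.real {x | t < G x} ≤ 1 / 2 := by
      refine (measureReal_mono fun x hx => ?_).trans hhalf
      have hx' : t < g x ^ 2 := hx
      refine lt_of_le_of_ne (hg0 x) fun h => ?_
      rw [← h] at hx'
      norm_num at hx'
      linarith
    rw [min_eq_left] at h1
    · exact h1
    · rw [probReal_compl_eq_one_sub hAm]; linarith)
  have hi1 : Integrable (fun p : X × X => G p.1) Γ := integrable_of_abs_le hG1 fun p => hGB p.1
  have hi2 : Integrable (fun p : X × X => G p.2) Γ := integrable_of_abs_le hG2 fun p => hGB p.2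
  have him : Integrable (fun p : X × X => min (G p.1) (G p.2)) Γ := hi1.inf hi2
  have hid : Integrable (fun p : X × X => (g p.1 - g p.2) ^ 2) Γ := by
    refine integrable_of_abs_le (B := (2 * B) ^ 2) ((hg1.sub hg2).pow_const 2) fun p => ?_
    rw [abs_pow]
    refine pow_le_pow_left₀ (abs_nonneg _) ?_ 2
    have := abs_sub (g p.1) (g p.2)
    linarith [hB p.1, hB p.2]
  have eq1 : ∫ p, G p.1 ∂Γ = ∫ x, G x ∂Q := by
    rw [← hfst, integral_map measurable_fst.aemeasurable hG.aestronglyMeasurable]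
  have eq2 : ∫ p, G p.2 ∂Γ = ∫ x, G x ∂Q := by
    rw [← eq1]
    conv_rhs => rw [← hswap]
    rw [integral_map measurable_swap.aemeasurable (by exact hG1.aestronglyMeasurable)]
    rfl
  set I := ∫ x, G x ∂Q with hI
  have hs1 : Integrable (fun p : X × X => G p.1 - min (G p.1) (G p.2)) Γ := hi1.sub him
  have hs2 : Integrable (fun p : X × X => G p.2 - min (G p.1) (G p.2)) Γ := hi2.sub him
  have hs3 : Integrable (fun p : X × X => 1 / φ * (g p.1 - g p.2) ^ 2) Γ := hid.const_mul _
  have hs4 : Integrable (fun p : X × X => φ / 2 * (G p.1 + G p.2)) Γ := (hi1.add hi2).const_mul _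
  have half : ∫ p, (G p.1 - min (G p.1) (G p.2)) ∂Γ =
      ∫ p, (G p.2 - min (G p.1) (G p.2)) ∂Γ := by
    rw [integral_sub hi1 him, integral_sub hi2 him, eq1, eq2]
  -- `|g² - g'²| = |g - g'| (g + g')`, to which Young's inequality is applied
  have young : ∫ p, ((G p.1 - min (G p.1) (G p.2)) + (G p.2 - min (G p.1) (G p.2))) ∂Γ ≤
      ∫ p, (1 / φ * (g p.1 - g p.2) ^ 2 + φ / 2 * (G p.1 + G p.2)) ∂Γ := by
    refine integral_mono (hs1.add hs2) (hs3.add hs4) fun p => ?_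
    have h1 : (G p.1 - min (G p.1) (G p.2)) + (G p.2 - min (G p.1) (G p.2)) =
        |g p.1 - g p.2| * (g p.1 + g p.2) := by
      simp only [hGdef]
      rcases le_total (g p.1) (g p.2) with h | h
      · rw [min_eq_left (pow_le_pow_left₀ (hg0 _) h 2), abs_of_nonpos (by linarith)]; ring
      · rw [min_eq_right (pow_le_pow_left₀ (hg0 _) h 2), abs_of_nonneg (by linarith)]; ring
    have h2 : 1 / φ * (g p.1 - g p.2) ^ 2 = φ * (|g p.1 - g p.2| / φ) ^ 2 := by
      rw [div_pow, sq_abs]; field_simp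
    simp only
    rw [h1, h2]
    set z := |g p.1 - g p.2| / φ with hz
    have h3 : |g p.1 - g p.2| = φ * z := by rw [hz]; field_simp
    rw [h3]
    simp only [hGdef]
    have h4 : 0 ≤ φ * (z - (g p.1 + g p.2) / 2) ^ 2 := by positivity
    have h5 : 0 ≤ φ * (g p.1 - g p.2) ^ 2 := by positivity
    nlinarith
  rw [integral_add hs1 hs2, ← half, integral_add hs3 hs4, integral_const_mul,
    integral_const_mul, integral_add hi1 hi2, eq1, eq2] at young
  have h6 : φ * I ≤ 1 / φ * ∫ p, (g p.1 - g p.2) ^ 2 ∂Γ := by linarith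
  calc φ ^ 2 * I = φ * (φ * I) := by ring
    _ ≤ φ * (1 / φ * ∫ p, (g p.1 - g p.2) ^ 2 ∂Γ) := by gcongr
    _ = _ := by field_simp

/-- Cheeger's inequality for a symmetric joint distribution `Γ` with marginal `Q`. The positive and
the negative part of the deviation from a median have supports of probability at most one half. -/
lemma cheeger {Q : Measure X} [IsProbabilityMeasure Q] {Γ : Measure (X × X)}
    [IsProbabilityMeasure Γ] (hfst : Γ.map Prod.fst = Q) (hswap : Γ.map Prod.swap = Γ)
    {φ : ℝ} (hφ : 0 < φ)
    (hflow : ∀ A, MeasurableSet A → φ * min (Q.real A) (Q.real Aᶜ) ≤ Γ.real (A ×ˢ Aᶜ))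
    {f : X → ℝ} (hf : Measurable f) {B : ℝ} (hB : ∀ x, |f x| ≤ B) :
    φ ^ 2 * (∫ x, f x ^ 2 ∂Q - (∫ x, f x ∂Q) ^ 2) ≤ ∫ p, (f p.1 - f p.2) ^ 2 ∂Γ := by
  obtain ⟨m, hm, hm1, hm2⟩ := exists_median (Q := Q) hf hB
  set gp : X → ℝ := fun x => max (f x - m) 0 with hgp
  set gm : X → ℝ := fun x => max (m - f x) 0 with hgm
  have hgpm : Measurable gp := (hf.sub_const m).max measurable_const
  have hgmm : Measurable gm := (hf.const_sub m).max measurable_const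
  have habs : ∀ x, |f x - m| ≤ 2 * B := fun x => by
    have := abs_sub (f x) m
    linarith [hB x]
  have hgpB : ∀ x, |gp x| ≤ 2 * B := fun x => by
    have h0 : 0 ≤ 2 * B := (abs_nonneg _).trans (habs x)
    rw [abs_of_nonneg (le_max_right _ _)]
    exact max_le ((le_abs_self _).trans (habs x)) h0
  have hgmB : ∀ x, |gm x| ≤ 2 * B := fun x => by
    have h0 : 0 ≤ 2 * B := (abs_nonneg _).trans (habs x)
    rw [abs_of_nonneg (le_max_right _ _)]
    refine max_le (le_trans ?_ (habs x)) h0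
    rw [abs_sub_comm]; exact le_abs_self _
  have cp := cheeger_of_nonneg hfst hswap hφ hflow hgpm (fun x => le_max_right _ _) hgpB (by
    refine (measureReal_mono fun x hx => ?_).trans hm1
    have hx' : 0 < max (f x - m) 0 := hx
    rw [lt_max_iff] at hx'
    rcases hx' with h | h
    · exact sub_pos.1 h
    · exact absurd h (lt_irrefl _))
  have cm := cheeger_of_nonneg hfst hswap hφ hflow hgmm (fun x => le_max_right _ _) hgmB (by
    refine (measureReal_mono fun x hx => ?_).trans hm2
    have hx' : 0 < max (m - f x) 0 := hx
    rw [lt_max_iff] at hx'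
    rcases hx' with h | h
    · exact sub_pos.1 h
    · exact absurd h (lt_irrefl _))
  have sqI : ∀ {Y : Type _} [MeasurableSpace Y] (ν : Measure Y) [IsFiniteMeasure ν] (g : Y → ℝ),
      Measurable g → (∀ x, |g x| ≤ 4 * B) → Integrable (fun x => g x ^ 2) ν := by
    intro Y _ ν _ g hg hgB
    refine integrable_of_abs_le (B := (4 * B) ^ 2) (hg.pow_const 2) fun x => ?_
    rw [abs_pow]
    exact pow_le_pow_left₀ (abs_nonneg _) (hgB x) 2
  have hB0 : ∀ x, 0 ≤ B := fun x => (abs_nonneg _).trans (hB x)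
  have hdiff : ∀ g : X → ℝ, Measurable g → (∀ x, |g x| ≤ 2 * B) →
      Integrable (fun p : X × X => (g p.1 - g p.2) ^ 2) Γ := by
    intro g hg hgB
    refine sqI Γ (fun p => g p.1 - g p.2) ((hg.comp measurable_fst).sub (hg.comp measurable_snd))
      fun p => ?_
    have := abs_sub (g p.1) (g p.2)
    linarith [hgB p.1, hgB p.2]
  have hmono : (∫ p, (gp p.1 - gp p.2) ^ 2 ∂Γ) + ∫ p, (gm p.1 - gm p.2) ^ 2 ∂Γ ≤
      ∫ p, (f p.1 - f p.2) ^ 2 ∂Γ := by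
    rw [← integral_add (hdiff gp hgpm hgpB) (hdiff gm hgmm hgmB)]
    refine integral_mono ((hdiff gp hgpm hgpB).add (hdiff gm hgmm hgmB))
      (hdiff f hf fun x => by linarith [hB x, hB0 x]) fun p => ?_
    simp only [hgp, hgm]
    rcases le_total (f p.1) m with h1 | h1 <;> rcases le_total (f p.2) m with h2 | h2
    · rw [max_eq_right (by linarith), max_eq_right (by linarith), max_eq_left (by linarith),
        max_eq_left (by linarith)]; nlinarith
    · rw [max_eq_right (by linarith), max_eq_left (by linarith), max_eq_left (by linarith),
        max_eq_right (by linarith)]; nlinarith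
    · rw [max_eq_left (by linarith), max_eq_right (by linarith), max_eq_right (by linarith),
        max_eq_left (by linarith)]; nlinarith
    · rw [max_eq_left (by linarith), max_eq_left (by linarith), max_eq_right (by linarith),
        max_eq_right (by linarith)]; nlinarith
  have hsum : (∫ x, gp x ^ 2 ∂Q) + ∫ x, gm x ^ 2 ∂Q = ∫ x, (f x - m) ^ 2 ∂Q := by
    rw [← integral_add (sqI Q gp hgpm fun x => by linarith [hgpB x, hB0 x])
      (sqI Q gm hgmm fun x => by linarith [hgmB x, hB0 x])]
    refine integral_congr_ae (ae_of_all _ fun x => ?_)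
    simp only [hgp, hgm]
    rcases le_total (f x) m with h | h
    · rw [max_eq_right (by linarith), max_eq_left (by linarith)]; ring
    · rw [max_eq_left (by linarith), max_eq_right (by linarith)]; ring
  have hfi : Integrable f Q := integrable_of_abs_le hf hB
  have hf2 : Integrable (fun x => f x ^ 2) Q := sqI Q f hf fun x => by linarith [hB x, hB0 x]
  have hvar : (∫ x, f x ^ 2 ∂Q) - (∫ x, f x ∂Q) ^ 2 ≤ ∫ x, (f x - m) ^ 2 ∂Q := by
    have e : ∫ x, (f x - m) ^ 2 ∂Q = (∫ x, f x ^ 2 ∂Q) - 2 * m * (∫ x, f x ∂Q) + m ^ 2 := by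
      have : (fun x => (f x - m) ^ 2) = fun x => (f x ^ 2 - 2 * m * f x) + m ^ 2 := by
        funext x; ring
      have hi : Integrable (fun x => 2 * m * f x) Q := hfi.const_mul _
      have hi' : Integrable (fun x => f x ^ 2 - 2 * m * f x) Q := hf2.sub hi
      rw [this, integral_add hi' (integrable_const _), integral_sub hf2 hi, integral_const_mul]
      simp
    rw [e]
    nlinarith [sq_nonneg (∫ x, f x ∂Q - m)]
  calc φ ^ 2 * (∫ x, f x ^ 2 ∂Q - (∫ x, f x ∂Q) ^ 2) ≤ φ ^ 2 * ∫ x, (f x - m) ^ 2 ∂Q := by gcongr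
    _ = φ ^ 2 * (∫ x, gp x ^ 2 ∂Q) + φ ^ 2 * ∫ x, gm x ^ 2 ∂Q := by rw [← hsum]; ring
    _ ≤ _ := by linarith

end Cheeger

/-! ### Convergence of reversible chains -/

section Mixing

open ProbabilityTheory

variable {X : Type*} [MeasurableSpace X]

lemma integral_bind_kernel {Y : Type*} [MeasurableSpace Y] {μ : Measure X} [SFinite μ]
    {κ : Kernel X Y} [IsMarkovKernel κ] {f : Y → ℝ} (hf : Integrable f (μ.bind κ)) :
    ∫ y, f y ∂(μ.bind κ) = ∫ x, ∫ y, f y ∂κ x ∂μ := by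
  rw [Measure.comp_eq_comp_const_apply] at hf ⊢
  rw [Kernel.integral_comp hf]
  simp

/-- The joint distribution of two independent moves from a common starting point drawn from `Q`.
If `κ` is reversible, these are the positions at times `0` and `2` of the stationary chain. -/
def pairLaw (Q : Measure X) (κ : Kernel X X) : Measure (X × X) := Q.bind (κ ×ₖ κ)

/-- The action of a kernel on functions. -/
def kernelAvg (κ : Kernel X X) (f : X → ℝ) : X → ℝ := fun x => ∫ y, f y ∂κ x

variable {Q : Measure X} {κ : Kernel X X}

lemma measurable_kernelAvg {f : X → ℝ} (hf : Measurable f) : Measurable (kernelAvg κ f) :=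
  (hf.stronglyMeasurable.integral_kernel (κ := κ)).measurable

variable [IsMarkovKernel κ]

lemma pairLaw_map_fst (hinv : Kernel.Invariant κ Q) : (pairLaw Q κ).map Prod.fst = Q := by
  rw [pairLaw, Measure.map_comp _ _ measurable_fst, ← Kernel.fst_eq, Kernel.fst_prod, hinv.def]

lemma pairLaw_map_swap : (pairLaw Q κ).map Prod.swap = pairLaw Q κ := by
  rw [pairLaw, Measure.map_comp _ _ measurable_swap, Kernel.map_prod_swap]

lemma pairLaw_real_prod {A B : Set X} (hA : MeasurableSet A) (hB : MeasurableSet B) :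
    (pairLaw Q κ).real (A ×ˢ B) = ∫ x, (κ x).real A * (κ x).real B ∂Q := by
  rw [measureReal_def, pairLaw, Measure.bind_apply (hA.prod hB) (Kernel.aemeasurable _),
    ← integral_toReal]
  · refine integral_congr_ae (ae_of_all _ fun x => ?_)
    simp only [Kernel.prod_apply_prod, ENNReal.toReal_mul, measureReal_def]
  · exact (Kernel.measurable_coe _ (hA.prod hB)).aemeasurable
  · exact ae_of_all _ fun x => measure_lt_top _ _

variable [IsProbabilityMeasure Q]

instance : IsProbabilityMeasure (pairLaw Q κ) :=
  inferInstanceAs (IsProbabilityMeasure ((κ ×ₖ κ) ∘ₘ Q))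

lemma abs_kernelAvg_le {f : X → ℝ} {B : ℝ} (hB : ∀ x, |f x| ≤ B) (x : X) :
    |kernelAvg κ f x| ≤ B := by
  have := norm_integral_le_of_norm_le_const (μ := κ x) (f := f) (C := B)
    (ae_of_all _ fun y => by rw [Real.norm_eq_abs]; exact hB y)
  simpa [kernelAvg] using this

lemma integral_kernelAvg (hinv : Kernel.Invariant κ Q) {f : X → ℝ} (hf : Measurable f) {B : ℝ}
    (hB : ∀ x, |f x| ≤ B) : ∫ x, kernelAvg κ f x ∂Q = ∫ x, f x ∂Q := by
  have hi : Integrable f (Q.bind κ) := by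
    rw [hinv.def]; exact integrable_of_abs_le hf hB
  have := integral_bind_kernel hi
  rw [hinv.def] at this
  exact this.symm

lemma integral_pairLaw_sub_sq (hinv : Kernel.Invariant κ Q) {f : X → ℝ} (hf : Measurable f)
    {B : ℝ} (hB : ∀ x, |f x| ≤ B) :
    ∫ p, (f p.1 - f p.2) ^ 2 ∂(pairLaw Q κ) =
      2 * ∫ x, f x ^ 2 ∂Q - 2 * ∫ x, kernelAvg κ f x ^ 2 ∂Q := by
  have hf1 : Measurable fun p : X × X => f p.1 := hf.comp measurable_fst
  have hf2 : Measurable fun p : X × X => f p.2 := hf.comp measurable_snd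
  have hsqB : ∀ x, |f x ^ 2| ≤ B ^ 2 := fun x => by
    rw [abs_pow]; exact pow_le_pow_left₀ (abs_nonneg _) (hB x) 2
  have hmulB : ∀ p : X × X, |f p.1 * f p.2| ≤ B * B := fun p => by
    rw [abs_mul]
    exact mul_le_mul (hB _) (hB _) (abs_nonneg _) ((abs_nonneg _).trans (hB p.1))
  have i1 : Integrable (fun p : X × X => f p.1 ^ 2) (pairLaw Q κ) :=
    integrable_of_abs_le (hf1.pow_const 2) fun p => hsqB p.1
  have i2 : Integrable (fun p : X × X => f p.2 ^ 2) (pairLaw Q κ) :=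
    integrable_of_abs_le (hf2.pow_const 2) fun p => hsqB p.2
  have i3 : Integrable (fun p : X × X => f p.1 * f p.2) (pairLaw Q κ) :=
    integrable_of_abs_le (hf1.mul hf2) hmulB
  have i4 : Integrable (fun p : X × X => 2 * (f p.1 * f p.2)) (pairLaw Q κ) := i3.const_mul 2
  have i5 : Integrable (fun p : X × X => f p.1 ^ 2 + f p.2 ^ 2) (pairLaw Q κ) := i1.add i2
  have e1 : ∫ p, f p.1 ^ 2 ∂(pairLaw Q κ) = ∫ x, f x ^ 2 ∂Q := by
    conv_rhs => rw [← pairLaw_map_fst hinv]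
    rw [integral_map measurable_fst.aemeasurable (hf.pow_const 2).aestronglyMeasurable]
  have e2 : ∫ p, f p.2 ^ 2 ∂(pairLaw Q κ) = ∫ x, f x ^ 2 ∂Q := by
    rw [← e1]
    conv_rhs => rw [← pairLaw_map_swap]
    rw [integral_map measurable_swap.aemeasurable (hf1.pow_const 2).aestronglyMeasurable]
    rfl
  have e3 : ∫ p, f p.1 * f p.2 ∂(pairLaw Q κ) = ∫ x, kernelAvg κ f x ^ 2 ∂Q := by
    rw [pairLaw, integral_bind_kernel (by exact i3)]
    refine integral_congr_ae (ae_of_all _ fun x => ?_)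
    simp only [Kernel.prod_apply, kernelAvg]
    rw [integral_prod_mul, sq]
  have e : (fun p : X × X => (f p.1 - f p.2) ^ 2) =
      fun p => (f p.1 ^ 2 + f p.2 ^ 2) - 2 * (f p.1 * f p.2) := by
    funext p; ring
  rw [e, integral_sub i5 i4, integral_add i1 i2, integral_const_mul, e1, e2, e3]
  ring

/-- The variance of a function contracts under the chain at a rate given by the conductance of
the two-step chain. -/
lemma variance_kernelAvg_le (hinv : Kernel.Invariant κ Q) {φ : ℝ} (hφ : 0 < φ)
    (hflow : ∀ A, MeasurableSet A → φ * min (Q.real A) (Q.real Aᶜ) ≤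
      ∫ x, (κ x).real A * (κ x).real Aᶜ ∂Q)
    {f : X → ℝ} (hf : Measurable f) {B : ℝ} (hB : ∀ x, |f x| ≤ B) :
    ∫ x, kernelAvg κ f x ^ 2 ∂Q - (∫ x, kernelAvg κ f x ∂Q) ^ 2 ≤
      (1 - φ ^ 2 / 2) * (∫ x, f x ^ 2 ∂Q - (∫ x, f x ∂Q) ^ 2) := by
  have h1 := cheeger (pairLaw_map_fst hinv) pairLaw_map_swap hφ
    (fun A hA => by rw [pairLaw_real_prod hA hA.compl]; exact hflow A hA) hf hB
  rw [integral_pairLaw_sub_sq hinv hf hB] at h1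
  rw [integral_kernelAvg hinv hf hB]
  linarith

lemma lintegral_mul_kernel_eq (hrev : Kernel.IsReversible κ Q) {G : X → ℝ≥0∞}
    (hG : Measurable G) {A : Set X} (hA : MeasurableSet A) :
    ∫⁻ x, G x * κ x A ∂Q = ∫⁻ x in A, ∫⁻ y, G y ∂κ x ∂Q := by
  have hsym : (Q ⊗ₘ κ).map Prod.swap = Q ⊗ₘ κ := by
    symm
    refine Measure.ext_prod fun {s t} hs ht => ?_
    rw [Measure.map_apply measurable_swap (hs.prod ht), Set.preimage_swap_prod,
      Measure.compProd_apply_prod hs ht, Measure.compProd_apply_prod ht hs]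
    exact hrev hs ht
  have hm : Measurable fun p : X × X => G p.1 * A.indicator 1 p.2 :=
    (hG.comp measurable_fst).mul ((measurable_one.indicator hA).comp measurable_snd)
  calc ∫⁻ x, G x * κ x A ∂Q = ∫⁻ p, G p.1 * A.indicator 1 p.2 ∂(Q ⊗ₘ κ) := by
        rw [Measure.lintegral_compProd hm]
        refine lintegral_congr fun x => ?_
        simp only
        rw [lintegral_const_mul _ (measurable_one.indicator hA), lintegral_indicator_one hA]
    _ = ∫⁻ p, G p.2 * A.indicator 1 p.1 ∂(Q ⊗ₘ κ) := by
        conv_lhs => rw [← hsym]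
        rw [lintegral_map hm measurable_swap]
        rfl
    _ = ∫⁻ x in A, ∫⁻ y, G y ∂κ x ∂Q := by
        have hm' : Measurable fun p : X × X => G p.2 * A.indicator 1 p.1 :=
          (hG.comp measurable_snd).mul ((measurable_one.indicator hA).comp measurable_fst)
        rw [Measure.lintegral_compProd hm', ← lintegral_indicator hA]
        refine lintegral_congr fun x => ?_
        simp only
        rw [lintegral_mul_const _ hG]
        by_cases hx : x ∈ A <;> simp [hx]

lemma bind_withDensity (hrev : Kernel.IsReversible κ Q) {g : X → ℝ} (hg : Measurable g)
    (hg0 : ∀ x, 0 ≤ g x) {M : ℝ} (hM : ∀ x, g x ≤ M) :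
    (Q.withDensity fun x => ENNReal.ofReal (g x)).bind κ =
      Q.withDensity fun x => ENNReal.ofReal (kernelAvg κ g x) := by
  ext A hA
  rw [Measure.bind_apply hA (Kernel.aemeasurable _), withDensity_apply _ hA,
    lintegral_withDensity_eq_lintegral_mul _ hg.ennreal_ofReal (Kernel.measurable_coe κ hA)]
  simp only [Pi.mul_apply]
  rw [lintegral_mul_kernel_eq hrev hg.ennreal_ofReal hA]
  refine lintegral_congr fun x => ?_
  rw [kernelAvg, ofReal_integral_eq_lintegral_ofReal (integrable_of_abs_le hg (B := M) fun x => by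
    rw [abs_of_nonneg (hg0 x)]; exact hM x) (ae_of_all _ hg0)]

lemma tvDist_withDensity_le {g : X → ℝ} (hg : Measurable g) (hg0 : ∀ x, 0 ≤ g x) {M : ℝ}
    (hM : ∀ x, g x ≤ M) (h1 : ∫ x, g x ∂Q = 1) :
    tvDist (Q.withDensity fun x => ENNReal.ofReal (g x)) Q ≤
      Real.sqrt (∫ x, g x ^ 2 ∂Q - (∫ x, g x ∂Q) ^ 2) := by
  have hB : ∀ x, |g x| ≤ M := fun x => by rw [abs_of_nonneg (hg0 x)]; exact hM x
  have hgi : Integrable g Q := integrable_of_abs_le hg hB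
  have hg2 : Integrable (fun x => g x ^ 2) Q :=
    integrable_of_abs_le (B := M ^ 2) (hg.pow_const 2) fun x => by
      rw [abs_pow]; exact pow_le_pow_left₀ (abs_nonneg _) (hB x) 2
  set V := ∫ x, g x ^ 2 ∂Q - (∫ x, g x ∂Q) ^ 2 with hV
  have hVe : ∫ x, (g x - 1) ^ 2 ∂Q = V := by
    have e : (fun x => (g x - 1) ^ 2) = fun x => (g x ^ 2 - 2 * g x) + 1 := by funext x; ring
    have hi : Integrable (fun x => 2 * g x) Q := hgi.const_mul 2
    have hi' : Integrable (fun x => g x ^ 2 - 2 * g x) Q := hg2.sub hi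
    rw [e, integral_add hi' (integrable_const _), integral_sub hg2 hi, integral_const_mul, hV, h1]
    simp; ring
  have hd : Integrable (fun x => |g x - 1|) Q := (hgi.sub (integrable_const 1)).abs
  have hd2 : Integrable (fun x => (g x - 1) ^ 2) Q := by
    refine integrable_of_abs_le (B := (M + 1) ^ 2) ((hg.sub_const 1).pow_const 2) fun x => ?_
    rw [abs_pow]
    refine pow_le_pow_left₀ (abs_nonneg _) ?_ 2
    have := abs_sub (g x) 1
    rw [abs_one] at this
    linarith [hB x]
  have hL1 : ∫ x, |g x - 1| ∂Q ≤ Real.sqrt V := by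
    refine Real.le_sqrt_of_sq_le ?_
    rw [← hVe]
    set a := ∫ x, |g x - 1| ∂Q with ha
    have h0 : 0 ≤ ∫ x, (|g x - 1| - a) ^ 2 ∂Q := integral_nonneg fun x => sq_nonneg _
    have e : (fun x => (|g x - 1| - a) ^ 2) =
        fun x => ((g x - 1) ^ 2 - 2 * a * |g x - 1|) + a ^ 2 := by
      funext x; rw [sub_sq, sq_abs]; ring
    have hi : Integrable (fun x => 2 * a * |g x - 1|) Q := hd.const_mul _
    have hi' : Integrable (fun x => (g x - 1) ^ 2 - 2 * a * |g x - 1|) Q := hd2.sub hi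
    rw [e, integral_add hi' (integrable_const _), integral_sub hd2 hi, integral_const_mul,
      ← ha] at h0
    simp at h0
    linarith
  have hne : Nonempty {A : Set X // MeasurableSet A} := ⟨⟨∅, MeasurableSet.empty⟩⟩
  refine ciSup_le fun ⟨A, hA⟩ => le_trans ?_ hL1
  simp only
  have e1 : (Q.withDensity fun x => ENNReal.ofReal (g x)).real A = ∫ x in A, g x ∂Q := by
    rw [measureReal_def, withDensity_apply _ hA,
      integral_eq_lintegral_of_nonneg_ae (ae_of_all _ hg0) hg.aestronglyMeasurable]
  have e2 : Q.real A = ∫ x in A, (1 : ℝ) ∂Q := by simp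
  rw [e1, e2, ← integral_sub hgi.integrableOn (integrable_const _)]
  refine abs_integral_le_integral_abs.trans ?_
  exact setIntegral_le_integral hd (ae_of_all _ fun x => abs_nonneg _)

/-- A reversible chain started from a bounded density converges geometrically, at a rate given by
the conductance of the two-step chain. -/
lemma tvDist_chainLaw_le (hrev : Kernel.IsReversible κ Q) {φ : ℝ} (hφ : 0 < φ) (hφ1 : φ ≤ 1)
    (hflow : ∀ A, MeasurableSet A → φ * min (Q.real A) (Q.real Aᶜ) ≤
      ∫ x, (κ x).real A * (κ x).real Aᶜ ∂Q)
    {g : X → ℝ} (hg : Measurable g) (hg0 : ∀ x, 0 ≤ g x) {M : ℝ} (hM : ∀ x, g x ≤ M)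
    (h1 : ∫ x, g x ∂Q = 1) (t : ℕ) :
    tvDist (chainLaw κ (Q.withDensity fun x => ENNReal.ofReal (g x)) t) Q ≤
      Real.sqrt (M * (1 - φ ^ 2 / 2) ^ t) ∧
    tvDist (chainLaw κ (Q.withDensity fun x => ENNReal.ofReal (g x)) t) Q ≤ 1 - 1 / M := by
  have hinv : Kernel.Invariant κ Q := hrev.invariant
  have hr0 : 0 ≤ 1 - φ ^ 2 / 2 := by nlinarith
  have main : ∃ gt : X → ℝ, Measurable gt ∧ (∀ x, 0 ≤ gt x) ∧ (∀ x, gt x ≤ M) ∧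
      ∫ x, gt x ∂Q = 1 ∧ ∫ x, gt x ^ 2 ∂Q - (∫ x, gt x ∂Q) ^ 2 ≤ M * (1 - φ ^ 2 / 2) ^ t ∧
      chainLaw κ (Q.withDensity fun x => ENNReal.ofReal (g x)) t =
        Q.withDensity fun x => ENNReal.ofReal (gt x) := by
    induction t with
    | zero =>
      refine ⟨g, hg, hg0, hM, h1, ?_, rfl⟩
      have hgi : Integrable g Q := integrable_of_abs_le hg (B := M) fun x => by
        rw [abs_of_nonneg (hg0 x)]; exact hM x
      have : ∫ x, g x ^ 2 ∂Q ≤ ∫ x, M * g x ∂Q := by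
        refine integral_mono_of_nonneg (ae_of_all _ fun x => sq_nonneg _) (hgi.const_mul M)
          (ae_of_all _ fun x => ?_)
        simp only
        rw [sq]
        exact mul_le_mul_of_nonneg_right (hM x) (hg0 x)
      rw [integral_const_mul, h1] at this
      rw [h1]; simp only [pow_zero]; linarith
    | succ t ih =>
      obtain ⟨gt, hm, h0, hle, hint, hvar, heq⟩ := ih
      have hB : ∀ x, |gt x| ≤ M := fun x => by rw [abs_of_nonneg (h0 x)]; exact hle x
      refine ⟨kernelAvg κ gt, measurable_kernelAvg hm, fun x => integral_nonneg h0,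
        fun x => (le_abs_self _).trans (abs_kernelAvg_le hB x), ?_, ?_, ?_⟩
      · rw [integral_kernelAvg hinv hm hB, hint]
      · refine (variance_kernelAvg_le hinv hφ hflow hm hB).trans ?_
        calc _ ≤ (1 - φ ^ 2 / 2) * (M * (1 - φ ^ 2 / 2) ^ t) := by gcongr
          _ = _ := by ring
      · rw [chainLaw, heq, bind_withDensity hrev hm h0 hle]
  obtain ⟨gt, hm, h0, hle, hint, hvar, heq⟩ := main
  rw [heq]
  refine ⟨(tvDist_withDensity_le hm h0 hle hint).trans (Real.sqrt_le_sqrt hvar), ?_⟩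
  have hgi : Integrable gt Q := integrable_of_abs_le hm (B := M) fun x => by
    rw [abs_of_nonneg (h0 x)]; exact hle x
  have hM1 : 1 ≤ M := by
    have := integral_mono hgi (integrable_const M) hle
    rw [hint] at this
    simpa using this
  have hne : Nonempty {A : Set X // MeasurableSet A} := ⟨⟨∅, MeasurableSet.empty⟩⟩
  have hprob : IsProbabilityMeasure (Q.withDensity fun x => ENNReal.ofReal (gt x)) := by
    refine ⟨?_⟩
    rw [withDensity_apply _ MeasurableSet.univ, Measure.restrict_univ,
      ← ofReal_integral_eq_lintegral_ofReal hgi (ae_of_all _ h0), hint, ENNReal.ofReal_one]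
  -- `Q_t ≤ M Q` bounds the difference on `A` from above, and on the complement from below
  have hdom : ∀ A, MeasurableSet A →
      (Q.withDensity fun x => ENNReal.ofReal (gt x)).real A ≤ M * Q.real A := by
    intro A hA
    rw [measureReal_def, withDensity_apply _ hA,
      ← integral_eq_lintegral_of_nonneg_ae (ae_of_all _ h0) hm.aestronglyMeasurable]
    have := setIntegral_mono (s := A) hgi.integrableOn (integrable_const M).integrableOn hle
    simpa [mul_comm] using this
  have hone : ∀ A, MeasurableSet A →
      (Q.withDensity fun x => ENNReal.ofReal (gt x)).real A - Q.real A ≤ 1 - 1 / M := by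
    intro A hA
    have h2 := hdom A hA
    have h3 : (Q.withDensity fun x => ENNReal.ofReal (gt x)).real A ≤ 1 := measureReal_le_one
    have h4 : (Q.withDensity fun x => ENNReal.ofReal (gt x)).real A / M ≤ Q.real A := by
      rw [div_le_iff₀ (by linarith)]; linarith
    have h5 : 0 ≤ (1 - (Q.withDensity fun x => ENNReal.ofReal (gt x)).real A) * (1 - 1 / M) := by
      refine mul_nonneg (by linarith) ?_
      rw [sub_nonneg, div_le_one (by linarith)]; exact hM1
    have h6 : (1 - (Q.withDensity fun x => ENNReal.ofReal (gt x)).real A) * (1 - 1 / M) =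
        1 - 1 / M - (Q.withDensity fun x => ENNReal.ofReal (gt x)).real A +
          (Q.withDensity fun x => ENNReal.ofReal (gt x)).real A / M := by ring
    linarith
  refine ciSup_le fun ⟨A, hA⟩ => abs_le.2 ⟨?_, hone A hA⟩
  have := hone Aᶜ hA.compl
  rw [probReal_compl_eq_one_sub hA, probReal_compl_eq_one_sub hA] at this
  simp only
  linarith

end Mixing

/-! ### From overlap of the one-step distributions to conductance -/

section Overlap

open ProbabilityTheory

variable {X : Type*}

lemma measurable_kernel_real [MeasurableSpace X] {κ : Kernel X X} {A : Set X}
    (hA : MeasurableSet A) : Measurable fun x => (κ x).real A :=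
  (Kernel.measurable_coe κ hA).ennreal_toReal

lemma integral_indicator_one_real [MeasurableSpace X] {Q : Measure X} {A : Set X}
    (hA : MeasurableSet A) : ∫ x, A.indicator (fun _ => (1 : ℝ)) x ∂Q = Q.real A := by
  rw [integral_indicator hA]; simp

lemma integrable_indicator_one [MeasurableSpace X] {Q : Measure X} [IsFiniteMeasure Q]
    {A : Set X} (hA : MeasurableSet A) : Integrable (A.indicator fun _ => (1 : ℝ)) Q :=
  (integrable_const 1).indicator hA

lemma integral_kernel_real [MeasurableSpace X] {Q : Measure X} {κ : Kernel X X}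
    [IsFiniteKernel κ] (hinv : Kernel.Invariant κ Q) {A : Set X} (hA : MeasurableSet A) :
    ∫ x, (κ x).real A ∂Q = Q.real A := by
  have h1 : Q.real A = (Q.bind κ).real A := by rw [hinv.def]
  rw [h1, measureReal_def, Measure.bind_apply hA (Kernel.aemeasurable _), ← integral_toReal
    (Kernel.measurable_coe κ hA).aemeasurable (ae_of_all _ fun x => measure_lt_top _ _)]
  rfl

variable [NormedAddCommGroup X] [MeasurableSpace X] {Q : Measure X}
  [IsProbabilityMeasure Q] {κ : Kernel X X} [IsMarkovKernel κ] {K : Set X} {h c τ : ℝ}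

/-- The two-step conductance. Points from which a move enters `A` with probability close to `1`
are far from those from which it does so with probability close to `0`, and the other points
contribute to the flow. -/
lemma two_step_flow_ge (hinv : Kernel.Invariant κ Q) (hK : MeasurableSet K) (hQK : Q Kᶜ = 0)
    (hc0 : 0 < c) (hc1 : c ≤ 1) (hτ0 : 0 ≤ τ) (hτ1 : τ ≤ 1)
    (hover : ∀ u ∈ K, ∀ v ∈ K, ‖u - v‖ ≤ h → ∀ A, MeasurableSet A →
      (κ u).real A - (κ v).real A < 1 - c)
    (hiso : ∀ A B, MeasurableSet A → MeasurableSet B → (∀ a ∈ A, ∀ b ∈ B, h ≤ ‖a - b‖) →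
      τ * min (Q.real A) (Q.real B) ≤ Q.real (A ∪ B)ᶜ) (A : Set X) (hA : MeasurableSet A) :
    τ * c / 10 * min (Q.real A) (Q.real Aᶜ) ≤ ∫ x, (κ x).real A * (κ x).real Aᶜ ∂Q := by
  set w : X → ℝ := fun x => (κ x).real A with hw
  have hwm : Measurable w := measurable_kernel_real hA
  have hw0 : ∀ x, 0 ≤ w x := fun x => measureReal_nonneg
  have hw1 : ∀ x, w x ≤ 1 := fun x => measureReal_le_one
  have hwc : ∀ x, (κ x).real Aᶜ = 1 - w x := fun x => probReal_compl_eq_one_sub hA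
  simp only [hwc]
  change _ ≤ ∫ x, w x * (1 - w x) ∂Q
  set I := ∫ x, w x * (1 - w x) ∂Q with hI
  have hwi : Integrable w Q := integrable_of_abs_le hwm (B := 1) fun x => by
    rw [abs_of_nonneg (hw0 x)]; exact hw1 x
  have hIi : Integrable (fun x => w x * (1 - w x)) Q :=
    integrable_of_abs_le (B := 1) (hwm.mul (hwm.const_sub 1)) fun x => by
      rw [abs_of_nonneg (mul_nonneg (hw0 x) (by linarith [hw1 x]))]
      nlinarith [hw0 x, hw1 x]
  have hI0 : 0 ≤ I := integral_nonneg fun x => mul_nonneg (hw0 x) (by linarith [hw1 x])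
  set A' := {x | x ∈ K ∧ 1 - c / 2 ≤ w x} with hA'
  set B' := {x | x ∈ K ∧ w x ≤ c / 2} with hB'
  have hA'm : MeasurableSet A' := hK.inter (measurableSet_le measurable_const hwm)
  have hB'm : MeasurableSet B' := hK.inter (measurableSet_le hwm measurable_const)
  set S := (A' ∪ B')ᶜ with hS
  have hSm : MeasurableSet S := (hA'm.union hB'm).compl
  have hKae : ∀ᵐ x ∂Q, x ∈ K := by rw [ae_iff]; exact hQK
  have hsep := hiso A' B' hA'm hB'm (by
    intro a ha b hb
    by_contra! hlt
    have := hover a ha.1 b hb.1 hlt.le A hA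
    have h1 : 1 - c / 2 ≤ (κ a).real A := ha.2
    have h2 : (κ b).real A ≤ c / 2 := hb.2
    linarith)
  have hSI : c / 4 * Q.real S ≤ I := by
    rw [← integral_indicator_one_real hSm, ← integral_const_mul]
    refine integral_mono_ae ((integrable_indicator_one hSm).const_mul _) hIi ?_
    filter_upwards [hKae] with x hx
    by_cases hxS : x ∈ S
    · have h1 : w x < 1 - c / 2 := by
        by_contra! h; exact hxS (Or.inl ⟨hx, h⟩)
      have h2 : c / 2 < w x := by
        by_contra! h; exact hxS (Or.inr ⟨hx, h⟩)
      simp only [Set.indicator_of_mem hxS]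
      nlinarith
    · simp only [Set.indicator_of_notMem hxS, mul_zero]
      exact mul_nonneg (hw0 x) (by linarith [hw1 x])
  have h2I : Integrable (fun x => 2 * (w x * (1 - w x))) Q := hIi.const_mul 2
  have hQA : Q.real A ≤ Q.real A' + Q.real S + 2 * I := by
    have hAS : Integrable (fun x => A'.indicator (fun _ => (1 : ℝ)) x +
        S.indicator (fun _ => (1 : ℝ)) x) Q :=
      (integrable_indicator_one hA'm).add (integrable_indicator_one hSm)
    rw [← integral_kernel_real hinv hA, ← integral_indicator_one_real hSm,
      ← integral_indicator_one_real hA'm, hI, ← integral_const_mul,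
      ← integral_add (integrable_indicator_one hA'm) (integrable_indicator_one hSm),
      ← integral_add hAS h2I]
    refine integral_mono hwi (hAS.add h2I) fun x => ?_
    change w x ≤ _ + _ + 2 * (w x * (1 - w x))
    have h0 : 0 ≤ w x * (1 - w x) := mul_nonneg (hw0 x) (by linarith [hw1 x])
    have hi : ∀ T : Set X, 0 ≤ T.indicator (fun _ => (1 : ℝ)) x := fun T =>
      Set.indicator_nonneg (fun _ _ => zero_le_one) x
    by_cases h1 : x ∈ A'
    · rw [Set.indicator_of_mem h1]; linarith [hi S, hw1 x]
    by_cases h2 : x ∈ B'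
    · have : w x ≤ c / 2 := h2.2
      nlinarith [hi A', hi S, hw0 x]
    · have h3 : x ∈ S := fun h => h.elim h1 h2
      rw [Set.indicator_of_mem h3]; linarith [hi A', hw1 x]
  have hQB : Q.real Aᶜ ≤ Q.real B' + Q.real S + 2 * I := by
    have hBS : Integrable (fun x => B'.indicator (fun _ => (1 : ℝ)) x +
        S.indicator (fun _ => (1 : ℝ)) x) Q :=
      (integrable_indicator_one hB'm).add (integrable_indicator_one hSm)
    have e : Q.real Aᶜ = ∫ x, (1 - w x) ∂Q := by
      rw [integral_sub (integrable_const 1) hwi, probReal_compl_eq_one_sub hA,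
        integral_kernel_real hinv hA]
      simp
    rw [e, ← integral_indicator_one_real hSm,
      ← integral_indicator_one_real hB'm, hI, ← integral_const_mul,
      ← integral_add (integrable_indicator_one hB'm) (integrable_indicator_one hSm),
      ← integral_add hBS h2I]
    refine integral_mono ((integrable_const 1).sub hwi) (hBS.add h2I) fun x => ?_
    change 1 - w x ≤ _ + _ + 2 * (w x * (1 - w x))
    have h0 : 0 ≤ w x * (1 - w x) := mul_nonneg (hw0 x) (by linarith [hw1 x])
    have hi : ∀ T : Set X, 0 ≤ T.indicator (fun _ => (1 : ℝ)) x := fun T =>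
      Set.indicator_nonneg (fun _ _ => zero_le_one) x
    by_cases h1 : x ∈ B'
    · rw [Set.indicator_of_mem h1]; linarith [hi S, hw0 x]
    by_cases h2 : x ∈ A'
    · have : 1 - c / 2 ≤ w x := h2.2
      nlinarith [hi B', hi S, hw1 x]
    · have h3 : x ∈ S := fun h => h.elim h2 h1
      rw [Set.indicator_of_mem h3]; linarith [hi B', hw0 x]
  have hmin : min (Q.real A) (Q.real Aᶜ) ≤
      min (Q.real A') (Q.real B') + (Q.real S + 2 * I) := by
    rw [← min_add_add_right]
    exact min_le_min (by linarith) (by linarith)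
  have hS0 : 0 ≤ Q.real S := measureReal_nonneg
  have h1 : τ * min (Q.real A) (Q.real Aᶜ) ≤ 2 * Q.real S + 2 * I := by
    calc τ * min (Q.real A) (Q.real Aᶜ)
        ≤ τ * (min (Q.real A') (Q.real B') + (Q.real S + 2 * I)) := by gcongr
      _ = τ * min (Q.real A') (Q.real B') + τ * (Q.real S + 2 * I) := by ring
      _ ≤ Q.real S + 1 * (Q.real S + 2 * I) := by gcongr
      _ = _ := by ring
  calc τ * c / 10 * min (Q.real A) (Q.real Aᶜ)
      = c / 10 * (τ * min (Q.real A) (Q.real Aᶜ)) := by ring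
    _ ≤ c / 10 * (2 * Q.real S + 2 * I) := by gcongr
    _ = 4 / 5 * (c / 4 * Q.real S) + c / 5 * I := by ring
    _ ≤ 4 / 5 * I + 1 / 5 * I := by gcongr
    _ = I := by ring

/-- The conductance, by the same argument. -/
lemma flow_ge (hinv : Kernel.Invariant κ Q) (hK : MeasurableSet K) (hQK : Q Kᶜ = 0)
    (hc0 : 0 < c) (hτ0 : 0 ≤ τ) (hτ1 : τ ≤ 1)
    (hover : ∀ u ∈ K, ∀ v ∈ K, ‖u - v‖ ≤ h → ∀ A, MeasurableSet A →
      (κ u).real A - (κ v).real A < 1 - c)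
    (hiso : ∀ A B, MeasurableSet A → MeasurableSet B → (∀ a ∈ A, ∀ b ∈ B, h ≤ ‖a - b‖) →
      τ * min (Q.real A) (Q.real B) ≤ Q.real (A ∪ B)ᶜ) (A : Set X) (hA : MeasurableSet A) :
    τ * c / 6 * min (Q.real A) (Q.real Aᶜ) ≤ ∫ x in A, (κ x).real Aᶜ ∂Q := by
  set w : X → ℝ := fun x => (κ x).real A with hw
  have hwm : Measurable w := measurable_kernel_real hA
  have hw0 : ∀ x, 0 ≤ w x := fun x => measureReal_nonneg
  have hw1 : ∀ x, w x ≤ 1 := fun x => measureReal_le_one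
  have hwc : ∀ x, (κ x).real Aᶜ = 1 - w x := fun x => probReal_compl_eq_one_sub hA
  have hwi : Integrable w Q := integrable_of_abs_le hwm (B := 1) fun x => by
    rw [abs_of_nonneg (hw0 x)]; exact hw1 x
  simp only [hwc]
  rw [← integral_indicator hA]
  set a : X → ℝ := A.indicator fun x => 1 - w x with ha
  set b : X → ℝ := Aᶜ.indicator w with hb
  have hai : Integrable a Q := ((integrable_const 1).sub hwi).indicator hA
  have hbi : Integrable b Q := hwi.indicator hA.compl
  have ha0 : ∀ x, 0 ≤ a x := fun x => Set.indicator_nonneg (fun x _ => by linarith [hw1 x]) x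
  have hb0 : ∀ x, 0 ≤ b x := fun x => Set.indicator_nonneg (fun x _ => hw0 x) x
  set Φ := ∫ x, a x ∂Q with hΦ
  have hΦ0 : 0 ≤ Φ := integral_nonneg ha0
  -- the flow into `A` equals the flow out of `A`
  have hbΦ : ∫ x, b x ∂Q = Φ := by
    have h1 : ∫ x in A, (1 - w x) ∂Q = Q.real A - ∫ x in A, w x ∂Q := by
      rw [integral_sub (integrable_const 1) hwi.integrableOn]; simp
    have h2 := integral_add_compl hA hwi
    rw [integral_kernel_real hinv hA] at h2
    rw [hΦ, ha, hb, integral_indicator hA, integral_indicator hA.compl, h1]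
    linarith
  set A' := {x | x ∈ K ∧ x ∈ A ∧ 1 - w x < c / 2} with hA'
  set B' := {x | x ∈ K ∧ x ∈ Aᶜ ∧ w x < c / 2} with hB'
  have hA'm : MeasurableSet A' :=
    hK.inter (hA.inter (measurableSet_lt (hwm.const_sub 1) measurable_const))
  have hB'm : MeasurableSet B' :=
    hK.inter (hA.compl.inter (measurableSet_lt hwm measurable_const))
  set S := (A' ∪ B')ᶜ with hS
  have hSm : MeasurableSet S := (hA'm.union hB'm).compl
  have hKae : ∀ᵐ x ∂Q, x ∈ K := by rw [ae_iff]; exact hQK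
  have hsep := hiso A' B' hA'm hB'm (by
    intro u hu v hv
    by_contra! hlt
    have := hover u hu.1 v hv.1 hlt.le A hA
    have h1 : 1 - (κ u).real A < c / 2 := hu.2.2
    have h2 : (κ v).real A < c / 2 := hv.2.2
    linarith)
  have hi : ∀ (T : Set X) x, 0 ≤ T.indicator (fun _ => (1 : ℝ)) x := fun T x =>
    Set.indicator_nonneg (fun _ _ => zero_le_one) x
  have haA : ∀ x ∈ A, a x = 1 - w x := fun x hx => Set.indicator_of_mem hx _
  have hbA : ∀ x ∉ A, b x = w x := fun x hx => Set.indicator_of_mem (s := Aᶜ) hx _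
  have hQS : c / 2 * Q.real S ≤ 2 * Φ := by
    have e : 2 * Φ = ∫ x, (a x + b x) ∂Q := by rw [integral_add hai hbi, hbΦ]; ring
    rw [e, ← integral_indicator_one_real hSm, ← integral_const_mul]
    refine integral_mono_ae ((integrable_indicator_one hSm).const_mul _) (hai.add hbi) ?_
    filter_upwards [hKae] with x hx
    change c / 2 * _ ≤ a x + b x
    by_cases hxS : x ∈ S
    · rw [Set.indicator_of_mem hxS]
      by_cases hxA : x ∈ A
      · have h1 : c / 2 ≤ 1 - w x := by
          by_contra! h; exact hxS (Or.inl ⟨hx, hxA, h⟩)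
        linarith [haA x hxA, hb0 x]
      · have h1 : c / 2 ≤ w x := by
          by_contra! h; exact hxS (Or.inr ⟨hx, hxA, h⟩)
        linarith [hbA x hxA, ha0 x]
    · rw [Set.indicator_of_notMem hxS]; linarith [ha0 x, hb0 x]
  have hQA : c / 2 * Q.real A ≤ c / 2 * Q.real A' + Φ := by
    rw [← integral_indicator_one_real hA, ← integral_indicator_one_real hA'm,
      ← integral_const_mul, ← integral_const_mul,
      ← integral_add ((integrable_indicator_one hA'm).const_mul _) hai]
    refine integral_mono_ae ((integrable_indicator_one hA).const_mul _)
      (((integrable_indicator_one hA'm).const_mul _).add hai) ?_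
    filter_upwards [hKae] with x hx
    change c / 2 * _ ≤ c / 2 * _ + a x
    by_cases hxA : x ∈ A
    · rw [Set.indicator_of_mem hxA]
      by_cases h1 : x ∈ A'
      · rw [Set.indicator_of_mem h1]; linarith [ha0 x]
      · have h2 : c / 2 ≤ 1 - w x := by
          by_contra! h; exact h1 ⟨hx, hxA, h⟩
        rw [Set.indicator_of_notMem h1]; linarith [haA x hxA]
    · rw [Set.indicator_of_notMem hxA, mul_zero]
      have := mul_nonneg (by linarith : 0 ≤ c / 2) (hi A' x)
      linarith [ha0 x]
  have hQB : c / 2 * Q.real Aᶜ ≤ c / 2 * Q.real B' + Φ := by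
    rw [← hbΦ, ← integral_indicator_one_real hA.compl, ← integral_indicator_one_real hB'm,
      ← integral_const_mul, ← integral_const_mul,
      ← integral_add ((integrable_indicator_one hB'm).const_mul _) hbi]
    refine integral_mono_ae ((integrable_indicator_one hA.compl).const_mul _)
      (((integrable_indicator_one hB'm).const_mul _).add hbi) ?_
    filter_upwards [hKae] with x hx
    change c / 2 * _ ≤ c / 2 * _ + b x
    by_cases hxA : x ∈ Aᶜ
    · rw [Set.indicator_of_mem hxA]
      by_cases h1 : x ∈ B'
      · rw [Set.indicator_of_mem h1]; linarith [hb0 x]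
      · have h2 : c / 2 ≤ w x := by
          by_contra! h; exact h1 ⟨hx, hxA, h⟩
        rw [Set.indicator_of_notMem h1]; linarith [hbA x hxA]
    · rw [Set.indicator_of_notMem hxA, mul_zero]
      have := mul_nonneg (by linarith : 0 ≤ c / 2) (hi B' x)
      linarith [hb0 x]
  have hmin : c / 2 * min (Q.real A) (Q.real Aᶜ) ≤
      c / 2 * min (Q.real A') (Q.real B') + Φ := by
    rw [mul_min_of_nonneg _ _ (by linarith), mul_min_of_nonneg _ _ (by linarith),
      ← min_add_add_right]
    exact min_le_min hQA hQB
  calc τ * c / 6 * min (Q.real A) (Q.real Aᶜ)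
      = τ / 3 * (c / 2 * min (Q.real A) (Q.real Aᶜ)) := by ring
    _ ≤ τ / 3 * (c / 2 * min (Q.real A') (Q.real B') + Φ) := by gcongr
    _ = c / 6 * (τ * min (Q.real A') (Q.real B')) + τ / 3 * Φ := by ring
    _ ≤ c / 6 * Q.real S + 1 / 3 * Φ := by gcongr
    _ = 1 / 3 * (c / 2 * Q.real S) + 1 / 3 * Φ := by ring
    _ ≤ 1 / 3 * (2 * Φ) + 1 / 3 * Φ := by gcongr
    _ = Φ := by ring

end Overlap

/-! ### Warm starts -/

/-- If `Q` has events of arbitrarily small positive probability, then an `M`-warm distribution has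
a density bounded by `M`; in particular it is absolutely continuous, although the definition of
warmness says nothing about `Q`-null sets. -/
lemma IsWarm.exists_density {X : Type*} [MeasurableSpace X] {Q Q₀ : Measure X}
    [IsProbabilityMeasure Q] [IsProbabilityMeasure Q₀] {M : ℝ} (hw : IsWarm Q₀ Q M)
    (hsmall : ∀ ε : ℝ≥0∞, 0 < ε → ∃ B, MeasurableSet B ∧ 0 < Q B ∧ Q B ≤ ε) :
    1 ≤ M ∧ ∃ g : X → ℝ, Measurable g ∧ (∀ x, 0 ≤ g x) ∧ (∀ x, g x ≤ M) ∧ ∫ x, g x ∂Q = 1 ∧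
      Q₀ = Q.withDensity fun x => ENNReal.ofReal (g x) := by
  have hle : ∀ A, MeasurableSet A → 0 < Q A → Q₀ A ≤ ENNReal.ofReal M * Q A := by
    intro A hA hQA
    rw [← ENNReal.div_le_iff hQA.ne' (measure_ne_top _ _), ← hw]
    exact le_iSup₂_of_le A hA (le_iSup_of_le hQA le_rfl)
  have hM : 1 ≤ M := by
    have := hle Set.univ MeasurableSet.univ (by simp)
    simpa using this
  have hM0 : (0 : ℝ) ≤ M := by linarith
  have hnull : ∀ A, MeasurableSet A → Q A = 0 → Q₀ A = 0 := by
    intro A hA hQA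
    have hlim : Tendsto (fun ε : ℝ≥0∞ => ENNReal.ofReal M * ε) (𝓝[>] 0) (𝓝 0) := by
      have := ENNReal.Tendsto.const_mul (a := ENNReal.ofReal M) (tendsto_id (α := ℝ≥0∞) (x := 𝓝 0))
        (Or.inr ENNReal.ofReal_ne_top)
      rw [mul_zero] at this
      exact this.mono_left nhdsWithin_le_nhds
    refine le_antisymm (ge_of_tendsto hlim ?_) bot_le
    filter_upwards [self_mem_nhdsWithin] with ε hε
    obtain ⟨B, hB, hB0, hBε⟩ := hsmall ε hε
    calc Q₀ A ≤ Q₀ (A ∪ B) := measure_mono Set.subset_union_left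
      _ ≤ ENNReal.ofReal M * Q (A ∪ B) :=
          hle _ (hA.union hB) (hB0.trans_le (measure_mono Set.subset_union_right))
      _ ≤ ENNReal.ofReal M * ε := by
          gcongr
          refine (measure_union_le _ _).trans ?_
          rw [hQA, zero_add]; exact hBε
  have hac : Q₀ ≪ Q := Measure.AbsolutelyContinuous.mk fun A hA h => hnull A hA h
  set r := Q₀.rnDeriv Q with hr
  have hrm : Measurable r := Measure.measurable_rnDeriv _ _
  have hrQ : Q.withDensity r = Q₀ := Measure.withDensity_rnDeriv_eq _ _ hac
  have hrM : r ≤ᵐ[Q] fun _ => ENNReal.ofReal M := by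
    refine ae_le_of_forall_setLIntegral_le_of_sigmaFinite hrm fun A hA _ => ?_
    rw [← withDensity_apply _ hA, hrQ, setLIntegral_const]
    rcases eq_or_ne (Q A) 0 with h | h
    · rw [hnull A hA h]; exact bot_le
    · exact hle A hA (pos_iff_ne_zero.2 h)
  set g : X → ℝ := fun x => min (r x).toReal M with hg
  have hgm : Measurable g := hrm.ennreal_toReal.min measurable_const
  have hg0 : ∀ x, 0 ≤ g x := fun x => le_min ENNReal.toReal_nonneg hM0
  have hgM : ∀ x, g x ≤ M := fun x => min_le_right _ _
  have hgr : (fun x => ENNReal.ofReal (g x)) =ᵐ[Q] r := by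
    filter_upwards [hrM] with x hx
    have h1 : r x ≠ ∞ := ne_top_of_le_ne_top ENNReal.ofReal_ne_top hx
    have h2 : (r x).toReal ≤ M := ENNReal.toReal_le_of_le_ofReal hM0 hx
    simp only [hg]
    rw [min_eq_left h2, ENNReal.ofReal_toReal h1]
  have hQ₀ : Q₀ = Q.withDensity fun x => ENNReal.ofReal (g x) := by
    rw [withDensity_congr_ae hgr, hrQ]
  refine ⟨hM, g, hgm, hg0, hgM, ?_, hQ₀⟩
  have h1 : ∫⁻ x, ENNReal.ofReal (g x) ∂Q = 1 := by
    rw [← setLIntegral_univ, ← withDensity_apply _ MeasurableSet.univ, ← hQ₀, measure_univ]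
  rw [integral_eq_lintegral_of_nonneg_ae (ae_of_all _ hg0) hgm.aestronglyMeasurable, h1]
  simp

/-! ### The Metropolis kernel -/

section Metropolis

open ProbabilityTheory

variable {d : ℕ} {K : Set (E d)} {f : E d → ℝ} {q : E d → E d → ℝ}

lemma oneStep_apply (u : E d) {A : Set (E d)} (hA : MeasurableSet A) :
    oneStep K f q u A = ∫⁻ x in A, ENNReal.ofReal (moveDensity f q u x) ∂(volume.restrict K) +
      A.indicator (fun u => 1 - moveProb K f q u) u := by
  rw [oneStep, Measure.add_apply, withDensity_apply _ hA, Measure.smul_apply,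
    Measure.dirac_apply' _ hA]
  by_cases hu : u ∈ A <;> simp [hu]

/-- Admissible data for the Metropolis walk on `K`: a target density `f`, positive and integrable
on the set `K` of positive volume, and a jointly measurable family `q u` of probability densities,
`u ∈ K`. -/
structure MetropolisData (K : Set (E d)) (f : E d → ℝ) (q : E d → E d → ℝ) : Prop where
  measurableSet : MeasurableSet K
  volume_pos : 0 < volume K
  measurable_density : Measurable f
  density_pos : ∀ x ∈ K, 0 < f x
  integrableOn : IntegrableOn f K
  measurable_proposal : Measurable fun p : E d × E d => q p.1 p.2
  proposal_nonneg : ∀ u ∈ K, ∀ x, 0 ≤ q u x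
  lintegral_proposal : ∀ u ∈ K, ∫⁻ x, ENNReal.ofReal (q u x) = 1

namespace MetropolisData

lemma measurable_moveDensity (h : MetropolisData K f q) :
    Measurable fun p : E d × E d => moveDensity f q p.1 p.2 := by
  have h1 := h.measurable_proposal
  have h2 : Measurable fun p : E d × E d => q p.2 p.1 := h1.comp measurable_swap
  have h3 := h.measurable_density
  unfold moveDensity
  exact ((((h3.comp measurable_snd).mul h2).div ((h3.comp measurable_fst).mul h1)).min
    measurable_const).mul h1

lemma moveDensity_le (h : MetropolisData K f q) {u : E d} (hu : u ∈ K) (x : E d) :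
    moveDensity f q u x ≤ q u x :=
  mul_le_of_le_one_left (h.proposal_nonneg u hu x) (min_le_right _ _)

/-- Detailed balance. -/
lemma density_mul_moveDensity (h : MetropolisData K f q) {u x : E d} (hu : u ∈ K) (hx : x ∈ K) :
    f u * moveDensity f q u x = min (f x * q x u) (f u * q u x) := by
  have hfu := h.density_pos u hu
  have hfx := h.density_pos x hx
  rcases (h.proposal_nonneg u hu x).eq_or_lt with h0 | h0
  · have : 0 ≤ f x * q x u := mul_nonneg hfx.le (h.proposal_nonneg x hx u)
    rw [moveDensity, ← h0, mul_zero, mul_zero, min_eq_right this]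
  · have hp : 0 < f u * q u x := mul_pos hfu h0
    rw [moveDensity, mul_left_comm, min_mul_of_nonneg _ _ hp.le, div_mul_cancel₀ _ hp.ne', one_mul]

lemma moveProb_le_one (h : MetropolisData K f q) {u : E d} (hu : u ∈ K) :
    moveProb K f q u ≤ 1 := by
  rw [moveProb, ← h.lintegral_proposal u hu]
  exact (setLIntegral_le_lintegral _ _).trans
    (lintegral_mono fun x => ENNReal.ofReal_le_ofReal (h.moveDensity_le hu x))

lemma measurable_moveProb (h : MetropolisData K f q) : Measurable (moveProb K f q) :=
  h.measurable_moveDensity.ennreal_ofReal.lintegral_prod_right'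

lemma measurable_oneStep (h : MetropolisData K f q) : Measurable (oneStep K f q) := by
  refine Measure.measurable_of_measurable_coe _ fun A hA => ?_
  simp only [oneStep_apply _ hA]
  exact h.measurable_moveDensity.ennreal_ofReal.lintegral_prod_right'.add
    ((measurable_const.sub h.measurable_moveProb).indicator hA)

open scoped Classical in
/-- The Metropolis walk on `K` as a Markov kernel on the whole space, which leaves the points
outside `K` where they are. -/
def kernel (h : MetropolisData K f q) : Kernel (E d) (E d) where
  toFun := K.piecewise (oneStep K f q) Measure.dirac
  measurable' := h.measurable_oneStep.piecewise h.measurableSet Measure.measurable_dirac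

lemma kernel_apply (h : MetropolisData K f q) {u : E d} (hu : u ∈ K) :
    h.kernel u = oneStep K f q u := by
  classical
  exact Set.piecewise_eq_of_mem _ _ _ hu

lemma isProbabilityMeasure_oneStep (h : MetropolisData K f q) {u : E d} (hu : u ∈ K) :
    IsProbabilityMeasure (oneStep K f q u) := by
  constructor
  rw [oneStep_apply u MeasurableSet.univ, Measure.restrict_univ, Set.indicator_univ]
  exact add_tsub_cancel_of_le (h.moveProb_le_one hu)

lemma oneStep_compl (h : MetropolisData K f q) {u : E d} (hu : u ∈ K) :
    oneStep K f q u Kᶜ = 0 := by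
  rw [oneStep_apply u h.measurableSet.compl, Measure.restrict_restrict h.measurableSet.compl]
  simp [hu]

instance isMarkovKernel (h : MetropolisData K f q) : IsMarkovKernel h.kernel := by
  refine ⟨fun u => ?_⟩
  by_cases hu : u ∈ K
  · rw [h.kernel_apply hu]; exact h.isProbabilityMeasure_oneStep hu
  · have : h.kernel u = Measure.dirac u := by
      classical
      exact Set.piecewise_eq_of_notMem _ _ _ hu
    rw [this]; infer_instance

/-! #### The target -/

lemma mass_pos (h : MetropolisData K f q) : ∫⁻ x in K, ENNReal.ofReal (f x) ≠ 0 := by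
  have := (setLIntegral_pos_iff h.measurable_density.ennreal_ofReal (μ := volume) (s := K)).2 (by
    refine h.volume_pos.trans_le (measure_mono fun x hx => ⟨?_, hx⟩)
    simpa using h.density_pos x hx)
  exact this.ne'

lemma mass_ne_top (h : MetropolisData K f q) : ∫⁻ x in K, ENNReal.ofReal (f x) ≠ ∞ :=
  h.integrableOn.lintegral_lt_top.ne

lemma isProbabilityMeasure_target (h : MetropolisData K f q) :
    IsProbabilityMeasure (target K f) := by
  constructor
  rw [target, Measure.smul_apply, withDensity_apply _ MeasurableSet.univ, Measure.restrict_univ,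
    smul_eq_mul, ENNReal.inv_mul_cancel h.mass_pos h.mass_ne_top]

lemma target_absolutelyContinuous : target K f ≪ volume.restrict K :=
  (Measure.AbsolutelyContinuous.rfl.smul_left _).trans (withDensity_absolutelyContinuous _ _)

lemma target_compl (h : MetropolisData K f q) : target K f Kᶜ = 0 :=
  target_absolutelyContinuous (by
    rw [Measure.restrict_apply h.measurableSet.compl, Set.compl_inter_self, measure_empty])

lemma setLIntegral_kernel (h : MetropolisData K f q) {A B : Set (E d)} (hA : MeasurableSet A)
    (hB : MeasurableSet B) :
    ∫⁻ u in A, h.kernel u B ∂((volume.restrict K).withDensity fun x => ENNReal.ofReal (f x)) =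
      ∫⁻ u in A, ∫⁻ x in B, ENNReal.ofReal (f u * moveDensity f q u x) ∂(volume.restrict K)
        ∂(volume.restrict K) +
      ∫⁻ u in A ∩ B, ENNReal.ofReal (f u) * (1 - moveProb K f q u) ∂(volume.restrict K) := by
  have hF := h.measurable_density.ennreal_ofReal
  have hmd := h.measurable_moveDensity
  have hG : Measurable fun p : E d × E d => ENNReal.ofReal (f p.1 * moveDensity f q p.1 p.2) :=
    ((h.measurable_density.comp measurable_fst).mul hmd).ennreal_ofReal
  rw [setLIntegral_withDensity_eq_setLIntegral_mul _ hF (h.kernel.measurable_coe hB) hA,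
    Set.inter_comm, ← Measure.restrict_restrict hB, ← lintegral_indicator hB,
    ← lintegral_add_left hG.lintegral_prod_right', Measure.restrict_restrict hA]
  refine setLIntegral_congr_fun (hA.inter h.measurableSet) fun u hu => ?_
  have huK : u ∈ K := hu.2
  have e : ∀ x, ENNReal.ofReal (f u * moveDensity f q u x) =
      ENNReal.ofReal (f u) * ENNReal.ofReal (moveDensity f q u x) := fun x =>
    ENNReal.ofReal_mul (h.density_pos u huK).le
  have hmdu : Measurable fun x => moveDensity f q u x := hmd.comp measurable_prodMk_left
  simp only [Pi.mul_apply, e]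
  rw [h.kernel_apply huK, oneStep_apply u hB, mul_add,
    lintegral_const_mul _ hmdu.ennreal_ofReal]
  by_cases hu' : u ∈ B <;> simp [hu']

/-- The Metropolis walk is reversible. -/
lemma isReversible (h : MetropolisData K f q) : Kernel.IsReversible h.kernel (target K f) := by
  intro A B hA hB
  rw [target, Measure.restrict_smul, Measure.restrict_smul, lintegral_smul_measure,
    lintegral_smul_measure, h.setLIntegral_kernel hA hB, h.setLIntegral_kernel hB hA,
    Set.inter_comm B A]
  congr 2
  have hG : Measurable fun p : E d × E d => ENNReal.ofReal (f p.1 * moveDensity f q p.1 p.2) :=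
    ((h.measurable_density.comp measurable_fst).mul h.measurable_moveDensity).ennreal_ofReal
  rw [lintegral_lintegral_swap hG.aemeasurable]
  rw [Measure.restrict_restrict hB, Measure.restrict_restrict hA]
  refine setLIntegral_congr_fun (hB.inter h.measurableSet) fun u hu => ?_
  refine setLIntegral_congr_fun (hA.inter h.measurableSet) fun x hx => ?_
  rw [h.density_mul_moveDensity hx.2 hu.2, h.density_mul_moveDensity hu.2 hx.2, min_comm]

lemma chainLaw_kernel (h : MetropolisData K f q) {Q₀ : Measure (E d)} (hQ₀ : Q₀ Kᶜ = 0) (t : ℕ) :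
    chainLaw (oneStep K f q) Q₀ t = chainLaw h.kernel Q₀ t ∧
      chainLaw (oneStep K f q) Q₀ t Kᶜ = 0 := by
  induction t with
  | zero => exact ⟨rfl, hQ₀⟩
  | succ t ih =>
    obtain ⟨ih1, ih2⟩ := ih
    have hae : ∀ᵐ x ∂chainLaw (oneStep K f q) Q₀ t, x ∈ K := by rw [ae_iff]; exact ih2
    constructor
    · change Measure.bind _ _ = Measure.bind _ _
      rw [← ih1]
      ext A hA
      rw [Measure.bind_apply hA h.measurable_oneStep.aemeasurable,
        Measure.bind_apply hA h.kernel.aemeasurable]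
      refine lintegral_congr_ae ?_
      filter_upwards [hae] with u hu
      rw [h.kernel_apply hu]
    · change Measure.bind _ _ _ = 0
      rw [Measure.bind_apply h.measurableSet.compl h.measurable_oneStep.aemeasurable,
        ← lintegral_zero (μ := chainLaw (oneStep K f q) Q₀ t)]
      refine lintegral_congr_ae ?_
      filter_upwards [hae] with u hu
      exact h.oneStep_compl hu

/-- There are events of arbitrarily small positive probability: small balls about the origin. -/
lemma exists_small_event (h : MetropolisData K f q) (hd : 1 ≤ d) {R : ℝ} (hR : 0 < R)
    (hK : K = Metric.closedBall 0 R) {ε : ℝ≥0∞} (hε : 0 < ε) :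
    ∃ B, MeasurableSet B ∧ 0 < target K f B ∧ target K f B ≤ ε := by
  have hP := h.isProbabilityMeasure_target
  have : Nonempty (Fin d) := ⟨⟨0, hd⟩⟩
  have h0 : target K f {0} = 0 := target_absolutelyContinuous (by simp)
  have hlim : Tendsto (fun r : ℝ => target K f (Metric.closedBall 0 r)) (𝓝[>] 0) (𝓝 0) := by
    have := tendsto_measure_biInter_gt (μ := target K f) (s := fun r : ℝ =>
      Metric.closedBall (0 : E d) r) (a := 0)
      (fun r _ => Metric.isClosed_closedBall.measurableSet.nullMeasurableSet)
      (fun i j _ hij => Metric.closedBall_subset_closedBall hij)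
      ⟨1, one_pos, measure_ne_top _ _⟩
    have e : ⋂ r > (0 : ℝ), Metric.closedBall (0 : E d) r = {0} := by
      ext x
      simp only [Set.mem_iInter, Metric.mem_closedBall, dist_zero_right, Set.mem_singleton_iff]
      refine ⟨fun hx => norm_le_zero_iff.1 (le_of_forall_gt_imp_ge_of_dense hx), ?_⟩
      rintro rfl r hr
      simpa using hr.le
    rwa [e, h0] at this
  obtain ⟨r, hr, hr0, hrR⟩ := ((hlim.eventually (gt_mem_nhds hε)).and
    (Ioo_mem_nhdsGT hR)).exists
  refine ⟨_, Metric.isClosed_closedBall.measurableSet, ?_, hr.le⟩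
  rw [target, Measure.smul_apply, smul_eq_mul, withDensity_apply _
    Metric.isClosed_closedBall.measurableSet]
  refine ENNReal.mul_pos (ENNReal.inv_ne_zero.2 h.mass_ne_top) (ne_of_gt ?_)
  rw [Measure.restrict_restrict Metric.isClosed_closedBall.measurableSet,
    setLIntegral_pos_iff h.measurable_density.ennreal_ofReal]
  refine (Metric.measure_ball_pos volume (0 : E d) hr0).trans_le (measure_mono fun x hx => ?_)
  have hx1 : x ∈ Metric.closedBall (0 : E d) r := Metric.ball_subset_closedBall hx
  have hxK : x ∈ K := by
    rw [hK]; exact Metric.closedBall_subset_closedBall hrR.le hx1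
  exact ⟨by simpa using h.density_pos x hxK, hx1, hxK⟩

end MetropolisData

end Metropolis

/-! ### Conductance and mixing of the Metropolis walk -/

lemma abs_sub_le_tvDist {X : Type*} [MeasurableSpace X] {μ ν : Measure X}
    [IsProbabilityMeasure μ] [IsProbabilityMeasure ν] {A : Set X} (hA : MeasurableSet A) :
    |μ.real A - ν.real A| ≤ tvDist μ ν := by
  refine le_ciSup (f := fun A : {A : Set X // MeasurableSet A} => |μ.real A.1 - ν.real A.1|)
    ⟨1, ?_⟩ ⟨A, hA⟩
  rintro _ ⟨B, rfl⟩
  have h1 : μ.real B.1 ≤ 1 := measureReal_le_one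
  have h2 : ν.real B.1 ≤ 1 := measureReal_le_one
  have h3 : 0 ≤ μ.real B.1 := measureReal_nonneg
  have h4 : 0 ≤ ν.real B.1 := measureReal_nonneg
  exact abs_le.2 ⟨by linarith, by linarith⟩

lemma SamplesWithin.mono {X : Type*} [MeasurableSpace X] {K : Set X} {P : X → Measure X}
    {Q : Measure X} {b b' : ℝ} (hb : 0 < b) (hbb' : b ≤ b') (h : SamplesWithin K P Q b) :
    SamplesWithin K P Q b' := by
  intro ε M Q₀ hε hε1 hQ₀ hK hM
  obtain ⟨N, hN, ht⟩ := h ε M Q₀ hε hε1 hQ₀ hK hM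
  have hlog : 0 ≤ Real.log (M / ε) := by
    have : 0 ≤ b * Real.log (M / ε) := (Nat.cast_nonneg N).trans hN
    exact nonneg_of_mul_nonneg_right this hb
  exact ⟨N, hN.trans (mul_le_mul_of_nonneg_right hbb' hlog), ht⟩

namespace MetropolisData

variable {d : ℕ} {K : Set (E d)} {f : E d → ℝ} {q : E d → E d → ℝ}

/-- A density on a ball within a constant factor `b` of a Gaussian one inherits the isoperimetric
inequality, up to the factor `b`. -/
lemma target_isoperimetry {R : ℝ} (h : MetropolisData (Metric.closedBall 0 R) f q) (hd : 1 ≤ d)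
    {J : Matrix (Fin d) (Fin d) ℝ} {s a b r : ℝ} (hs : 0 < s)
    (hJ : ∀ x : E d, s ^ 2 * ‖x‖ ^ 2 ≤ quadForm J x) (ha : 0 < a) (hb : 0 < b)
    (hlow : ∀ x ∈ Metric.closedBall (0 : E d) R, a * Real.exp (-(1 / 2) * quadForm J x) ≤ f x)
    (hup : ∀ x ∈ Metric.closedBall (0 : E d) R,
      f x ≤ a * b * Real.exp (-(1 / 2) * quadForm J x))
    (hr : 0 < r) {A B : Set (E d)} (hA : MeasurableSet A) (hB : MeasurableSet B)
    (hAB : ∀ x ∈ A, ∀ y ∈ B, r ≤ ‖x - y‖) :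
    min (s * r) 1 / (48 * b) * min ((target (Metric.closedBall 0 R) f).real A)
      ((target (Metric.closedBall 0 R) f).real B) ≤
      (target (Metric.closedBall 0 R) f).real (A ∪ B)ᶜ := by
  have hγ : IsFiniteMeasure (gaussBall J R) := isFiniteMeasure_gaussBall hJ R
  have hQ := h.isProbabilityMeasure_target
  set Z := ∫⁻ x in Metric.closedBall (0 : E d) R, ENNReal.ofReal (f x) with hZ
  have hZ0 : 0 ≤ (Z⁻¹).toReal := ENNReal.toReal_nonneg
  have hgm : Measurable fun x : E d => ENNReal.ofReal (Real.exp (-(1 / 2) * quadForm J x)) := by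
    have : Continuous fun x : E d => Real.exp (-(1 / 2) * quadForm J x) := by fun_prop
    exact this.measurable.ennreal_ofReal
  have happ : ∀ S : Set (E d), MeasurableSet S → target (Metric.closedBall 0 R) f S =
      Z⁻¹ * ∫⁻ x in S ∩ Metric.closedBall 0 R, ENNReal.ofReal (f x) := fun S hS => by
    rw [target, Measure.smul_apply, withDensity_apply _ hS, Measure.restrict_restrict hS,
      smul_eq_mul]
  have hγapp : ∀ S : Set (E d), MeasurableSet S → ∀ k : ℝ, 0 ≤ k →
      ENNReal.ofReal k * gaussBall J R S = ∫⁻ x in S ∩ Metric.closedBall 0 R,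
        ENNReal.ofReal (k * Real.exp (-(1 / 2) * quadForm J x)) := fun S hS k hk => by
    simp only [ENNReal.ofReal_mul hk]
    rw [lintegral_const_mul _ hgm, gaussBall, withDensity_apply _ hS, Measure.restrict_restrict hS]
  have lower : ∀ S : Set (E d), MeasurableSet S → (Z⁻¹).toReal * (a * (gaussBall J R).real S) ≤
      (target (Metric.closedBall 0 R) f).real S := fun S hS => by
    have : Z⁻¹ * (ENNReal.ofReal a * gaussBall J R S) ≤ target (Metric.closedBall 0 R) f S := by
      rw [happ S hS, hγapp S hS a ha.le]
      gcongr Z⁻¹ * ?_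
      exact setLIntegral_mono' (hS.inter h.measurableSet) fun x hx =>
        ENNReal.ofReal_le_ofReal (hlow x hx.2)
    have := ENNReal.toReal_mono (measure_ne_top _ _) this
    rwa [ENNReal.toReal_mul, ENNReal.toReal_mul, ENNReal.toReal_ofReal ha.le] at this
  have upper : ∀ S : Set (E d), MeasurableSet S → (target (Metric.closedBall 0 R) f).real S ≤
      (Z⁻¹).toReal * (a * b * (gaussBall J R).real S) := fun S hS => by
    have hab : 0 ≤ a * b := by positivity
    have : target (Metric.closedBall 0 R) f S ≤
        Z⁻¹ * (ENNReal.ofReal (a * b) * gaussBall J R S) := by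
      rw [happ S hS, hγapp S hS _ hab]
      gcongr Z⁻¹ * ?_
      exact setLIntegral_mono' (hS.inter h.measurableSet) fun x hx =>
        ENNReal.ofReal_le_ofReal (hup x hx.2)
    have := ENNReal.toReal_mono (ENNReal.mul_ne_top (ENNReal.inv_ne_top.2 h.mass_pos)
      (ENNReal.mul_ne_top ENNReal.ofReal_ne_top (measure_ne_top _ _))) this
    rwa [ENNReal.toReal_mul, ENNReal.toReal_mul, ENNReal.toReal_ofReal hab] at this
  have hiso := gaussBall_isoperimetry hd hs hJ R hr hAB
  set z := (Z⁻¹).toReal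
  set m := min (s * r) 1
  have hm0 : 0 ≤ m := le_min (by positivity) zero_le_one
  have hzab : 0 ≤ z * (a * b) := by positivity
  calc m / (48 * b) *
        min ((target (Metric.closedBall 0 R) f).real A) ((target (Metric.closedBall 0 R) f).real B)
      ≤ m / (48 * b) * (z * (a * b) *
          min ((gaussBall J R).real A) ((gaussBall J R).real B)) := by
        gcongr
        rw [mul_min_of_nonneg _ _ hzab]
        exact min_le_min ((upper A hA).trans_eq (by ring)) ((upper B hB).trans_eq (by ring))
    _ = z * a / 48 * (m * min ((gaussBall J R).real A) ((gaussBall J R).real B)) := by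
        field_simp
    _ ≤ z * a / 48 * (48 * (gaussBall J R).real (A ∪ B)ᶜ) := by gcongr
    _ = z * (a * (gaussBall J R).real (A ∪ B)ᶜ) := by ring
    _ ≤ _ := lower _ (hA.union hB).compl

lemma inv_conductance_le (h : MetropolisData K f q) {k : ℝ} (hk : 0 < k)
    (hflow : ∀ A, MeasurableSet A → k * min ((target K f).real A) ((target K f).real Aᶜ) ≤
      ∫ x in A, (h.kernel x).real Aᶜ ∂(target K f)) :
    (conductance K (oneStep K f q) (target K f))⁻¹ ≤ ENNReal.ofReal (1 / k) := by
  have hQ := h.isProbabilityMeasure_target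
  have key : ENNReal.ofReal k ≤ conductance K (oneStep K f q) (target K f) := by
    refine le_iInf fun A => le_iInf fun hA => le_iInf fun hAK => le_iInf fun hA0 =>
      le_iInf fun hA1 => ?_
    have hKA : target K f (K \ A) = target K f Aᶜ := by
      refine measure_congr ?_
      have hae : ∀ᵐ x ∂target K f, x ∈ K := by rw [ae_iff]; exact h.target_compl
      filter_upwards [hae] with x hx
      exact propext ⟨fun hx' => hx'.2, fun hx' => ⟨hx, hx'⟩⟩
    have hAc : target K f Aᶜ ≠ 0 := by
      rw [prob_compl_eq_one_sub hA]; exact (tsub_pos_of_lt hA1).ne'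
    rw [hKA, ENNReal.le_div_iff_mul_le
      (Or.inl (lt_min hA0 (pos_iff_ne_zero.2 hAc)).ne')
      (Or.inl (ne_top_of_le_ne_top (measure_ne_top (target K f) A) (min_le_left _ _)))]
    have hflowA : ergodicFlow K (oneStep K f q) (target K f) A =
        ENNReal.ofReal (∫ x in A, (h.kernel x).real Aᶜ ∂(target K f)) := by
      have hm : Measurable fun x => (h.kernel x).real Aᶜ := measurable_kernel_real hA.compl
      rw [ofReal_integral_eq_lintegral_ofReal
        (integrable_of_abs_le (μ := (target K f).restrict A) hm (B := 1) fun x => by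
          rw [abs_of_nonneg measureReal_nonneg]; exact measureReal_le_one)
        (ae_of_all _ fun x => measureReal_nonneg), ergodicFlow]
      refine setLIntegral_congr_fun hA fun u hu => ?_
      have hnull : ∀ᵐ x ∂oneStep K f q u, x ∈ K := by
        rw [ae_iff]; exact h.oneStep_compl (hAK hu)
      change _ = ENNReal.ofReal ((h.kernel u).real Aᶜ)
      rw [ofReal_measureReal, h.kernel_apply (hAK hu)]
      refine measure_congr ?_
      filter_upwards [hnull] with x hx
      exact propext ⟨fun hx' => hx'.2, fun hx' => ⟨hx, hx'⟩⟩
    rw [hflowA]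
    refine le_trans (le_of_eq ?_) (ENNReal.ofReal_le_ofReal (hflow A hA))
    rw [ENNReal.ofReal_mul hk.le, ENNReal.ofReal_min, ofReal_measureReal, ofReal_measureReal]
  rw [one_div, ENNReal.ofReal_inv_of_pos hk]
  exact ENNReal.inv_le_inv.2 key

lemma samplesWithin (h : MetropolisData K f q)
    (hsmall : ∀ ε : ℝ≥0∞, 0 < ε → ∃ B, MeasurableSet B ∧ 0 < target K f B ∧ target K f B ≤ ε)
    {φ : ℝ} (hφ : 0 < φ) (hφ1 : φ ≤ 1)
    (hflow : ∀ A, MeasurableSet A → φ * min ((target K f).real A) ((target K f).real Aᶜ) ≤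
      ∫ x, (h.kernel x).real A * (h.kernel x).real Aᶜ ∂(target K f)) :
    SamplesWithin K (oneStep K f q) (target K f) (6 / φ ^ 2) := by
  intro ε M Q₀ hε hε1 hQ₀ hQ₀K hw
  have hQ := h.isProbabilityMeasure_target
  obtain ⟨hM, g, hg, hg0, hgM, hg1, hQ₀g⟩ := hw.exists_density hsmall
  have hM0 : 0 < M := by linarith
  have htv : ∀ t, tvDist (chainLaw (oneStep K f q) Q₀ t) (target K f) ≤
      Real.sqrt (M * (1 - φ ^ 2 / 2) ^ t) ∧
      tvDist (chainLaw (oneStep K f q) Q₀ t) (target K f) ≤ 1 - 1 / M := fun t => by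
    rw [(h.chainLaw_kernel hQ₀K t).1, hQ₀g]
    exact tvDist_chainLaw_le h.isReversible hφ hφ1 hflow hg hg0 hgM hg1 t
  set L := Real.log (M / ε) with hL
  have hMε : 0 < M / ε := by positivity
  have hLpos : 0 < L := Real.log_pos (by rw [one_lt_div hε]; linarith)
  have hφ2 : 0 < φ ^ 2 := by positivity
  have hφ21 : φ ^ 2 ≤ 1 := pow_le_one₀ hφ.le hφ1
  rcases le_or_gt L (1 / 2) with hL2 | hL2
  · -- the starting distribution is within `1 - 1 / M ≤ ε` of the target already
    refine ⟨0, by rw [Nat.cast_zero]; positivity, fun t _ => (htv t).2.trans ?_⟩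
    have h1 : M / ε ≤ Real.exp (1 / 2) := (Real.log_le_iff_le_exp hMε).1 hL2
    have h2 : Real.exp (1 / 2) ≤ 2 := by
      have h3 : Real.exp (1 / 2) ^ 2 = Real.exp 1 := by
        rw [← Real.exp_nat_mul]; norm_num
      have := Real.exp_one_lt_d9
      nlinarith [Real.exp_pos (1 / 2)]
    have h4 : M ≤ 2 * ε := by
      have := h1.trans h2
      rwa [div_le_iff₀ hε] at this
    have h5 : (2 : ℝ) - M ≤ 1 / M := by
      rw [le_div_iff₀ hM0]; nlinarith [sq_nonneg (M - 1)]
    have h6 : 1 / (2 * ε) ≤ 1 / M := one_div_le_one_div_of_le hM0 h4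
    have h7 : 1 - ε ≤ 1 / (2 * ε) := by
      rw [le_div_iff₀ (by positivity)]; nlinarith [sq_nonneg (2 * ε - 1)]
    linarith
  · refine ⟨⌈4 / φ ^ 2 * L⌉₊, ?_, fun t ht => (htv t).1.trans ?_⟩
    -- rounding up costs at most `1 ≤ 2 / φ ^ 2 * L`
    · have h1 : (⌈4 / φ ^ 2 * L⌉₊ : ℝ) < 4 / φ ^ 2 * L + 1 := Nat.ceil_lt_add_one (by positivity)
      have h2 : 1 ≤ 2 / φ ^ 2 * L := by
        rw [div_mul_eq_mul_div, le_div_iff₀ hφ2]; linarith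
      calc (⌈4 / φ ^ 2 * L⌉₊ : ℝ) ≤ 4 / φ ^ 2 * L + 2 / φ ^ 2 * L := by linarith
        _ = 6 / φ ^ 2 * L := by ring
    · have ht' : 4 / φ ^ 2 * L ≤ t := (Nat.le_ceil _).trans (by exact_mod_cast ht)
      rw [Real.sqrt_le_iff]
      refine ⟨hε.le, ?_⟩
      have h1 : (1 - φ ^ 2 / 2) ^ t ≤ Real.exp (-(2 * L)) := by
        calc (1 - φ ^ 2 / 2) ^ t ≤ Real.exp (-(φ ^ 2 / 2)) ^ t := by
              gcongr
              · linarith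
              · linarith [Real.add_one_le_exp (-(φ ^ 2 / 2))]
          _ = Real.exp (-(φ ^ 2 / 2 * t)) := by rw [← Real.exp_nat_mul]; ring_nf
          _ ≤ Real.exp (-(2 * L)) := by
              refine Real.exp_le_exp.2 (neg_le_neg ?_)
              calc 2 * L = φ ^ 2 / 2 * (4 / φ ^ 2 * L) := by field_simp; ring
                _ ≤ φ ^ 2 / 2 * t := by gcongr
      have h2 : Real.exp (-(2 * L)) = (ε / M) ^ 2 := by
        rw [Real.exp_neg, two_mul, Real.exp_add, hL, Real.exp_log hMε]
        field_simp
      calc M * (1 - φ ^ 2 / 2) ^ t ≤ M * (ε / M) ^ 2 := by rw [← h2]; gcongr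
        _ = ε ^ 2 / M := by field_simp
        _ ≤ ε ^ 2 := div_le_self (by positivity) hM

/-- The deterministic bounds on conductance and mixing. -/
lemma conductance_and_mixing {R : ℝ} (hR : 0 < R)
    (h : MetropolisData (Metric.closedBall 0 R) f q) (hd : 1 ≤ d)
    {J : Matrix (Fin d) (Fin d) ℝ} (hJ : J.PosDef) {a D r c : ℝ} (ha : 0 < a) (hD : 0 ≤ D)
    (hlow : ∀ x ∈ Metric.closedBall (0 : E d) R, a * Real.exp (-(1 / 2) * quadForm J x) ≤ f x)
    (hup : ∀ x ∈ Metric.closedBall (0 : E d) R,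
      f x ≤ a * Real.exp (2 * D) * Real.exp (-(1 / 2) * quadForm J x))
    (hr : 0 < r) (hc : 0 < c)
    (hover : ∀ u ∈ Metric.closedBall (0 : E d) R, ∀ v ∈ Metric.closedBall (0 : E d) R,
      ‖u - v‖ ≤ r → tvDist (oneStep (Metric.closedBall 0 R) f q u)
        (oneStep (Metric.closedBall 0 R) f q v) < 1 - c) :
    (conductance (Metric.closedBall 0 R) (oneStep (Metric.closedBall 0 R) f q)
        (target (Metric.closedBall 0 R) f))⁻¹ ≤
      ENNReal.ofReal (288 * (Real.exp (2 * D) / (c * min (r * Real.sqrt (lambdaMin J)) 1))) ∧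
    SamplesWithin (Metric.closedBall 0 R) (oneStep (Metric.closedBall 0 R) f q)
      (target (Metric.closedBall 0 R) f)
      (6 * 480 ^ 2 * (Real.exp (4 * D) / (c * min (r * Real.sqrt (lambdaMin J)) 1) ^ 2)) := by
  have hQ := h.isProbabilityMeasure_target
  set K := Metric.closedBall (0 : E d) R with hK
  set s := Real.sqrt (lambdaMin J) with hs
  have hlam := lambdaMin_pos hd hJ
  have hs0 : 0 < s := Real.sqrt_pos.2 hlam
  have hJs : ∀ x : E d, s ^ 2 * ‖x‖ ^ 2 ≤ quadForm J x := fun x => by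
    rw [hs, Real.sq_sqrt hlam.le]; exact lambdaMin_mul_le_quadForm hJ x
  set b := Real.exp (2 * D) with hb
  have hb1 : 1 ≤ b := Real.one_le_exp (by linarith)
  have hb0 : 0 < b := by linarith
  set m := min (r * s) 1 with hm
  have hm0 : 0 < m := lt_min (by positivity) one_pos
  have hm1 : m ≤ 1 := min_le_right _ _
  have hov : ∀ u ∈ K, ∀ v ∈ K, ‖u - v‖ ≤ r → ∀ A, MeasurableSet A →
      (h.kernel u).real A - (h.kernel v).real A < 1 - c := fun u hu v hv huv A hA => by
    have h1 := h.isProbabilityMeasure_oneStep hu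
    have h2 := h.isProbabilityMeasure_oneStep hv
    rw [h.kernel_apply hu, h.kernel_apply hv]
    exact ((le_abs_self _).trans (abs_sub_le_tvDist hA)).trans_lt (hover u hu v hv huv)
  -- the overlap condition for `u = v`
  have hc1 : c ≤ 1 := by
    have h0 : (0 : E d) ∈ K := by simpa [hK] using hR.le
    have := hov 0 h0 0 h0 (by simpa using hr.le) ∅ MeasurableSet.empty
    simp only [measureReal_empty, sub_self] at this
    linarith
  set τ := m / (48 * b) with hτ
  have hτ0 : 0 < τ := by positivity
  have hτ1 : τ ≤ 1 := by rw [hτ, div_le_one (by positivity)]; linarith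
  have hiso : ∀ A B, MeasurableSet A → MeasurableSet B → (∀ x ∈ A, ∀ y ∈ B, r ≤ ‖x - y‖) →
      τ * min ((target K f).real A) ((target K f).real B) ≤ (target K f).real (A ∪ B)ᶜ :=
    fun A B hA hB hAB => by
      have := h.target_isoperimetry hd hs0 hJs ha hb0 hlow hup hr hA hB hAB
      rwa [mul_comm s r] at this
  constructor
  · have hk : 0 < τ * c / 6 := by positivity
    refine (h.inv_conductance_le hk (flow_ge h.isReversible.invariant h.measurableSet h.target_compl
      hc hτ0.le hτ1 hov hiso)).trans_eq ?_
    congr 1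
    rw [hτ]; field_simp; norm_num
  · have hφ : 0 < τ * c / 10 := by positivity
    have hφ1 : τ * c / 10 ≤ 1 := by nlinarith
    have := h.samplesWithin (fun ε hε => h.exists_small_event hd hR hK hε) hφ hφ1
      (two_step_flow_ge h.isReversible.invariant h.measurableSet h.target_compl hc hc1 hτ0.le hτ1
        hov hiso)
    convert this using 1
    have e : Real.exp (4 * D) = b ^ 2 := by rw [hb, ← Real.exp_nat_mul]; ring_nf
    rw [hτ, e]; field_simp; norm_num

end MetropolisData

/-! ### The quasi-posterior -/

lemma quadForm_le_setNormJ_sq {d : ℕ} {J : Matrix (Fin d) (Fin d) ℝ} (hJ : J.PosDef)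
    {K : Set (E d)} (hK : IsCompact K) {x : E d} (hx : x ∈ K) :
    quadForm J x ≤ setNormJ J K ^ 2 := by
  have h0 : 0 ≤ quadForm J x := by
    have h1 := lambdaMin_mul_le_quadForm hJ x
    rcases Nat.eq_zero_or_pos d with rfl | hd
    · have : x = 0 := Subsingleton.elim _ _
      subst this; simpa using h1
    · exact le_trans (mul_nonneg (lambdaMin_pos hd hJ).le (sq_nonneg _)) h1
  have hcont : Continuous (ellNorm J) := (continuous_quadForm J).sqrt
  have h1 : ellNorm J x ≤ setNormJ J K :=
    le_csSup (hK.image hcont).bddAbove (Set.mem_image_of_mem _ hx)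
  have h2 : 0 ≤ ellNorm J x := Real.sqrt_nonneg _
  have h3 : quadForm J x = ellNorm J x ^ 2 := (Real.sq_sqrt h0).symm
  rw [h3]
  exact pow_le_pow_left₀ h2 h1 2

lemma measurable_indicator_of_lowerSemicontinuousOn {X : Type*} [TopologicalSpace X]
    [MeasurableSpace X] [BorelSpace X] {s : Set X} (hs : MeasurableSet s) {g : X → ℝ}
    (hg : LowerSemicontinuousOn g s) : Measurable (s.indicator g) := by
  refine measurable_of_restrict_of_restrict_compl hs ?_ ?_
  · have e : s.domRestrict (s.indicator g) = s.domRestrict g := by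
      funext x; exact Set.indicator_of_mem x.2 g
    rw [e]
    exact (lowerSemicontinuous_restrict_iff.2 hg).measurable
  · have e : sᶜ.domRestrict (s.indicator g) = fun _ => 0 := by
      funext x; exact Set.indicator_of_notMem x.2 g
    rw [e]
    exact measurable_const

namespace Setup

variable {Ω : ℕ+ → Type u} (S : Setup Ω)

lemma measurableSet_Lam (n : ℕ+) (ω : Ω n) (hΘ : MeasurableSet (S.Θ n)) :
    MeasurableSet (S.Lam n ω) := by
  have hn : Real.sqrt (n : ℕ) ≠ 0 := (Real.sqrt_pos.2 (by exact_mod_cast n.pos)).ne'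
  rw [Lam, Set.image_eq_preimage_of_inverse
    (g := fun x => (Real.sqrt (n : ℕ))⁻¹ • (x + S.s n ω) + S.θ₀ n)]
  · have : Continuous fun x : E (S.d n) =>
        (Real.sqrt (n : ℕ))⁻¹ • (x + S.s n ω) + S.θ₀ n := by fun_prop
    exact this.measurable hΘ
  · intro x
    simp only [sub_add_cancel]
    rw [smul_smul, inv_mul_cancel₀ hn, one_smul, sub_add_cancel]
  · intro x
    simp only [add_sub_cancel_right]
    rw [smul_smul, mul_inv_cancel₀ hn, one_smul, add_sub_cancel_right]

variable [∀ n, MeasurableSpace (Ω n)] {P : ∀ n, Measure (Ω n)}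

/-- For almost every sample, the bounds on conductance and mixing time. -/
lemma conductance_and_mixing_ae (h0 : S.Standing P) (h1 : S.C1 P) (h2 : S.C2 P) (h3 : S.D1 P)
    (n : ℕ+) : ∀ᵐ ω ∂P n, 0 < S.geo n ω ∧
      (S.cond n ω)⁻¹ ≤ ENNReal.ofReal (288 * (Real.exp (2 * S.dev n ω) / S.geo n ω)) ∧
      SamplesWithin (S.K n) (S.step n ω) (S.Q n ω)
        (6 * 480 ^ 2 * (Real.exp (4 * S.dev n ω) / S.geo n ω ^ 2)) := by
  filter_upwards [h0.ℓ_nonneg n, h0.ℓ_integrable n, h0.q_measurable n, h0.q_nonneg n,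
    h0.q_density n, h1.K_subset n, h2.ε₁_pos n, h2.ε₂_pos n, h2.ℓ_lsc n, h2.ℓ_approx n, h3.h_pos n,
    h3.c_pos n, h3.overlap n] with ω hℓ0 hℓi hqm hq0 hq1 hKΛ hε₁ hε₂ hlsc happrox hh hc hover
  have hd := h0.d_pos n
  have hR := h1.R_pos n
  have hJ := h2.J_posDef n
  have hΛ := S.measurableSet_Lam n ω (h0.measurable_Θ n)
  have hKm : MeasurableSet (S.K n) := Metric.isClosed_closedBall.measurableSet
  have hKvol : 0 < volume (S.K n) := Metric.measure_closedBall_pos _ _ hR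
  set Z := ∫ y in S.Lam n ω, S.ℓ n ω y with hZ
  have hZpos : 0 < Z := by
    rw [hZ, setIntegral_pos_iff_support_of_nonneg_ae (ae_restrict_of_forall_mem hΛ hℓ0) hℓi]
    exact hKvol.trans_le (measure_mono fun x hx => ⟨(happrox x hx).1.ne', hKΛ hx⟩)
  have hf : ∀ x ∈ S.K n, S.f n ω x = S.ℓ n ω x / Z := fun x hx =>
    Set.indicator_of_mem (hKΛ hx) _
  have hf_eq : S.f n ω = fun x => (S.Lam n ω).indicator (S.ℓ n ω) x / Z := by
    funext x
    by_cases hx : x ∈ S.Lam n ω <;> simp [Setup.f, hx, hZ]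
  have hdata : MetropolisData (S.K n) (S.f n ω) (S.q n ω) :=
    { measurableSet := hKm
      volume_pos := hKvol
      measurable_density := by
        rw [hf_eq]
        exact (measurable_indicator_of_lowerSemicontinuousOn hΛ hlsc).div_const Z
      density_pos := fun x hx => by
        rw [hf x hx]; exact div_pos (happrox x hx).1 hZpos
      integrableOn := by
        rw [hf_eq]
        exact ((integrable_indicator_iff hΛ).2 hℓi).integrableOn.div_const Z
      measurable_proposal := hqm
      proposal_nonneg := hq0
      lintegral_proposal := hq1 }
  have hD : ∀ x ∈ S.K n, S.ε₁ n ω + S.ε₂ n ω * quadForm (S.J n) x / 2 ≤ S.dev n ω := fun x hx => by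
    have := quadForm_le_setNormJ_sq hJ (isCompact_closedBall (0 : E (S.d n)) (S.R n)) hx
    unfold dev
    gcongr
    exact this
  have hD0 : 0 ≤ S.dev n ω := by unfold dev; positivity
  have hlog : ∀ x ∈ S.K n,
      Real.exp (-S.dev n ω + -(1 / 2) * quadForm (S.J n) x) ≤ S.ℓ n ω x ∧
      S.ℓ n ω x ≤ Real.exp (S.dev n ω + -(1 / 2) * quadForm (S.J n) x) := fun x hx => by
    obtain ⟨hp, ha⟩ := happrox x hx
    obtain ⟨hl, hu⟩ := abs_le.1 (ha.trans (hD x hx))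
    exact ⟨(Real.le_log_iff_exp_le hp).1 (by linarith), (Real.log_le_iff_le_exp hp).1 (by linarith)⟩
  have hlam := Real.sqrt_pos.2 (lambdaMin_pos hd hJ)
  refine ⟨mul_pos hc (lt_min (mul_pos hh hlam) one_pos), ?_⟩
  refine MetropolisData.conductance_and_mixing hR hdata hd hJ
    (a := Real.exp (-S.dev n ω) / Z) (D := S.dev n ω) (r := S.h n ω) (c := S.c n ω)
    (by positivity) hD0 (fun x hx => ?_) (fun x hx => ?_) hh hc hover
  · rw [hf x hx, div_mul_eq_mul_div, ← Real.exp_add]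
    exact div_le_div_of_nonneg_right (hlog x hx).1 hZpos.le
  · rw [hf x hx, div_mul_eq_mul_div, div_mul_eq_mul_div, ← Real.exp_add, ← Real.exp_add]
    refine div_le_div_of_nonneg_right ((hlog x hx).2.trans_eq ?_) hZpos.le
    congr 1; ring

/-- Outside an event of small probability, the approximation errors are small and the geometric
quantity is of the order of the dimension. -/
lemma exists_bound_geo (h2 : S.C3 P) (h3 : S.D2 P) {η : ℝ} (hη : 0 < η) :
    ∃ B : ℝ, 0 < B ∧ ∀ᶠ n in atTop, P n {ω | ¬ (S.dev n ω ≤ 1 / 2 ∧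
      ENNReal.ofReal (1 / S.geo n ω) ≤ ENNReal.ofReal (B * S.d n))} ≤ ENNReal.ofReal η := by
  obtain ⟨B, hB, hgeo⟩ := h3 (η / 3) (by positivity)
  refine ⟨B, hB, ?_⟩
  have hη3 : 0 < ENNReal.ofReal (η / 3) := ENNReal.ofReal_pos.2 (by positivity)
  filter_upwards [hgeo, ENNReal.tendsto_nhds_zero.1 (h2.ε₁_small (1 / 4) (by norm_num)) _ hη3,
    ENNReal.tendsto_nhds_zero.1 (h2.ε₂_small (1 / 4) (by norm_num)) _ hη3] with n hn1 hn2 hn3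
  set E₁ := {ω | 1 / 4 < |S.ε₁ n ω|}
  set E₂ := {ω | 1 / 4 < |S.ε₂ n ω * setNormJ (S.J n) (S.K n) ^ 2|}
  set E₃ := {ω | ENNReal.ofReal (B * S.d n) < ENNReal.ofReal (1 / S.geo n ω)}
  calc _ ≤ P n (E₁ ∪ E₂ ∪ E₃) := by
        refine measure_mono fun ω hω => ?_
        by_contra hE
        simp only [Set.mem_union, not_or] at hE
        obtain ⟨⟨hE1, hE2⟩, hE3⟩ := hE
        refine hω ⟨?_, not_lt.1 hE3⟩
        have h4 : |S.ε₁ n ω| ≤ 1 / 4 := not_lt.1 hE1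
        have h5 : |S.ε₂ n ω * setNormJ (S.J n) (S.K n) ^ 2| ≤ 1 / 4 := not_lt.1 hE2
        unfold dev
        linarith [le_of_abs_le h4, le_of_abs_le h5]
    _ ≤ P n E₁ + P n E₂ + P n E₃ :=
        (measure_union_le _ _).trans (add_le_add_left (measure_union_le _ _) _)
    _ ≤ ENNReal.ofReal (η / 3) + ENNReal.ofReal (η / 3) + ENNReal.ofReal (η / 3) := by gcongr
    _ = ENNReal.ofReal η := by
        rw [← ENNReal.ofReal_add (by positivity) (by positivity),
          ← ENNReal.ofReal_add (by positivity) (by positivity)]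
        congr 1; ring

/-- The nonasymptotic bounds, with the errors and the geometric quantity controlled in
probability, give the rates in the dimension. -/
lemma rates (h0 : S.Standing P) (h1 : S.C1 P) (h2 : S.C2 P) (h3 : S.D1 P) (h4 : S.C3 P)
    (h5 : S.D2 P) {η : ℝ} (hη : 0 < η) :
    ∃ B : ℝ, 0 < B ∧ ∀ᶠ n in atTop, P n {ω | ¬ ((S.cond n ω)⁻¹ ≤ ENNReal.ofReal (B * S.d n) ∧
      SamplesWithin (S.K n) (S.step n ω) (S.Q n ω) (B * (S.d n : ℝ) ^ 2))} ≤
      ENNReal.ofReal η := by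
  obtain ⟨B, hB, hev⟩ := S.exists_bound_geo h4 h5 hη
  refine ⟨max (288 * (3 * B)) (6 * 480 ^ 2 * (9 * B ^ 2)), lt_max_of_lt_left (by positivity), ?_⟩
  filter_upwards [hev] with n hn
  refine le_trans (measure_mono_ae ?_) hn
  filter_upwards [S.conductance_and_mixing_ae h0 h1 h2 h3 n] with ω hω hbad
  refine fun hgood => hbad ?_
  obtain ⟨hdev, hle⟩ := hgood
  obtain ⟨hgeo, hcond, hmix⟩ := hω
  have hd : (0 : ℝ) < S.d n := by exact_mod_cast h0.d_pos n
  have hg : 1 / S.geo n ω ≤ B * S.d n := (ENNReal.ofReal_le_ofReal_iff (by positivity)).1 hle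
  have hg0 : 0 < 1 / S.geo n ω := by positivity
  have he : Real.exp 1 ≤ 3 := by linarith [Real.exp_one_lt_d9]
  have he2 : Real.exp (2 * S.dev n ω) ≤ 3 :=
    (Real.exp_le_exp.2 (by linarith)).trans he
  have he4 : Real.exp (4 * S.dev n ω) ≤ 9 := by
    have : Real.exp (4 * S.dev n ω) = Real.exp (2 * S.dev n ω) ^ 2 := by
      rw [← Real.exp_nat_mul]; ring_nf
    rw [this]; nlinarith [Real.exp_pos (2 * S.dev n ω)]
  refine ⟨hcond.trans (ENNReal.ofReal_le_ofReal ?_), hmix.mono (by positivity) ?_⟩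
  · calc 288 * (Real.exp (2 * S.dev n ω) / S.geo n ω)
        = 288 * (Real.exp (2 * S.dev n ω) * (1 / S.geo n ω)) := by ring
      _ ≤ 288 * (3 * (B * S.d n)) := by gcongr
      _ = 288 * (3 * B) * S.d n := by ring
      _ ≤ _ := by gcongr; exact le_max_left _ _
  · calc 6 * 480 ^ 2 * (Real.exp (4 * S.dev n ω) / S.geo n ω ^ 2)
        = 6 * 480 ^ 2 * (Real.exp (4 * S.dev n ω) * (1 / S.geo n ω) ^ 2) := by ring
      _ ≤ 6 * 480 ^ 2 * (9 * (B * S.d n) ^ 2) := by gcongr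
      _ = 6 * 480 ^ 2 * (9 * B ^ 2) * (S.d n : ℝ) ^ 2 := by ring
      _ ≤ _ := by gcongr; exact le_max_right _ _

end Setup

end QuasiBayes

end

theorem theorem2 :
    ∃ C : ℝ, 0 < C ∧
      ∀ (Ω : ℕ+ → Type u) [∀ n, MeasurableSpace (Ω n)] (P : ∀ n, Measure (Ω n))
        [∀ n, IsProbabilityMeasure (P n)] (S : QuasiBayes.Setup Ω),
        S.Standing P → S.C1 P → S.C2 P → S.D1 P →
          (∀ n, ∀ᵐ ω ∂P n,
            (S.cond n ω)⁻¹ ≤ ENNReal.ofReal (C * (Real.exp (2 * S.dev n ω) / S.geo n ω))) ∧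
          (∀ n, ∀ᵐ ω ∂P n,
            QuasiBayes.SamplesWithin (S.K n) (S.step n ω) (S.Q n ω)
              (C * (Real.exp (4 * S.dev n ω) / S.geo n ω ^ 2))) ∧
          (S.C3 P → S.D2 P →
            QuasiBayes.IsBigOp P (fun n ω => (S.cond n ω)⁻¹) (fun n => (S.d n : ℝ)) ∧
            ∀ η : ℝ, 0 < η → ∃ B : ℝ, 0 < B ∧ ∀ᶠ n in atTop,
              P n {ω | ¬ QuasiBayes.SamplesWithin (S.K n) (S.step n ω) (S.Q n ω)
                (B * (S.d n : ℝ) ^ 2)} ≤ ENNReal.ofReal η) := by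
  refine ⟨6 * 480 ^ 2, by norm_num, fun Ω _ P _ S h0 h1 h2 h3 => ⟨fun n => ?_, fun n => ?_,
    fun h4 h5 => ⟨fun η hη => ?_, fun η hη => ?_⟩⟩⟩
  · filter_upwards [S.conductance_and_mixing_ae h0 h1 h2 h3 n] with ω hω
    have hgeo := hω.1
    refine hω.2.1.trans (ENNReal.ofReal_le_ofReal ?_)
    gcongr
    norm_num
  · filter_upwards [S.conductance_and_mixing_ae h0 h1 h2 h3 n] with ω hω using hω.2.2
  · obtain ⟨B, hB, hev⟩ := S.rates h0 h1 h2 h3 h4 h5 hη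
    refine ⟨B, hB, hev.mono fun n hn => le_trans (measure_mono ?_) hn⟩
    exact fun ω hω hgood => absurd hgood.1 (not_le.2 hω)
  · obtain ⟨B, hB, hev⟩ := S.rates h0 h1 h2 h3 h4 h5 hη
    refine ⟨B, hB, hev.mono fun n hn => le_trans (measure_mono ?_) hn⟩
    exact fun ω hω hgood => hω hgood.2
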